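/- Conventions. Let $n\ge 1$. The Fourier transform on $\mathbb{R}^n$ is $\mathcal{F}f(\xi)=(2\pi)^{-n/2}\int_{\mathbb{R}^n} f(x)e^{-ix\cdot\xi}\,dx$, extended to tempered distributions as usual. Fix a window $\rho\in C_0^\infty(\mathbb{R}^n)$ with values in $[0,1]$, supported in $[-1,1]^n$ and equal to $1$ on $[-\tfrac12,\tfrac12]^n$. For $k\in\mathbb{Z}^n$ put \[ \sigma_k(\xi)=\rho(\xi-k)\Big(\sum_{l\in\mathbb{Z}^n}\rho(\xi-l)\Big)^{-1},\qquad \Box_k=\mathcal{F}^{-1}\big(\sigma_k\,\mathcal{F}(\cdot)\big). \] For $s>0$ and $1\le p,q\le\infty$, the Gevrey-modulation space $\mathcal{GM}^s_{p,q}(\mathbb{R}^n)$ is the set of all $f\in L^p(\mathbb{R}^n)$ with \[ \|f\|_{\mathcal{GM}^s_{p,q}}=\Big(\sum_{k\in\mathbb{Z}^n}e^{q|k|^{1/s}}\,\|\Box_kf\|_{L^p}^q\Big)^{1/q}<\infty \] (with the supremum $\sup_k e^{|k|^{1/s}}\|\Box_kf\|_{L^p}$ if $q=\infty$), where $|k|$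 is the Euclidean norm. Theorem. Let $s>1$, $1<p<\infty$ and $1\le q\le\infty$. Let $\mu$ be a complex measure on $\mathbb{R}$ with $\mu(\mathbb{R})=0$ and \[ \int_{\mathbb{R}}e^{\lambda\,|\xi|^{1/s}\log|\xi|}\,d|\mu|(\xi)<\infty\qquad\text{for every }\lambda>0 \] (the integrand is read as $1$ at $\xi=0$). Let $f$ be the inverse Fourier transform of $\mu$, that is, \[ f(t)=\frac1{\sqrt{2\pi}}\int_{\mathbb{R}}e^{i\xi t}\,d\mu(\xi),\qquad t\in\mathbb{R}. \] Then $f\in C^\infty(\mathbb{R})$, and for every real-valued $u\in\mathcal{GM}^s_{p,q}(\mathbb{R}^n)$ the (in general complex-valued) composition $f\circ u$ belongs to $\mathcal{GM}^s_{p,q}(\mathbb{R}^n)$. -/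

import Mathlib

open MeasureTheory SchwartzMap
open scoped ENNReal ContDiff

noncomputable section

/-- The lattice point `k ∈ ℤⁿ`, viewed as a point of the Euclidean space `ℝⁿ`. -/
def latticePoint {n : ℕ} (k : Fin n → ℤ) : EuclideanSpace ℝ (Fin n) :=
  WithLp.toLp 2 (fun i => (k i : ℝ))

/-- Admissible windows `ρ : ℝⁿ → [0, 1]`: smooth, supported in the cube `[-1, 1]ⁿ`, and equal to
`1` on the cube `[-1/2, 1/2]ⁿ`. -/
structure IsWindow {n : ℕ} (ρ : EuclideanSpace ℝ (Fin n) → ℝ) : Prop where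
  contDiff : ContDiff ℝ ∞ ρ
  nonneg : ∀ ξ, 0 ≤ ρ ξ
  le_one : ∀ ξ, ρ ξ ≤ 1
  tsupport_subset : tsupport ρ ⊆ {ξ | ∀ i, |ξ i| ≤ 1}
  eq_one : ∀ ξ : EuclideanSpace ℝ (Fin n), (∀ i, |ξ i| ≤ 1 / 2) → ρ ξ = 1

/-- The uniform decomposition of unity `σ_k(ξ) = ρ(ξ - k) / ∑_l ρ(ξ - l)`, `k ∈ ℤⁿ`. For each `ξ`
the sum in the denominator has only finitely many nonzero terms, and it is at least `1`. -/
def uniformPartition {n : ℕ} (ρ : EuclideanSpace ℝ (Fin n) → ℝ) (k : Fin n → ℤ)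
    (ξ : EuclideanSpace ℝ (Fin n)) : ℝ :=
  ρ (ξ - latticePoint k) / ∑' l : Fin n → ℤ, ρ (ξ - latticePoint l)

/-- The uniform decomposition operator `□_k = F⁻¹ σ_k F` on tempered distributions, for the Fourier
transform `F f(ξ) = (2π)^(-n/2) ∫ f(x) e^(-i x·ξ) dx`. Mathlib's Fourier transform has the kernel
`e^(-2πi x·ξ)`; in terms of it, `□_k` is the Fourier multiplier with symbol `ξ ↦ σ_k(2πξ)`. -/
def boxOp {n : ℕ} (ρ : EuclideanSpace ℝ (Fin n) → ℝ) (k : Fin n → ℤ) :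
    𝓢'(EuclideanSpace ℝ (Fin n), ℂ) →L[ℂ] 𝓢'(EuclideanSpace ℝ (Fin n), ℂ) :=
  TemperedDistribution.fourierMultiplierCLM ℂ
    (fun ξ => (uniformPartition ρ k ((2 * Real.pi) • ξ) : ℂ))

/-- The `L^p` norm of a tempered distribution: the norm of the `L^p` function that represents it
(such a function is unique), and `∞` if there is none. -/
def distLpNorm {n : ℕ} (p : ℝ≥0∞) [Fact (1 ≤ p)] (T : 𝓢'(EuclideanSpace ℝ (Fin n), ℂ)) : ℝ≥0∞ :=
  ⨅ (g : Lp ℂ p (volume : Measure (EuclideanSpace ℝ (Fin n))))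
    (_ : Lp.toTemperedDistribution g = T), ‖g‖ₑ

/-- The norm of the Gevrey-modulation space `GM^s_{p,q}(ℝⁿ)` (with values in `[0, ∞]`):
`(∑_k e^(q |k|^(1/s)) ‖□_k f‖_{L^p}^q)^(1/q)` for `q < ∞`, and
`sup_k e^(|k|^(1/s)) ‖□_k f‖_{L^p}` for `q = ∞`. -/
def gevreyModulationNorm {n : ℕ} (ρ : EuclideanSpace ℝ (Fin n) → ℝ) (s : ℝ) (p q : ℝ≥0∞)
    [Fact (1 ≤ p)] (f : Lp ℂ p (volume : Measure (EuclideanSpace ℝ (Fin n)))) : ℝ≥0∞ :=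
  if q = ⊤ then
    ⨆ k : Fin n → ℤ, ENNReal.ofReal (Real.exp (‖latticePoint k‖ ^ (1 / s))) *
      distLpNorm p (boxOp ρ k (Lp.toTemperedDistribution f))
  else
    (∑' k : Fin n → ℤ, ENNReal.ofReal (Real.exp (q.toReal * ‖latticePoint k‖ ^ (1 / s))) *
      distLpNorm p (boxOp ρ k (Lp.toTemperedDistribution f)) ^ q.toReal) ^ (1 / q.toReal)

/-- The function `f` belongs to the Gevrey-modulation space `GM^s_{p,q}(ℝⁿ)`: it is in `L^p`, and
its Gevrey-modulation norm is finite. -/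
def MemGevreyModulation {n : ℕ} (ρ : EuclideanSpace ℝ (Fin n) → ℝ) (s : ℝ) (p q : ℝ≥0∞)
    [Fact (1 ≤ p)] (f : EuclideanSpace ℝ (Fin n) → ℂ) : Prop :=
  ∃ hf : MemLp f p volume, gevreyModulationNorm ρ s p q (hf.toLp f) < ⊤

/-- The inverse Fourier transform `t ↦ (2π)^(-1/2) ∫ e^(iξt) dμ(ξ)` of a complex measure `μ` on the
real line. -/
def measureFourierInv (μ : ComplexMeasure ℝ) (t : ℝ) : ℂ :=
  (1 / Real.sqrt (2 * Real.pi) : ℝ) *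
    μ.integral (fun ξ : ℝ => Complex.exp (Complex.I * ξ * t)) (ContinuousLinearMap.mul ℝ ℂ)

end

set_option linter.unusedSectionVars false

/-! Put θ = 1/s < 1. Since μ(ℝ) = 0, f ∘ u is a constant times ∫ (e^{iξu} - 1) dμ(ξ). By Minkowski's
inequality (`IsWindow.gevreyNorm_integral_exp_le`) it suffices that the norm of e^{iξu} - 1 grows at
most like exp(C t^θ log t) in t = |ξ|, up to lower order terms. This growth bound is
`IsWindow.exists_gevreyNorm_exp_le`.

The engine is (a + b)^θ ≤ a^θ + θ b^θ for 0 ≤ b ≤ a. It makes products tame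
(`IsWindow.gevreyNorm_mul_le`): one factor carries the Gevrey norm N, the other only the ℓ¹ norm V
with weight e^{θ|k|^θ}, and V ≤ C N because e^{(θ-1)|k|^θ} is summable. Hence N(F^{m+1}) ≤ (m+1) (D
V(F))^m N(F). The exponential series alone then bounds N(e^{iξu} - 1) by an exponential in t, which
is too much.

To do better, split u = l + h at a frequency R with R^θ = A (1 + log(1 + t)). For large A the high
part has t V(h) bounded, so the series gives N(e^{iξh} - 1) = O(t). The low part is band limited, so
the Taylor polynomial of degree L of e^{iξl} lives at frequencies O(LR); when L is a large multiple
of t the Taylor remainder contributes only O(t). On the ball of radius O(LR) each box is bounded by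
the L^p norm of e^{iξl} - 1, and the weights cost exp(C (LR)^θ), which is exp(C t^θ log t) up to
constants. That L^p norm is O(t) because u is real: Im l = -Im h is small, so |e^{iξl}| stays
bounded. Finally e^{iξu} - 1 = GH + G + H with G = e^{iξl} - 1 and H = e^{iξh} - 1. -/

/-! ### Minkowski's integral inequality and ℓ^q norms. -/

/-- Hölder with a weight replaces duality: with A(y) = ‖f(·, y)‖_p and S = ∫ A, writing f = (f
A^{-(p-1)/p}) A^{(p-1)/p} gives (∫ f dν)^p ≤ (∫ f^p A^{1-p} dν) S^{p-1}, and integrating in x turns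
the right side into S^p. -/
theorem lintegral_rpow_lintegral_le {α β : Type*} [MeasurableSpace α] [MeasurableSpace β]
    {μ : Measure α} {ν : Measure β} [SFinite μ] [SigmaFinite ν] {p : ℝ} (hp : 1 ≤ p)
    {f : α → β → ℝ≥0∞} (hf : Measurable (Function.uncurry f)) :
    (∫⁻ x, (∫⁻ y, f x y ∂ν) ^ p ∂μ) ^ (1 / p) ≤ ∫⁻ y, (∫⁻ x, f x y ^ p ∂μ) ^ (1 / p) ∂ν := by
  rcases hp.eq_or_lt with rfl | hp1
  · simpa using (lintegral_lintegral_swap (f := f) hf.aemeasurable).le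
  have hp0 : 0 < p := by linarith
  have hfp : Measurable (Function.uncurry fun y x => f x y ^ p) :=
    (hf.comp measurable_swap).pow_const p
  set A : β → ℝ≥0∞ := fun y => (∫⁻ x, f x y ^ p ∂μ) ^ (1 / p) with hA
  have hAm : Measurable A := (hfp.lintegral_prod_right').pow_const _
  by_cases hS : ∫⁻ y, A y ∂ν = ⊤
  · rw [hS]; exact le_top
  refine ENNReal.le_of_forall_pos_le_add fun ε hε _ => ?_
  -- A strictly positive `w` of integral below ε keeps the weight `A'` away from zero, so that its
  -- negative powers cancel.
  obtain ⟨w, hw0, hwm, hwi⟩ := exists_pos_lintegral_lt_of_sigmaFinite ν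
    (ε := (ε : ℝ≥0∞)) (by simpa using hε.ne')
  set A' : β → ℝ≥0∞ := fun y => A y + w y with hA'
  have hA'm : Measurable A' := hAm.add hwm.coe_nnreal_ennreal
  have hS' : ∫⁻ y, A' y ∂ν ≤ ∫⁻ y, A y ∂ν + ε := by
    rw [lintegral_add_left hAm]; gcongr
  set S := ∫⁻ y, A' y ∂ν with hSdef
  refine le_trans ?_ hS'
  have hSfin : S ≠ ⊤ := (hS'.trans_lt (by simp [lt_top_iff_ne_top, hS])).ne
  have hA'0 : ∀ y, A' y ≠ 0 := fun y => by
    have := hw0 y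
    simp [hA', this.ne']
  have hA'fin : ∀ᵐ y ∂ν, A' y ≠ ⊤ := by
    filter_upwards [ae_lt_top hA'm hSfin] with y hy using hy.ne
  have hpq : p.HolderConjugate (p / (p - 1)) := Real.HolderConjugate.conjExponent hp1
  have hq : 0 < p / (p - 1) := hpq.symm.pos
  have key : ∀ x, (∫⁻ y, f x y ∂ν) ^ p ≤ (∫⁻ y, f x y ^ p * A' y ^ (1 - p) ∂ν) * S ^ (p - 1) := by
    intro x
    have hfx : Measurable (f x) := hf.comp measurable_prodMk_left
    have h1 : ∫⁻ y, f x y ∂ν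
        = ∫⁻ y, ((fun y => f x y * A' y ^ (-((p - 1) / p))) * fun y => A' y ^ ((p - 1) / p)) y ∂ν := by
      refine lintegral_congr_ae ?_
      filter_upwards [hA'fin] with y hy
      simp only [Pi.mul_apply]
      rw [mul_assoc, ← ENNReal.rpow_add _ _ (hA'0 y) hy]
      simp
    have h2 := ENNReal.lintegral_mul_le_Lp_mul_Lq ν hpq
      (f := fun y => f x y * A' y ^ (-((p - 1) / p))) (g := fun y => A' y ^ ((p - 1) / p))
      (hfx.mul (hA'm.pow_const _)).aemeasurable (hA'm.pow_const _).aemeasurable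
    rw [h1]
    refine (ENNReal.rpow_le_rpow h2 hp0.le).trans ?_
    rw [ENNReal.mul_rpow_of_nonneg _ _ hp0.le, ← ENNReal.rpow_mul, ← ENNReal.rpow_mul]
    have e1 : 1 / p * p = 1 := by field_simp
    have e2 : 1 / (p / (p - 1)) * p = p - 1 := by field_simp
    rw [e1, e2, ENNReal.rpow_one]
    gcongr with y
    · rw [ENNReal.mul_rpow_of_nonneg _ _ hp0.le, ← ENNReal.rpow_mul]
      have : -((p - 1) / p) * p = 1 - p := by field_simp; ring
      rw [this]
    · refine (lintegral_congr fun y => ?_).le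
      rw [← ENNReal.rpow_mul]
      have hp1' : p - 1 ≠ 0 := by linarith
      have : (p - 1) / p * (p / (p - 1)) = 1 := by field_simp
      rw [this, ENNReal.rpow_one]
  have h3 : ∫⁻ x, (∫⁻ y, f x y ∂ν) ^ p ∂μ ≤ S * S ^ (p - 1) := by
    calc ∫⁻ x, (∫⁻ y, f x y ∂ν) ^ p ∂μ
        ≤ ∫⁻ x, (∫⁻ y, f x y ^ p * A' y ^ (1 - p) ∂ν) * S ^ (p - 1) ∂μ := lintegral_mono key
      _ = (∫⁻ x, (∫⁻ y, f x y ^ p * A' y ^ (1 - p) ∂ν) ∂μ) * S ^ (p - 1) := by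
          refine lintegral_mul_const' _ _ ?_
          exact (ENNReal.rpow_lt_top_of_nonneg (by linarith) hSfin).ne
      _ ≤ S * S ^ (p - 1) := by
          gcongr
          rw [lintegral_lintegral_swap]
          · refine lintegral_mono_ae ?_
            filter_upwards [hA'fin] with y hy
            rw [lintegral_mul_const _ ((show Measurable fun x => f x y from
              hf.comp measurable_prodMk_right).pow_const p)]
            have : ∫⁻ x, f x y ^ p ∂μ ≤ A' y ^ p := by
              calc ∫⁻ x, f x y ^ p ∂μ = A y ^ p := by
                    rw [hA]; simp only
                    rw [← ENNReal.rpow_mul]; field_simp; simp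
                _ ≤ _ := by gcongr; simp [hA']
            calc _ ≤ A' y ^ p * A' y ^ (1 - p) := by gcongr
              _ = A' y := by
                rw [← ENNReal.rpow_add _ _ (hA'0 y) hy]; simp
          · exact ((hf.pow_const p).mul
              ((hA'm.comp measurable_snd).pow_const _)).aemeasurable
  have h4 : S * S ^ (p - 1) = S ^ p := by
    rcases eq_or_ne S 0 with h | h
    · rw [h, ENNReal.zero_rpow_of_pos hp0]; simp
    · nth_rw 1 [← ENNReal.rpow_one S]
      rw [← ENNReal.rpow_add _ _ h hSfin]; simp
  rw [h4] at h3
  calc _ ≤ (S ^ p) ^ (1 / p) := ENNReal.rpow_le_rpow h3 (by positivity)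
    _ = S := by rw [← ENNReal.rpow_mul]; field_simp; simp

/-- The `ℓ^q` norm of a family of extended nonnegative reals. -/
noncomputable def lqNorm {ι : Type*} (q : ℝ≥0∞) (a : ι → ℝ≥0∞) : ℝ≥0∞ :=
  if q = ⊤ then ⨆ k, a k else (∑' k, a k ^ q.toReal) ^ (1 / q.toReal)

section lqNorm

variable {ι κ : Type*} {q : ℝ≥0∞}

theorem lqNorm_mono {a b : ι → ℝ≥0∞} (h : ∀ k, a k ≤ b k) : lqNorm q a ≤ lqNorm q b := by
  unfold lqNorm
  split_ifs
  · exact iSup_mono h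
  · gcongr with k
    exact h k

theorem toReal_pos_of_one_le (hq : 1 ≤ q) (hq' : q ≠ ⊤) : 1 ≤ q.toReal := by
  rw [← ENNReal.toReal_one]
  exact ENNReal.toReal_mono hq' hq

theorem lqNorm_const_mul (hq : 1 ≤ q) (c : ℝ≥0∞) (a : ι → ℝ≥0∞) :
    lqNorm q (fun k => c * a k) = c * lqNorm q a := by
  unfold lqNorm
  split_ifs with h
  · rw [ENNReal.mul_iSup]
  · have h1 := toReal_pos_of_one_le hq h
    have h0 : 0 < q.toReal := by linarith
    simp_rw [ENNReal.mul_rpow_of_nonneg _ _ h0.le]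
    rw [ENNReal.tsum_mul_left, ENNReal.mul_rpow_of_nonneg _ _ (by positivity), ← ENNReal.rpow_mul]
    field_simp
    simp

theorem lqNorm_comp_equiv (e : ι ≃ κ) (a : κ → ℝ≥0∞) :
    lqNorm q (fun k => a (e k)) = lqNorm q a := by
  unfold lqNorm
  split_ifs with h
  · exact e.iSup_comp
  · rw [e.tsum_eq (fun k => a k ^ q.toReal)]

theorem le_lqNorm (hq : 1 ≤ q) (a : ι → ℝ≥0∞) (k : ι) : a k ≤ lqNorm q a := by
  unfold lqNorm
  split_ifs with h
  · exact le_iSup a k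
  · have h1 := toReal_pos_of_one_le hq h
    have h0 : 0 < q.toReal := by linarith
    rw [one_div, ENNReal.le_rpow_inv_iff h0]
    exact ENNReal.le_tsum k

/-- Minkowski's inequality with counting measure as the outer measure. -/
theorem lqNorm_lintegral_le [Countable ι] (hq : 1 ≤ q) {β : Type*} [MeasurableSpace β]
    {ν : Measure β} [SigmaFinite ν] {f : ι → β → ℝ≥0∞} (hf : ∀ k, Measurable (f k)) :
    lqNorm q (fun k => ∫⁻ y, f k y ∂ν) ≤ ∫⁻ y, lqNorm q (fun k => f k y) ∂ν := by
  unfold lqNorm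
  split_ifs with h
  · exact iSup_le fun k => lintegral_mono fun y => le_iSup (fun k => f k y) k
  · let _ : MeasurableSpace ι := ⊤
    have : MeasurableSingletonClass ι := ⟨fun _ => trivial⟩
    have := lintegral_rpow_lintegral_le (μ := (Measure.count : Measure ι)) (ν := ν)
      (toReal_pos_of_one_le hq h) (f := f) (measurable_from_prod_countable_right hf)
    simpa [lintegral_count] using this

theorem lqNorm_tsum_le [Countable ι] [Countable κ] (hq : 1 ≤ q) (f : κ → ι → ℝ≥0∞) :
    lqNorm q (fun k => ∑' i, f i k) ≤ ∑' i, lqNorm q (f i) := by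
  let _ : MeasurableSpace κ := ⊤
  have : MeasurableSingletonClass κ := ⟨fun _ => trivial⟩
  have := lqNorm_lintegral_le (ν := (Measure.count : Measure κ)) hq (f := fun k i => f i k)
    (fun k => measurable_from_top)
  simpa [lintegral_count] using this

theorem lqNorm_add_le [Countable ι] (hq : 1 ≤ q) (a b : ι → ℝ≥0∞) :
    lqNorm q (fun k => a k + b k) ≤ lqNorm q a + lqNorm q b := by
  have := lqNorm_tsum_le hq (fun (i : Bool) => bif i then a else b)
  simpa [tsum_fintype] using this

/-- The triangle inequality, applied to the family as a sum of its one-point restrictions. -/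
theorem lqNorm_le_tsum [Countable ι] (hq : 1 ≤ q) (a : ι → ℝ≥0∞) :
    lqNorm q a ≤ ∑' k, a k := by
  classical
  have h := lqNorm_tsum_le hq (fun i : ι => fun k : ι => if k = i then a i else 0)
  have h1 : ∀ k, ∑' i, (if k = i then a i else 0) = a k := fun k => by
    rw [tsum_eq_single k (fun j hj => if_neg hj.symm)]; simp
  simp_rw [h1] at h
  refine h.trans (ENNReal.tsum_le_tsum fun i => ?_)
  unfold lqNorm
  split_ifs with hq'
  · exact iSup_le fun k => by dsimp only; split_ifs <;> simp_all
  · have h1 := toReal_pos_of_one_le hq hq'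
    have h0 : 0 < q.toReal := by linarith
    rw [tsum_eq_single i]
    · dsimp only; rw [if_pos rfl, ← ENNReal.rpow_mul]; field_simp; simp
    · intro j hj
      dsimp only
      rw [if_neg hj, ENNReal.zero_rpow_of_pos h0]

end lqNorm

/-! ### Subadditivity of powers and the subexponential weights. -/

/-- Bernoulli's inequality for (1 + b/a)^θ, then a^{θ-1} ≤ b^{θ-1}. The factor θ in front of the
smaller term is the gain over plain subadditivity on which the whole argument rests. -/
theorem add_rpow_le_add_mul_rpow {a b θ : ℝ} (hb : 0 ≤ b) (hab : b ≤ a) (h0 : 0 < θ)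
    (h1 : θ ≤ 1) : (a + b) ^ θ ≤ a ^ θ + θ * b ^ θ := by
  rcases hb.eq_or_lt with rfl | hb'
  · simp [Real.zero_rpow h0.ne']
  have ha : 0 < a := hb'.trans_le hab
  have e : a + b = a * (1 + b / a) := by field_simp
  have hB := rpow_one_add_le_one_add_mul_self (s := b / a)
    (by have : 0 ≤ b / a := by positivity
        linarith) h0.le h1
  rw [e, Real.mul_rpow ha.le (by positivity)]
  have h2 : a ^ θ * (b / a) ≤ b ^ θ := by
    have e1 : a ^ θ * (b / a) = b * a ^ (θ - 1) := by
      rw [Real.rpow_sub ha, Real.rpow_one]; field_simp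
    rw [e1]
    have : a ^ (θ - 1) ≤ b ^ (θ - 1) := Real.rpow_le_rpow_of_nonpos hb' hab (by linarith)
    calc b * a ^ (θ - 1) ≤ b * b ^ (θ - 1) := by gcongr
      _ = b ^ θ := by rw [Real.rpow_sub hb', Real.rpow_one]; field_simp
  calc a ^ θ * (1 + b / a) ^ θ ≤ a ^ θ * (1 + θ * (b / a)) := by gcongr
    _ = a ^ θ + θ * (a ^ θ * (b / a)) := by ring
    _ ≤ _ := by gcongr

theorem add_rpow_le_rpow_add_rpow {a b θ : ℝ} (ha : 0 ≤ a) (hb : 0 ≤ b) (h0 : 0 ≤ θ)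
    (h1 : θ ≤ 1) : (a + b) ^ θ ≤ a ^ θ + b ^ θ := by
  have := NNReal.rpow_add_le_add_rpow ⟨a, ha⟩ ⟨b, hb⟩ h0 h1
  exact_mod_cast this

theorem tsum_pi_prod_fin (n : ℕ) (g : ℤ → ℝ≥0∞) :
    ∑' k : Fin n → ℤ, ∏ i, g (k i) = (∑' j, g j) ^ n := by
  induction n with
  | zero => simp
  | succ n ih =>
    rw [← (Fin.consEquiv fun _ : Fin (n + 1) => ℤ).tsum_eq, ENNReal.tsum_prod']
    simp only [Fin.consEquiv, Equiv.coe_fn_mk, Fin.prod_univ_succ, Fin.cons_zero, Fin.cons_succ]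
    simp_rw [ENNReal.tsum_mul_left, ih, ENNReal.tsum_mul_right]
    ring

/-- The exponential beats every power: e^{-x} ≤ N!/x^N, with N so large that θN > 1. -/
theorem summable_exp_neg_mul_abs_rpow {c θ : ℝ} (hc : 0 < c) (hθ : 0 < θ) :
    Summable fun j : ℤ => Real.exp (-(c * |(j : ℝ)| ^ θ)) := by
  obtain ⟨N, hN⟩ := exists_nat_gt (2 / θ)
  have hN' : 1 < θ * N := by
    rw [div_lt_iff₀ hθ] at hN; linarith
  have hs := (Real.summable_abs_int_rpow hN').mul_left ((N.factorial : ℝ) / c ^ N)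
  refine Summable.of_norm_bounded_eventually hs ?_
  have : {(0 : ℤ)}ᶜ ∈ Filter.cofinite := (Set.finite_singleton 0).compl_mem_cofinite
  filter_upwards [this] with j hj
  have hj' : (0 : ℝ) < |(j : ℝ)| := abs_pos.mpr (by exact_mod_cast hj)
  set y := |(j : ℝ)|
  have h1 := Real.pow_div_factorial_le_exp (c * y ^ θ) (by positivity) N
  rw [Real.norm_eq_abs, abs_of_pos (Real.exp_pos _), Real.exp_neg]
  have h2 : (Real.exp (c * y ^ θ))⁻¹ ≤ ((c * y ^ θ) ^ N / N.factorial)⁻¹ := by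
    gcongr
  refine h2.trans (le_of_eq ?_)
  rw [mul_pow, ← Real.rpow_mul_natCast hj'.le, Real.rpow_neg hj'.le]
  field_simp

section weight

variable {n : ℕ}

theorem latticePoint_add (j k : Fin n → ℤ) :
    latticePoint (j + k) = latticePoint j + latticePoint k := by
  ext i; simp [latticePoint]

theorem abs_apply_le_norm_latticePoint (k : Fin n → ℤ) (i : Fin n) :
    |(k i : ℝ)| ≤ ‖latticePoint k‖ := by
  have := PiLp.norm_apply_le (latticePoint k) i
  simpa [latticePoint] using this

/-- The subexponential weight `e^(c |k|^θ)` on the lattice. -/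
noncomputable def subexpWeight (θ c : ℝ) (k : Fin n → ℤ) : ℝ≥0∞ :=
  ENNReal.ofReal (Real.exp (c * ‖latticePoint k‖ ^ θ))

theorem subexpWeight_ne_top (θ c : ℝ) (k : Fin n → ℤ) : subexpWeight θ c k ≠ ⊤ :=
  ENNReal.ofReal_ne_top

theorem subexpWeight_mono {θ c d : ℝ} (h : c ≤ d) (k : Fin n → ℤ) :
    subexpWeight θ c k ≤ subexpWeight θ d k := by
  unfold subexpWeight; gcongr

theorem one_le_subexpWeight {θ c : ℝ} (hc : 0 ≤ c) (k : Fin n → ℤ) :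
    1 ≤ subexpWeight θ c k := by
  unfold subexpWeight
  rw [ENNReal.one_le_ofReal]
  exact Real.one_le_exp (by positivity)

theorem subexpWeight_mul (θ c d : ℝ) (k : Fin n → ℤ) :
    subexpWeight θ c k * subexpWeight θ d k = subexpWeight θ (c + d) k := by
  unfold subexpWeight
  rw [← ENNReal.ofReal_mul (Real.exp_pos _).le, ← Real.exp_add, add_mul]

theorem subexpWeight_add_le {θ c : ℝ} (h0 : 0 < θ) (h1 : θ ≤ 1) (hc : 0 ≤ c)
    (j k : Fin n → ℤ) : subexpWeight θ c (j + k) ≤ subexpWeight θ c j * subexpWeight θ c k := by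
  unfold subexpWeight
  rw [← ENNReal.ofReal_mul (Real.exp_pos _).le, ← Real.exp_add, latticePoint_add, ← mul_add]
  gcongr
  exact (Real.rpow_le_rpow (norm_nonneg _) (norm_add_le _ _) h0.le).trans
    (add_rpow_le_rpow_add_rpow (norm_nonneg _) (norm_nonneg _) h0.le h1)

/-- Only the larger of the two frequencies has to carry the full weight; the smaller one keeps the
exponent θ. The two summands cover the two cases. -/
theorem subexpWeight_one_add_le {θ : ℝ} (h0 : 0 < θ) (h1 : θ ≤ 1) (j k : Fin n → ℤ) :
    subexpWeight θ 1 (j + k) ≤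
      subexpWeight θ 1 j * subexpWeight θ θ k + subexpWeight θ θ j * subexpWeight θ 1 k := by
  have key : ∀ j k : Fin n → ℤ, ‖latticePoint k‖ ≤ ‖latticePoint j‖ →
      subexpWeight θ 1 (j + k) ≤ subexpWeight θ 1 j * subexpWeight θ θ k := by
    intro j k h
    unfold subexpWeight
    rw [← ENNReal.ofReal_mul (Real.exp_pos _).le, ← Real.exp_add, latticePoint_add, one_mul,
      one_mul]
    gcongr
    exact (Real.rpow_le_rpow (norm_nonneg _) (norm_add_le _ _) h0.le).trans
      (add_rpow_le_add_mul_rpow (norm_nonneg _) h h0 h1)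
  rcases le_total ‖latticePoint k‖ ‖latticePoint j‖ with h | h
  · exact (key j k h).trans le_self_add
  · rw [add_comm j k, mul_comm (subexpWeight θ θ j)]
    exact (key k j h).trans le_add_self

/-- Since ∑ |k_i|^θ ≤ n |k|^θ, the sum is dominated by the n-th power of a one-dimensional one. -/
theorem tsum_subexpWeight_neg_ne_top {θ c : ℝ} (hθ : 0 < θ) (hc : c < 0) :
    ∑' k : Fin n → ℤ, subexpWeight θ c k ≠ ⊤ := by
  rcases Nat.eq_zero_or_pos n with rfl | hn
  · simp [subexpWeight]
  have hn' : (0 : ℝ) < n := by exact_mod_cast hn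
  have hs := summable_exp_neg_mul_abs_rpow (c := -c / n) (θ := θ) (by
    have : 0 < -c := by linarith
    positivity) hθ
  have hle : ∀ k : Fin n → ℤ, subexpWeight θ c k ≤
      ∏ i, ENNReal.ofReal (Real.exp (-(-c / n * |(k i : ℝ)| ^ θ))) := by
    intro k
    unfold subexpWeight
    rw [← ENNReal.ofReal_prod_of_nonneg (fun i _ => (Real.exp_pos _).le), ← Real.exp_sum]
    gcongr
    have : ∑ i, |(k i : ℝ)| ^ θ ≤ n * ‖latticePoint k‖ ^ θ := by
      calc ∑ i, |(k i : ℝ)| ^ θ ≤ ∑ i : Fin n, ‖latticePoint k‖ ^ θ := by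
            gcongr with i
            exact abs_apply_le_norm_latticePoint k i
        _ = _ := by simp
    rw [Finset.sum_neg_distrib, ← Finset.mul_sum]
    have h2 : -c / n * ∑ i, |(k i : ℝ)| ^ θ ≤ -c / n * (n * ‖latticePoint k‖ ^ θ) := by
      have : 0 ≤ -c / n := by have : 0 < -c := by linarith
                              positivity
      gcongr
    have h3 : -c / n * (n * ‖latticePoint k‖ ^ θ) = -c * ‖latticePoint k‖ ^ θ := by
      field_simp
    linarith
  refine ((ENNReal.tsum_le_tsum hle).trans_lt ?_).ne
  rw [tsum_pi_prod_fin n fun j => ENNReal.ofReal (Real.exp (-(-c / n * |(j : ℝ)| ^ θ)))]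
  refine ENNReal.pow_lt_top ?_
  rw [← ENNReal.ofReal_tsum_of_nonneg (fun j => (Real.exp_pos _).le) hs]
  exact ENNReal.ofReal_lt_top

end weight

/-! ### The partition of unity and its symbols. -/

section symbol

variable {n : ℕ} {ρ : EuclideanSpace ℝ (Fin n) → ℝ}

theorem IsWindow.abs_le_of_ne_zero (hρ : IsWindow ρ) {ξ : EuclideanSpace ℝ (Fin n)}
    (h : ρ ξ ≠ 0) (i : Fin n) : |ξ i| ≤ 1 :=
  hρ.tsupport_subset (subset_tsupport ρ h) i

/-- The lattice points within distance `r`, coordinatewise, of a given point. -/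
def latticeBox (x : EuclideanSpace ℝ (Fin n)) (r : ℝ) : Set (Fin n → ℤ) :=
  {l | ∀ i, |x i - l i| ≤ r}

theorem finite_latticeBox (x : EuclideanSpace ℝ (Fin n)) (r : ℝ) : (latticeBox x r).Finite := by
  refine (Set.Finite.pi' (t := fun i => {m : ℤ | |x i - m| ≤ r}) fun i => ?_).subset
    fun l hl i => hl i
  refine (Set.finite_Icc ⌈x i - r⌉ ⌊x i + r⌋).subset fun m hm => ?_
  have := abs_le.1 (show |x i - m| ≤ r from hm)
  exact ⟨Int.ceil_le.2 (by linarith), Int.le_floor.2 (by linarith)⟩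

theorem IsWindow.support_shift_subset (hρ : IsWindow ρ) (ξ : EuclideanSpace ℝ (Fin n)) :
    (Function.support fun l : Fin n → ℤ => ρ (ξ - latticePoint l)) ⊆ latticeBox ξ 1 := by
  intro l hl i
  simpa [latticePoint] using hρ.abs_le_of_ne_zero hl i

theorem IsWindow.finite_support_shift (hρ : IsWindow ρ) (ξ : EuclideanSpace ℝ (Fin n)) :
    (Function.support fun l : Fin n → ℤ => ρ (ξ - latticePoint l)).Finite :=
  (finite_latticeBox ξ 1).subset (hρ.support_shift_subset ξ)

theorem IsWindow.summable_shift (hρ : IsWindow ρ) (ξ : EuclideanSpace ℝ (Fin n)) :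
    Summable fun l : Fin n → ℤ => ρ (ξ - latticePoint l) :=
  summable_of_hasFiniteSupport (hρ.finite_support_shift ξ)

theorem IsWindow.one_le_tsum (hρ : IsWindow ρ) (ξ : EuclideanSpace ℝ (Fin n)) :
    1 ≤ ∑' l : Fin n → ℤ, ρ (ξ - latticePoint l) := by
  have h1 : ρ (ξ - latticePoint fun i => round (ξ i)) = 1 := by
    refine hρ.eq_one _ fun i => ?_
    simpa [latticePoint] using abs_sub_round (ξ i)
  rw [← h1]
  exact (hρ.summable_shift ξ).le_tsum _ fun _ _ => hρ.nonneg _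

theorem IsWindow.locallyFinite_shift (hρ : IsWindow ρ) :
    LocallyFinite fun l : Fin n → ℤ =>
      Function.support fun ξ : EuclideanSpace ℝ (Fin n) => ρ (ξ - latticePoint l) := by
  intro x
  refine ⟨Metric.ball x 1, Metric.ball_mem_nhds x one_pos, ?_⟩
  refine (finite_latticeBox x 2).subset ?_
  rintro l ⟨y, hy, hyx⟩ i
  have h1 : |y i - l i| ≤ 1 := by simpa [latticePoint] using hρ.abs_le_of_ne_zero hy i
  have h2 : |y i - x i| ≤ 1 := by
    have h3 := PiLp.norm_apply_le (y - x) i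
    rw [Metric.mem_ball, dist_eq_norm] at hyx
    have h4 : ‖(y - x) i‖ = |y i - x i| := by simp
    linarith
  have := abs_le.1 h1
  have := abs_le.1 h2
  rw [abs_le]
  constructor <;> linarith

theorem IsWindow.contDiff_tsum (hρ : IsWindow ρ) :
    ContDiff ℝ ∞ fun ξ : EuclideanSpace ℝ (Fin n) =>
      ∑' l : Fin n → ℤ, ρ (ξ - latticePoint l) := by
  have h := contMDiff_finsum (I' := modelWithCornersSelf ℝ (EuclideanSpace ℝ (Fin n)))
    (I := modelWithCornersSelf ℝ ℝ) (n := ∞)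
    (f := fun (l : Fin n → ℤ) (ξ : EuclideanSpace ℝ (Fin n)) => ρ (ξ - latticePoint l))
    (fun l => (hρ.contDiff.comp (contDiff_id.sub contDiff_const)).contMDiff)
    hρ.locallyFinite_shift
  have e : (fun ξ : EuclideanSpace ℝ (Fin n) => ∑' l : Fin n → ℤ, ρ (ξ - latticePoint l)) =
      fun ξ => ∑ᶠ l : Fin n → ℤ, ρ (ξ - latticePoint l) :=
    funext fun ξ => tsum_eq_finsum (hρ.finite_support_shift ξ)
  rw [e]
  exact h.contDiff

theorem tsum_shift_sub (ρ : EuclideanSpace ℝ (Fin n) → ℝ) (ξ : EuclideanSpace ℝ (Fin n))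
    (k : Fin n → ℤ) :
    ∑' l : Fin n → ℤ, ρ (ξ - latticePoint k - latticePoint l) =
      ∑' l : Fin n → ℤ, ρ (ξ - latticePoint l) := by
  rw [← (Equiv.addLeft k).tsum_eq fun l => ρ (ξ - latticePoint l)]
  simp [latticePoint_add, sub_sub]

theorem uniformPartition_eq_shift (ρ : EuclideanSpace ℝ (Fin n) → ℝ) (k : Fin n → ℤ)
    (ξ : EuclideanSpace ℝ (Fin n)) :
    uniformPartition ρ k ξ = uniformPartition ρ 0 (ξ - latticePoint k) := by
  have h0 : latticePoint (0 : Fin n → ℤ) = 0 := by ext i; simp [latticePoint]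
  simp only [uniformPartition]
  rw [tsum_shift_sub, h0, sub_zero]

theorem IsWindow.contDiff_uniformPartition (hρ : IsWindow ρ) (k : Fin n → ℤ) :
    ContDiff ℝ ∞ (uniformPartition ρ k) := by
  refine (hρ.contDiff.comp (contDiff_id.sub contDiff_const)).div hρ.contDiff_tsum fun ξ => ?_
  have := hρ.one_le_tsum ξ
  positivity

theorem IsWindow.abs_le_of_uniformPartition_ne_zero (hρ : IsWindow ρ) {k : Fin n → ℤ}
    {ξ : EuclideanSpace ℝ (Fin n)} (h : uniformPartition ρ k ξ ≠ 0) (i : Fin n) :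
    |ξ i - k i| ≤ 1 := by
  have : ρ (ξ - latticePoint k) ≠ 0 := fun h0 => h (by simp [uniformPartition, h0])
  simpa [latticePoint] using hρ.abs_le_of_ne_zero this i

theorem IsWindow.sum_uniformPartition (hρ : IsWindow ρ) (ξ : EuclideanSpace ℝ (Fin n))
    {s : Finset (Fin n → ℤ)} (hs : latticeBox ξ 1 ⊆ s) : ∑ k ∈ s, uniformPartition ρ k ξ = 1 := by
  have h1 := hρ.one_le_tsum ξ
  simp only [uniformPartition]
  rw [← Finset.sum_div, div_eq_one_iff_eq (by positivity)]
  exact (tsum_eq_sum' ((hρ.support_shift_subset ξ).trans hs)).symm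

theorem IsWindow.hasCompactSupport_boxSymbol (hρ : IsWindow ρ) (k : Fin n → ℤ) :
    HasCompactSupport fun ξ : EuclideanSpace ℝ (Fin n) =>
      (uniformPartition ρ k ((2 * Real.pi) • ξ) : ℂ) := by
  have hpi := Real.pi_pos
  refine HasCompactSupport.intro
    (isCompact_closedBall (0 : EuclideanSpace ℝ (Fin n)) (Real.sqrt n * (1 + ‖latticePoint k‖)))
    fun ξ hξ => ?_
  by_contra h
  apply hξ
  have h' : uniformPartition ρ k ((2 * Real.pi) • ξ) ≠ 0 := fun h0 => h (by simp [h0])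
  have h1 : ∀ i, ‖ξ i‖ ≤ 1 + ‖latticePoint k‖ := fun i => by
    have h2 := abs_le.1 (hρ.abs_le_of_uniformPartition_ne_zero h' i)
    have h3 := abs_le.1 (abs_apply_le_norm_latticePoint k i)
    simp only [PiLp.smul_apply, smul_eq_mul] at h2
    have h4 : |2 * Real.pi * ξ i| ≤ 1 + ‖latticePoint k‖ := by
      rw [abs_le]; constructor <;> linarith
    rw [abs_mul, abs_of_pos (by positivity)] at h4
    rw [Real.norm_eq_abs]
    have h5 : 1 * |ξ i| ≤ 2 * Real.pi * |ξ i| := by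
      gcongr
      linarith [Real.two_le_pi]
    linarith
  rw [mem_closedBall_zero_iff, EuclideanSpace.norm_eq]
  calc Real.sqrt (∑ i, ‖ξ i‖ ^ 2) ≤ Real.sqrt (∑ i : Fin n, (1 + ‖latticePoint k‖) ^ 2) := by
        gcongr with i
        exact h1 i
    _ = _ := by
        rw [Finset.sum_const, Finset.card_univ, Fintype.card_fin, nsmul_eq_mul,
          Real.sqrt_mul (by positivity), Real.sqrt_sq (by positivity)]

theorem IsWindow.contDiff_boxSymbol (hρ : IsWindow ρ) (k : Fin n → ℤ) :
    ContDiff ℝ ∞ fun ξ : EuclideanSpace ℝ (Fin n) =>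
      (uniformPartition ρ k ((2 * Real.pi) • ξ) : ℂ) :=
  Complex.ofRealCLM.contDiff.comp
    ((hρ.contDiff_uniformPartition k).comp (contDiff_const_smul (2 * Real.pi)))

/-- The symbol of `boxOp ρ k`, as a Schwartz function. -/
noncomputable def IsWindow.boxSymbol (hρ : IsWindow ρ) (k : Fin n → ℤ) :
    𝓢(EuclideanSpace ℝ (Fin n), ℂ) :=
  (hρ.hasCompactSupport_boxSymbol k).toSchwartzMap (hρ.contDiff_boxSymbol k)

theorem IsWindow.boxSymbol_apply (hρ : IsWindow ρ) (k : Fin n → ℤ)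
    (ξ : EuclideanSpace ℝ (Fin n)) :
    hρ.boxSymbol k ξ = (uniformPartition ρ k ((2 * Real.pi) • ξ) : ℂ) := rfl

theorem IsWindow.boxOp_eq (hρ : IsWindow ρ) (k : Fin n → ℤ) :
    boxOp ρ k = TemperedDistribution.fourierMultiplierCLM ℂ (hρ.boxSymbol k) := rfl

theorem IsWindow.boxSymbol_eq_shift (hρ : IsWindow ρ) (k : Fin n → ℤ)
    (ξ : EuclideanSpace ℝ (Fin n)) :
    hρ.boxSymbol k ξ = hρ.boxSymbol 0 (ξ - (2 * Real.pi)⁻¹ • latticePoint k) := by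
  rw [hρ.boxSymbol_apply, hρ.boxSymbol_apply, uniformPartition_eq_shift, smul_sub, smul_smul,
    mul_inv_cancel₀ (by positivity), one_smul]

theorem IsWindow.abs_le_of_boxSymbol_ne_zero (hρ : IsWindow ρ) {k : Fin n → ℤ}
    {ξ : EuclideanSpace ℝ (Fin n)} (h : hρ.boxSymbol k ξ ≠ 0) (i : Fin n) :
    |2 * Real.pi * ξ i - k i| ≤ 1 := by
  have : uniformPartition ρ k ((2 * Real.pi) • ξ) ≠ 0 := fun h0 => h (by
    rw [hρ.boxSymbol_apply, h0]; simp)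
  simpa using hρ.abs_le_of_uniformPartition_ne_zero this i

theorem IsWindow.sum_boxSymbol (hρ : IsWindow ρ) (ξ : EuclideanSpace ℝ (Fin n))
    {s : Finset (Fin n → ℤ)} (hs : latticeBox ((2 * Real.pi) • ξ) 1 ⊆ s) :
    ∑ k ∈ s, hρ.boxSymbol k ξ = 1 := by
  simp only [hρ.boxSymbol_apply]
  rw [← Complex.ofReal_sum, hρ.sum_uniformPartition _ hs, Complex.ofReal_one]

end symbol

/-! ### Box operators as convolutions with Schwartz kernels. -/

section kernel

open FourierTransform

variable {n : ℕ} {ρ : EuclideanSpace ℝ (Fin n) → ℝ} {p : ℝ≥0∞}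

theorem SchwartzMap.fourier_compSubConstCLM (K : 𝓢(EuclideanSpace ℝ (Fin n), ℂ))
    (a ξ : EuclideanSpace ℝ (Fin n)) :
    𝓕 (compSubConstCLM ℂ a K) ξ = Real.fourierChar (-inner ℝ a ξ) • 𝓕 K ξ := by
  rw [fourier_coe, fourier_coe, Real.fourier_eq, Real.fourier_eq,
    ← integral_add_right_eq_self _ a]
  simp only [compSubConstCLM_apply, add_sub_cancel_right, inner_add_left, neg_add_rev,
    AddChar.map_add_eq_mul, mul_smul]
  simp only [Circle.smul_def]
  rw [integral_smul]

theorem SchwartzMap.fourierInv_eq_fourier_neg (K : 𝓢(EuclideanSpace ℝ (Fin n), ℂ))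
    (x : EuclideanSpace ℝ (Fin n)) : 𝓕⁻ K x = 𝓕 K (-x) := by
  rw [fourierInv_coe, fourier_coe, Real.fourierInv_eq_fourier_neg]

/-- The convolution kernel of `boxOp ρ k`. -/
noncomputable def IsWindow.boxKernel (hρ : IsWindow ρ) (k : Fin n → ℤ) :
    𝓢(EuclideanSpace ℝ (Fin n), ℂ) := 𝓕⁻ (hρ.boxSymbol k)

theorem IsWindow.fourier_boxKernel (hρ : IsWindow ρ) (k : Fin n → ℤ) :
    𝓕 (hρ.boxKernel k) = hρ.boxSymbol k := by simp [IsWindow.boxKernel]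

/-- The symbols are translates of each other, so the kernels differ by a unimodular factor. All
bounds below are therefore uniform in `k`. -/
theorem IsWindow.norm_boxKernel (hρ : IsWindow ρ) (k : Fin n → ℤ)
    (x : EuclideanSpace ℝ (Fin n)) : ‖hρ.boxKernel k x‖ = ‖hρ.boxKernel 0 x‖ := by
  have h : hρ.boxSymbol k =
      compSubConstCLM ℂ ((2 * Real.pi)⁻¹ • latticePoint k) (hρ.boxSymbol 0) := by
    ext ξ
    rw [compSubConstCLM_apply, hρ.boxSymbol_eq_shift]
  rw [IsWindow.boxKernel, IsWindow.boxKernel, fourierInv_eq_fourier_neg, fourierInv_eq_fourier_neg,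
    h, fourier_compSubConstCLM, Circle.smul_def, norm_smul, Circle.norm_coe, one_mul]

/-- Convolution of a function with a Schwartz kernel. -/
noncomputable def kernelConv (K : 𝓢(EuclideanSpace ℝ (Fin n), ℂ))
    (F : EuclideanSpace ℝ (Fin n) → ℂ) (x : EuclideanSpace ℝ (Fin n)) : ℂ :=
  ∫ y, K (x - y) * F y

theorem kernelConv_congr_ae (K : 𝓢(EuclideanSpace ℝ (Fin n), ℂ))
    {F G : EuclideanSpace ℝ (Fin n) → ℂ} (h : F =ᵐ[volume] G) :
    kernelConv K F = kernelConv K G := by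
  ext x
  refine integral_congr_ae ?_
  filter_upwards [h] with y hy
  rw [hy]

theorem eLpNorm_comp_sub_left {E : Type*} [NormedAddCommGroup E] (r : ℝ≥0∞)
    {F : EuclideanSpace ℝ (Fin n) → E} (hF : AEStronglyMeasurable F volume)
    (x : EuclideanSpace ℝ (Fin n)) :
    eLpNorm (fun y => F (x - y)) r volume = eLpNorm F r volume :=
  eLpNorm_comp_measurePreserving hF (Measure.measurePreserving_sub_left volume x)

theorem SchwartzMap.memLp_comp_sub_left (K : 𝓢(EuclideanSpace ℝ (Fin n), ℂ)) (r : ℝ≥0∞)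
    (x : EuclideanSpace ℝ (Fin n)) : MemLp (fun y => K (x - y)) r volume :=
  (K.memLp r).comp_measurePreserving (Measure.measurePreserving_sub_left volume x)

/-- Hölder's inequality; `(1 - p⁻¹)⁻¹` is the exponent conjugate to `p`, here and below. -/
theorem integrable_kernelConv_integrand [hp : Fact (1 ≤ p)] (K : 𝓢(EuclideanSpace ℝ (Fin n), ℂ))
    {F : EuclideanSpace ℝ (Fin n) → ℂ} (hF : MemLp F p volume)
    (x : EuclideanSpace ℝ (Fin n)) : Integrable (fun y => K (x - y) * F y) volume := by
  have := ENNReal.HolderConjugate.inv_one_sub_inv' hp.out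
  exact MemLp.integrable_mul (p := (1 - p⁻¹)⁻¹) (K.memLp_comp_sub_left _ x) hF

theorem lintegral_enorm_kernelConv_integrand_le [hp : Fact (1 ≤ p)]
    (K : 𝓢(EuclideanSpace ℝ (Fin n), ℂ)) {F : EuclideanSpace ℝ (Fin n) → ℂ}
    (hF : MemLp F p volume) (x : EuclideanSpace ℝ (Fin n)) :
    ∫⁻ y, ‖K (x - y) * F y‖ₑ ≤ eLpNorm K (1 - p⁻¹)⁻¹ volume * eLpNorm F p volume := by
  have := ENNReal.HolderConjugate.inv_one_sub_inv' hp.out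
  rw [← eLpNorm_one_eq_lintegral_enorm,
    ← eLpNorm_comp_sub_left (1 - p⁻¹)⁻¹ K.continuous.aestronglyMeasurable x]
  have h := eLpNorm_smul_le_mul_eLpNorm (p := (1 - p⁻¹)⁻¹) (q := p) (r := 1) hF.1
    (K.memLp_comp_sub_left 1 x).1
  exact (congrArg (fun G => eLpNorm G 1 volume) (funext fun y => rfl)).trans_le h

theorem enorm_kernelConv_le [hp : Fact (1 ≤ p)] (K : 𝓢(EuclideanSpace ℝ (Fin n), ℂ))
    {F : EuclideanSpace ℝ (Fin n) → ℂ} (hF : MemLp F p volume)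
    (x : EuclideanSpace ℝ (Fin n)) :
    ‖kernelConv K F x‖ₑ ≤ eLpNorm K (1 - p⁻¹)⁻¹ volume * eLpNorm F p volume :=
  (enorm_integral_le_lintegral_enorm _).trans (lintegral_enorm_kernelConv_integrand_le K hF x)

theorem aestronglyMeasurable_kernelConv_integrand (K : 𝓢(EuclideanSpace ℝ (Fin n), ℂ))
    {F : EuclideanSpace ℝ (Fin n) → ℂ} (hF : AEStronglyMeasurable F volume) :
    AEStronglyMeasurable (fun z : EuclideanSpace ℝ (Fin n) × EuclideanSpace ℝ (Fin n) =>
      K (z.1 - z.2) * F z.2) (volume.prod volume) :=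
  (K.continuous.comp (continuous_fst.sub continuous_snd)).aestronglyMeasurable.mul hF.comp_snd

theorem aestronglyMeasurable_kernelConv (K : 𝓢(EuclideanSpace ℝ (Fin n), ℂ))
    {F : EuclideanSpace ℝ (Fin n) → ℂ} (hF : AEStronglyMeasurable F volume) :
    AEStronglyMeasurable (kernelConv K F) volume :=
  (aestronglyMeasurable_kernelConv_integrand K hF).integral_prod_right'

/-- **Young's inequality** for the convolution with a Schwartz kernel. -/
theorem eLpNorm_kernelConv_le (hp : 1 ≤ p) (hp' : p ≠ ⊤)
    (K : 𝓢(EuclideanSpace ℝ (Fin n), ℂ)) {F : EuclideanSpace ℝ (Fin n) → ℂ}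
    (hF : AEStronglyMeasurable F volume) :
    eLpNorm (kernelConv K F) p volume ≤ eLpNorm K 1 volume * eLpNorm F p volume := by
  have hp0 : p ≠ 0 := (zero_lt_one.trans_le hp).ne'
  rw [kernelConv_congr_ae K hF.ae_eq_mk, eLpNorm_congr_ae hF.ae_eq_mk]
  set G := hF.mk F
  have hG : StronglyMeasurable G := hF.stronglyMeasurable_mk
  have h1 : ∀ x, ‖kernelConv K G x‖ₑ ≤ ∫⁻ y, ‖K y‖ₑ * ‖G (x - y)‖ₑ := by
    intro x
    refine (enorm_integral_le_lintegral_enorm _).trans (le_of_eq ?_)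
    rw [← lintegral_sub_left_eq_self _ x]
    simp
  have hm : Measurable (Function.uncurry fun x y => ‖K y‖ₑ * ‖G (x - y)‖ₑ) :=
    ((K.continuous.measurable.comp measurable_snd).enorm).mul
      ((hG.measurable.comp (measurable_fst.sub measurable_snd)).enorm)
  have h2 := lintegral_rpow_lintegral_le (μ := volume) (ν := volume)
    (toReal_pos_of_one_le hp hp') hm
  have h0 : 0 < p.toReal := ENNReal.toReal_pos hp0 hp'
  calc eLpNorm (kernelConv K G) p volume
      ≤ (∫⁻ x, (∫⁻ y, ‖K y‖ₑ * ‖G (x - y)‖ₑ) ^ p.toReal) ^ (1 / p.toReal) := by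
        rw [eLpNorm_eq_lintegral_rpow_enorm_toReal hp0 hp']
        gcongr with x
        exact h1 x
    _ ≤ ∫⁻ y, (∫⁻ x, (‖K y‖ₑ * ‖G (x - y)‖ₑ) ^ p.toReal) ^ (1 / p.toReal) := h2
    _ = ∫⁻ y, ‖K y‖ₑ * eLpNorm G p volume := by
        refine lintegral_congr fun y => ?_
        simp_rw [ENNReal.mul_rpow_of_nonneg _ _ h0.le]
        rw [lintegral_const_mul' _ _ (by simp [h0.le]), lintegral_sub_right_eq_self
          (fun x => ‖G x‖ₑ ^ p.toReal) y, ENNReal.mul_rpow_of_nonneg _ _ (by positivity),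
          ← ENNReal.rpow_mul, eLpNorm_eq_lintegral_rpow_enorm_toReal hp0 hp']
        field_simp
        simp
    _ = _ := by
        rw [lintegral_mul_const _ K.continuous.measurable.enorm, eLpNorm_one_eq_lintegral_enorm]

theorem memLp_kernelConv (hp : 1 ≤ p) (hp' : p ≠ ⊤) (K : 𝓢(EuclideanSpace ℝ (Fin n), ℂ))
    {F : EuclideanSpace ℝ (Fin n) → ℂ} (hF : MemLp F p volume) :
    MemLp (kernelConv K F) p volume := by
  refine ⟨aestronglyMeasurable_kernelConv K hF.1, ?_⟩
  refine (eLpNorm_kernelConv_le hp hp' K hF.1).trans_lt ?_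
  exact ENNReal.mul_lt_top (K.memLp 1 volume).2 hF.2

/-- Fubini: the inner integral is bounded uniformly in `x` by Hölder, so integrability of `w` alone
suffices. -/
theorem integral_mul_kernelConv [hp : Fact (1 ≤ p)] (K : 𝓢(EuclideanSpace ℝ (Fin n), ℂ))
    {F w : EuclideanSpace ℝ (Fin n) → ℂ} (hF : MemLp F p volume) (hw : Integrable w volume) :
    ∫ x, w x * kernelConv K F x = ∫ y, F y * ∫ x, K (x - y) * w x := by
  have hC : eLpNorm K (1 - p⁻¹)⁻¹ volume * eLpNorm F p volume < ⊤ :=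
    ENNReal.mul_lt_top (K.memLp (1 - p⁻¹)⁻¹ volume).2 hF.2
  have hi : Integrable (fun z : EuclideanSpace ℝ (Fin n) × EuclideanSpace ℝ (Fin n) =>
      w z.1 * (K (z.1 - z.2) * F z.2)) (volume.prod volume) := by
    have hm := hw.1.comp_fst (ν := (volume : Measure (EuclideanSpace ℝ (Fin n)))) |>.mul
      (aestronglyMeasurable_kernelConv_integrand K hF.1)
    refine ⟨hm, ?_⟩
    rw [HasFiniteIntegral]
    erw [lintegral_prod _ hm.enorm]
    calc ∫⁻ x, ∫⁻ y, ‖w x * (K (x - y) * F y)‖ₑ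
        = ∫⁻ x, ‖w x‖ₑ * ∫⁻ y, ‖K (x - y) * F y‖ₑ := by
          refine lintegral_congr fun x => ?_
          simp_rw [enorm_mul (w x)]
          rw [lintegral_const_mul' _ _ enorm_ne_top]
      _ ≤ ∫⁻ x, ‖w x‖ₑ * (eLpNorm K (1 - p⁻¹)⁻¹ volume * eLpNorm F p volume) := by
          gcongr with x
          exact lintegral_enorm_kernelConv_integrand_le K hF x
      _ = (∫⁻ x, ‖w x‖ₑ) * (eLpNorm K (1 - p⁻¹)⁻¹ volume * eLpNorm F p volume) :=
          lintegral_mul_const' _ _ hC.ne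
      _ < ⊤ := ENNReal.mul_lt_top hw.2 hC
  unfold kernelConv
  simp_rw [← integral_const_mul]
  rw [integral_integral_swap hi]
  refine integral_congr_ae (Filter.Eventually.of_forall fun y => ?_)
  refine integral_congr_ae (Filter.Eventually.of_forall fun x => ?_)
  ring

/-- The action of the multiplier on test functions, through which it is defined on distributions:
convolution with the reflected kernel. -/
theorem IsWindow.fourier_smulLeftCLM_boxSymbol (hρ : IsWindow ρ) (k : Fin n → ℤ)
    (φ : 𝓢(EuclideanSpace ℝ (Fin n), ℂ)) (y : EuclideanSpace ℝ (Fin n)) :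
    𝓕 (smulLeftCLM ℂ (hρ.boxSymbol k) (𝓕⁻ φ)) y = ∫ x, hρ.boxKernel k (x - y) * φ x := by
  have h1 : ∀ x, hρ.boxKernel k (x - y) * φ x
      = compSubConstCLM ℂ y (hρ.boxKernel k) x * 𝓕 (𝓕⁻ φ) x := fun x => by
    rw [compSubConstCLM_apply, fourier_fourierInv_eq]
  simp_rw [h1]
  rw [← integral_fourier_mul_eq, fourier_coe, Real.fourier_eq]
  refine integral_congr_ae (Filter.Eventually.of_forall fun ξ => ?_)
  simp only
  rw [fourier_compSubConstCLM, hρ.fourier_boxKernel,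
    smulLeftCLM_apply_apply (hρ.boxSymbol k).hasTemperateGrowth, real_inner_comm]
  simp [Circle.smul_def, mul_assoc]

/-- `boxOp ρ k` acts on `L^p` functions as the convolution with its kernel. -/
theorem IsWindow.boxOp_toTemperedDistribution (hρ : IsWindow ρ) [hp : Fact (1 ≤ p)] (hp' : p ≠ ⊤)
    (k : Fin n → ℤ) {F : EuclideanSpace ℝ (Fin n) → ℂ} (hF : MemLp F p volume) :
    boxOp ρ k (Lp.toTemperedDistribution (hF.toLp F)) =
      Lp.toTemperedDistribution
        ((memLp_kernelConv hp.out hp' (hρ.boxKernel k) hF).toLp (kernelConv (hρ.boxKernel k) F)) := by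
  ext φ
  rw [hρ.boxOp_eq, TemperedDistribution.fourierMultiplierCLM_apply_apply,
    Lp.toTemperedDistribution_apply, Lp.toTemperedDistribution_apply]
  have h1 : ∫ x, φ x • ((memLp_kernelConv hp.out hp' (hρ.boxKernel k) hF).toLp
      (kernelConv (hρ.boxKernel k) F)) x = ∫ x, φ x * kernelConv (hρ.boxKernel k) F x := by
    refine integral_congr_ae ?_
    filter_upwards [MemLp.coeFn_toLp (memLp_kernelConv hp.out hp' (hρ.boxKernel k) hF)] with x hx
    rw [hx, smul_eq_mul]
  rw [h1, integral_mul_kernelConv _ hF φ.integrable]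
  refine integral_congr_ae ?_
  filter_upwards [MemLp.coeFn_toLp hF] with y hy
  rw [hy, hρ.fourier_smulLeftCLM_boxSymbol, smul_eq_mul, mul_comm]

end kernel

/-! ### Density of compactly supported functions in the Schwartz space. -/

section density

variable {V : Type*} [NormedAddCommGroup V] [NormedSpace ℝ V]

/-- For order zero the mean value inequality from the origin produces r‖x‖; for positive order the
chain rule produces a factor r^i ≤ r. -/
theorem exists_norm_iteratedFDeriv_le_of_comp_smul {χ : V → ℂ} (hχ : ContDiff ℝ ∞ χ)
    (hc : HasCompactSupport χ) (h0 : χ 0 = 1) (i : ℕ) :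
    ∃ C : ℝ, 0 ≤ C ∧ ∀ r : ℝ, 0 < r → r ≤ 1 → ∀ x : V,
      ‖iteratedFDeriv ℝ i (fun y => χ (r • y) - 1) x‖ ≤ C * r * (1 + ‖x‖) := by
  have hG : ContDiff ℝ ∞ fun y => χ y - 1 := hχ.sub contDiff_const
  have hfc : HasCompactSupport (fderiv ℝ χ) := hc.fderiv (𝕜 := ℝ)
  have hfs : ContDiff ℝ ∞ (fderiv ℝ χ) := hχ.fderiv_right (by simp)
  have hbound : ∀ j : ℕ, ∃ C : ℝ, ∀ x, ‖iteratedFDeriv ℝ j (fderiv ℝ χ) x‖ ≤ C := fun j =>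
    ((hfs.continuous_iteratedFDeriv (by exact_mod_cast le_top)).bounded_above_of_compact_support
      (hfc.iteratedFDeriv j))
  have hcomp : ∀ (r : ℝ) (x : V), iteratedFDeriv ℝ i (fun y => χ (r • y) - 1) x =
      r ^ i • iteratedFDeriv ℝ i (fun y => χ y - 1) (r • x) := fun r x =>
    congrFun (iteratedFDeriv_comp_const_smul (f := fun y => χ y - 1) r
      (hG.of_le (by exact_mod_cast le_top))) x
  rcases i with _ | j
  · obtain ⟨C, hC⟩ := hbound 0
    have hC0 : 0 ≤ C := (norm_nonneg _).trans (hC 0)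
    refine ⟨C, hC0, fun r hr hr1 x => ?_⟩
    rw [norm_iteratedFDeriv_zero]
    have := Convex.norm_image_sub_le_of_norm_fderiv_le (𝕜 := ℝ) (f := χ) (s := Set.univ)
      (C := C) (x := 0) (y := r • x) (fun y _ => (hχ.differentiable (by simp)).differentiableAt)
      (fun y _ => by simpa using hC y) convex_univ trivial trivial
    rw [h0, sub_zero, norm_smul, Real.norm_of_nonneg hr.le] at this
    refine this.trans ?_
    rw [← mul_assoc]
    gcongr
    linarith
  · obtain ⟨C, hC⟩ := hbound j
    have hC0 : 0 ≤ C := (norm_nonneg _).trans (hC 0)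
    refine ⟨C, hC0, fun r hr hr1 x => ?_⟩
    rw [hcomp, norm_smul, norm_pow, Real.norm_of_nonneg hr.le, ← norm_iteratedFDeriv_fderiv]
    have e : fderiv ℝ (fun y => χ y - 1) = fderiv ℝ χ := by
      exact funext fun y => fderiv_sub_const 1
    rw [e]
    calc r ^ (j + 1) * ‖iteratedFDeriv ℝ j (fderiv ℝ χ) (r • x)‖ ≤ r * C := by
          gcongr
          · exact pow_le_of_le_one hr.le hr1 (by simp)
          · exact hC _
      _ = C * r * 1 := by ring
      _ ≤ _ := by gcongr; linarith [norm_nonneg x]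

/-- By the Leibniz rule every seminorm of the difference is O(1/(N + 1)); the extra factor 1 + ‖x‖
is absorbed by the seminorm with one more power of ‖x‖. -/
theorem tendsto_smulLeftCLM_cutoff {χ : V → ℂ} (hχ : ContDiff ℝ ∞ χ)
    (hc : HasCompactSupport χ) (h0 : χ 0 = 1) (hg : ∀ r : ℝ, (fun y => χ (r • y)).HasTemperateGrowth)
    (ψ : 𝓢(V, ℂ)) :
    Filter.Tendsto (fun N : ℕ => smulLeftCLM ℂ (fun y => χ ((N + 1 : ℝ)⁻¹ • y)) ψ)
      Filter.atTop (nhds ψ) := by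
  rw [(schwartz_withSeminorms ℝ V ℂ).tendsto_nhds]
  rintro ⟨k, m⟩ ε hε
  choose C hC0 hC using exists_norm_iteratedFDeriv_le_of_comp_smul hχ hc h0
  set M : ℝ := ∑ i ∈ Finset.range (m + 1), (m.choose i : ℝ) * (C i *
    (SchwartzMap.seminorm ℝ k (m - i) ψ + SchwartzMap.seminorm ℝ (k + 1) (m - i) ψ)) with hM
  have hM0 : 0 ≤ M := Finset.sum_nonneg fun i _ => by
    have := hC0 i
    positivity
  have key : ∀ N : ℕ, SchwartzMap.seminorm ℝ k m
      (smulLeftCLM ℂ (fun y => χ ((N + 1 : ℝ)⁻¹ • y)) ψ - ψ) ≤ M * (N + 1 : ℝ)⁻¹ := by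
    intro N
    set r : ℝ := (N + 1 : ℝ)⁻¹
    have hr : 0 < r := by positivity
    have hr1 : r ≤ 1 := inv_le_one_of_one_le₀ (by simp)
    refine SchwartzMap.seminorm_le_bound ℝ k m _ (by positivity) fun x => ?_
    have e : (⇑(smulLeftCLM ℂ (fun y => χ (r • y)) ψ - ψ) : V → ℂ) =
        fun y => (χ (r • y) - 1) • ψ y := by
      ext y
      simp [smulLeftCLM_apply_apply (hg r), sub_mul]
    rw [e]
    have hGs : ContDiff ℝ ∞ fun y => χ (r • y) - 1 :=
      (hχ.comp (contDiff_const_smul r)).sub contDiff_const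
    have h1 := norm_iteratedFDeriv_smul_le (𝕜 := ℝ) hGs (ψ.smooth ⊤) x (n := m)
      (by exact_mod_cast le_top)
    calc ‖x‖ ^ k * ‖iteratedFDeriv ℝ m (fun y => (χ (r • y) - 1) • ψ y) x‖
        ≤ ‖x‖ ^ k * ∑ i ∈ Finset.range (m + 1), (m.choose i : ℝ) *
            ‖iteratedFDeriv ℝ i (fun y => χ (r • y) - 1) x‖ *
              ‖iteratedFDeriv ℝ (m - i) ψ x‖ := by gcongr
      _ = ∑ i ∈ Finset.range (m + 1), (m.choose i : ℝ) *
            (‖iteratedFDeriv ℝ i (fun y => χ (r • y) - 1) x‖ *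
              (‖x‖ ^ k * ‖iteratedFDeriv ℝ (m - i) ψ x‖)) := by
          rw [Finset.mul_sum]
          exact Finset.sum_congr rfl fun i _ => by ring
      _ ≤ ∑ i ∈ Finset.range (m + 1), (m.choose i : ℝ) * (C i *
            (SchwartzMap.seminorm ℝ k (m - i) ψ + SchwartzMap.seminorm ℝ (k + 1) (m - i) ψ)) * r := by
          refine Finset.sum_le_sum fun i _ => ?_
          rw [mul_assoc]
          refine mul_le_mul_of_nonneg_left ?_ (by positivity)
          have h2 := ψ.le_seminorm ℝ k (m - i) x
          have h3 := ψ.le_seminorm ℝ (k + 1) (m - i) x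
          calc _ ≤ (C i * r * (1 + ‖x‖)) * (‖x‖ ^ k * ‖iteratedFDeriv ℝ (m - i) ψ x‖) := by
                gcongr
                exact hC i r hr hr1 x
            _ = C i * (‖x‖ ^ k * ‖iteratedFDeriv ℝ (m - i) ψ x‖ +
                  ‖x‖ ^ (k + 1) * ‖iteratedFDeriv ℝ (m - i) ψ x‖) * r := by ring
            _ ≤ _ := by
                have := hC0 i
                gcongr
      _ = M * r := by rw [hM, Finset.sum_mul]
  have ht : Filter.Tendsto (fun N : ℕ => M * (N + 1 : ℝ)⁻¹) Filter.atTop (nhds 0) := by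
    have := (tendsto_one_div_add_atTop_nhds_zero_nat (𝕜 := ℝ)).const_mul M
    simpa using this
  filter_upwards [ht.eventually_lt_const hε] with N hN using (key N).trans_lt hN

/-- A tempered distribution that vanishes on compactly supported functions is zero. -/
theorem temperedDistribution_eq_zero {V : Type*} [NormedAddCommGroup V] [InnerProductSpace ℝ V]
    [FiniteDimensional ℝ V] (T : 𝓢'(V, ℂ))
    (hT : ∀ ψ : 𝓢(V, ℂ), HasCompactSupport ψ → T ψ = 0) : T = 0 := by
  ext ψ
  let b : ContDiffBump (0 : V) := ⟨1, 2, one_pos, one_lt_two⟩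
  set χ : V → ℂ := fun x => ((b x : ℝ) : ℂ)
  have hχ : ContDiff ℝ ∞ χ := Complex.ofRealCLM.contDiff.comp b.contDiff
  have hc : HasCompactSupport χ := b.hasCompactSupport.comp_left (g := fun t : ℝ => (t : ℂ)) (by simp)
  have h0 : χ 0 = 1 := by
    have : b 0 = 1 := b.one_of_mem_closedBall (by simp [b])
    simp [χ, this]
  have hgc : ∀ r : ℝ, (fun y => χ (r • y)).HasTemperateGrowth := fun r =>
    (hc.toSchwartzMap hχ).hasTemperateGrowth.comp
      (ContinuousLinearMap.hasTemperateGrowth (r • ContinuousLinearMap.id ℝ V))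
  have ht := ((map_continuous T).tendsto ψ).comp (tendsto_smulLeftCLM_cutoff hχ hc h0 hgc ψ)
  refine tendsto_nhds_unique ht ?_
  have : (T ∘ fun N : ℕ => smulLeftCLM ℂ (fun y => χ ((N + 1 : ℝ)⁻¹ • y)) ψ) = fun _ => 0 := by
    ext N
    refine hT _ ?_
    have hN : ((N + 1 : ℝ)⁻¹) ≠ 0 := by positivity
    have h1 : HasCompactSupport fun y : V => χ ((N + 1 : ℝ)⁻¹ • y) :=
      hc.comp_homeomorph (Homeomorph.smulOfNeZero _ hN)
    rw [smulLeftCLM_apply (hgc _)]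
    exact h1.smul_right
  rw [this]
  exact tendsto_const_nhds

end density

/-! ### Box operators on L^p, almost orthogonality and Bernstein's inequality. -/

section boxCLM

open FourierTransform

variable {n : ℕ} {ρ : EuclideanSpace ℝ (Fin n) → ℝ} {p : ℝ≥0∞} [hp : Fact (1 ≤ p)]

theorem kernelConv_add (K : 𝓢(EuclideanSpace ℝ (Fin n), ℂ))
    {F G : EuclideanSpace ℝ (Fin n) → ℂ} (hF : MemLp F p volume) (hG : MemLp G p volume) :
    kernelConv K (F + G) = kernelConv K F + kernelConv K G := by
  ext x
  simp only [kernelConv, Pi.add_apply, mul_add]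
  exact integral_add (integrable_kernelConv_integrand K hF x)
    (integrable_kernelConv_integrand K hG x)

theorem kernelConv_const_smul (K : 𝓢(EuclideanSpace ℝ (Fin n), ℂ)) (c : ℂ)
    (F : EuclideanSpace ℝ (Fin n) → ℂ) : kernelConv K (c • F) = c • kernelConv K F := by
  ext x
  simp only [kernelConv, Pi.smul_apply, smul_eq_mul, mul_left_comm _ c]
  exact integral_const_mul c _

/-- Convolution with a Schwartz kernel, as a continuous linear map on `L^p`. -/
noncomputable def kernelConvCLM (hp' : p ≠ ⊤) (K : 𝓢(EuclideanSpace ℝ (Fin n), ℂ)) :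
    Lp ℂ p (volume : Measure (EuclideanSpace ℝ (Fin n))) →L[ℂ]
      Lp ℂ p (volume : Measure (EuclideanSpace ℝ (Fin n))) :=
  LinearMap.mkContinuous
    { toFun := fun f => (memLp_kernelConv hp.out hp' K (Lp.memLp f)).toLp (kernelConv K f)
      map_add' := fun f g => by
        rw [← MemLp.toLp_add]
        exact MemLp.toLp_congr _ _ (.of_eq (by
          rw [kernelConv_congr_ae K (Lp.coeFn_add f g), kernelConv_add K (Lp.memLp f) (Lp.memLp g)]))
      map_smul' := fun c f => by
        rw [RingHom.id_apply, ← MemLp.toLp_const_smul]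
        exact MemLp.toLp_congr _ _ (.of_eq (by
          rw [kernelConv_congr_ae K (Lp.coeFn_smul c f), kernelConv_const_smul])) }
    (eLpNorm K 1 volume).toReal fun f => by
      simp only [LinearMap.coe_mk, AddHom.coe_mk]
      rw [Lp.norm_toLp, Lp.norm_def, ← ENNReal.toReal_mul]
      exact ENNReal.toReal_mono (ENNReal.mul_lt_top (K.memLp 1 volume).2 (Lp.memLp f).2).ne
        (eLpNorm_kernelConv_le hp.out hp' K (Lp.memLp f).1)

theorem coeFn_kernelConvCLM (hp' : p ≠ ⊤) (K : 𝓢(EuclideanSpace ℝ (Fin n), ℂ))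
    (f : Lp ℂ p (volume : Measure (EuclideanSpace ℝ (Fin n)))) :
    kernelConvCLM hp' K f =ᵐ[volume] kernelConv K f :=
  MemLp.coeFn_toLp (memLp_kernelConv hp.out hp' K (Lp.memLp f))

theorem toTemperedDistribution_injective :
    Function.Injective (Lp.toTemperedDistribution (E := EuclideanSpace ℝ (Fin n)) (F := ℂ)
      (μ := volume) (p := p)) :=
  LinearMap.ker_eq_bot.1
    (Lp.ker_toTemperedDistributionCLM_eq_bot (F := ℂ) (p := p)
      (μ := (volume : Measure (EuclideanSpace ℝ (Fin n)))))

theorem IsWindow.toTemperedDistribution_kernelConvCLM (hρ : IsWindow ρ) (hp' : p ≠ ⊤)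
    (k : Fin n → ℤ) (f : Lp ℂ p (volume : Measure (EuclideanSpace ℝ (Fin n)))) :
    Lp.toTemperedDistribution (kernelConvCLM hp' (hρ.boxKernel k) f) =
      boxOp ρ k (Lp.toTemperedDistribution f) := by
  have := hρ.boxOp_toTemperedDistribution hp' k (Lp.memLp f)
  rw [Lp.toLp_coeFn] at this
  rw [this]
  rfl

theorem IsWindow.distLpNorm_boxOp (hρ : IsWindow ρ) (hp' : p ≠ ⊤)
    (k : Fin n → ℤ) (f : Lp ℂ p (volume : Measure (EuclideanSpace ℝ (Fin n)))) :
    distLpNorm p (boxOp ρ k (Lp.toTemperedDistribution f)) =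
      ‖kernelConvCLM hp' (hρ.boxKernel k) f‖ₑ := by
  rw [← hρ.toTemperedDistribution_kernelConvCLM hp']
  unfold distLpNorm
  refine le_antisymm (iInf₂_le_of_le _ rfl le_rfl) (le_iInf₂ fun g hg => ?_)
  rw [toTemperedDistribution_injective hg]

/-- The lattice points whose coordinates are at most `r` in absolute value. -/
noncomputable def latticeCube (n : ℕ) (r : ℝ) : Finset (Fin n → ℤ) :=
  (finite_latticeBox (0 : EuclideanSpace ℝ (Fin n)) r).toFinset

theorem mem_latticeCube {r : ℝ} {e : Fin n → ℤ} :
    e ∈ latticeCube n r ↔ ∀ i, |(e i : ℝ)| ≤ r := by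
  simp [latticeCube, latticeBox]

/-- Each symbol has half-width 1 around its lattice point (after scaling by 2π), so only neighbours
within 2 meet the support of the `k`-th, and there they sum to 1. -/
theorem IsWindow.sum_boxSymbol_mul_boxSymbol (hρ : IsWindow ρ) (k : Fin n → ℤ)
    (ξ : EuclideanSpace ℝ (Fin n)) :
    ∑ e ∈ latticeCube n 2, hρ.boxSymbol k ξ * hρ.boxSymbol (k + e) ξ = hρ.boxSymbol k ξ := by
  classical
  by_cases h : hρ.boxSymbol k ξ = 0
  · simp [h]
  rw [← Finset.mul_sum]
  have h1 := hρ.sum_boxSymbol ξ (s := (latticeCube n 2).image fun e => k + e) fun l hl => by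
    rw [Finset.coe_image]
    refine ⟨l - k, ?_, by simp⟩
    rw [Finset.mem_coe, mem_latticeCube]
    intro i
    have h2 := abs_le.1 (hρ.abs_le_of_boxSymbol_ne_zero h i)
    have h3 := abs_le.1 (hl i)
    simp only [PiLp.smul_apply, smul_eq_mul] at h3
    rw [abs_le]
    push_cast [Pi.sub_apply]
    constructor <;> linarith
  rw [Finset.sum_image (fun a _ b _ h => by simpa using h)] at h1
  rw [h1, mul_one]

theorem IsWindow.boxOp_sum_boxOp (hρ : IsWindow ρ) (k : Fin n → ℤ)
    (T : 𝓢'(EuclideanSpace ℝ (Fin n), ℂ)) :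
    ∑ e ∈ latticeCube n 2, boxOp ρ (k + e) (boxOp ρ k T) = boxOp ρ k T := by
  simp_rw [hρ.boxOp_eq]
  have h1 : ∀ e, TemperedDistribution.fourierMultiplierCLM ℂ (hρ.boxSymbol (k + e))
      (TemperedDistribution.fourierMultiplierCLM ℂ (hρ.boxSymbol k) T) =
      TemperedDistribution.fourierMultiplierCLM ℂ (⇑(hρ.boxSymbol k) * ⇑(hρ.boxSymbol (k + e))) T :=
    fun e => TemperedDistribution.fourierMultiplierCLM_fourierMultiplierCLM_apply
      (hρ.boxSymbol k).hasTemperateGrowth (hρ.boxSymbol (k + e)).hasTemperateGrowth T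
  simp_rw [h1]
  rw [← sum_apply, ← TemperedDistribution.fourierMultiplierCLM_sum]
  · congr 2
    ext ξ
    exact hρ.sum_boxSymbol_mul_boxSymbol k ξ
  · exact fun e _ => (hρ.boxSymbol k).hasTemperateGrowth.mul (hρ.boxSymbol (k + e)).hasTemperateGrowth

theorem IsWindow.boxOp_boxOp_eq_zero (hρ : IsWindow ρ) {k l : Fin n → ℤ}
    (hkl : k - l ∉ latticeCube n 2) (T : 𝓢'(EuclideanSpace ℝ (Fin n), ℂ)) :
    boxOp ρ k (boxOp ρ l T) = 0 := by
  rw [hρ.boxOp_eq, hρ.boxOp_eq,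
    TemperedDistribution.fourierMultiplierCLM_fourierMultiplierCLM_apply
      (hρ.boxSymbol l).hasTemperateGrowth (hρ.boxSymbol k).hasTemperateGrowth]
  have : ⇑(hρ.boxSymbol l) * ⇑(hρ.boxSymbol k) = fun _ => 0 := by
    ext ξ
    rw [Pi.mul_apply]
    by_contra h
    apply hkl
    rw [mem_latticeCube]
    intro i
    have h2 := abs_le.1 (hρ.abs_le_of_boxSymbol_ne_zero (left_ne_zero_of_mul h) i)
    have h3 := abs_le.1 (hρ.abs_le_of_boxSymbol_ne_zero (right_ne_zero_of_mul h) i)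
    rw [abs_le]
    push_cast [Pi.sub_apply]
    constructor <;> linarith
  rw [this, TemperedDistribution.fourierMultiplierCLM_const]
  simp

/-- The `L^p` norm of the `k`-th box of a function. -/
noncomputable def IsWindow.boxNorm (hρ : IsWindow ρ) (p : ℝ≥0∞) (k : Fin n → ℤ)
    (F : EuclideanSpace ℝ (Fin n) → ℂ) : ℝ≥0∞ := eLpNorm (kernelConv (hρ.boxKernel k) F) p volume

theorem IsWindow.enorm_kernelConvCLM_toLp (hρ : IsWindow ρ) (hp' : p ≠ ⊤) (k : Fin n → ℤ)
    {F : EuclideanSpace ℝ (Fin n) → ℂ} (hF : MemLp F p volume) :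
    ‖kernelConvCLM hp' (hρ.boxKernel k) (hF.toLp F)‖ₑ = hρ.boxNorm p k F := by
  rw [Lp.enorm_def, eLpNorm_congr_ae (coeFn_kernelConvCLM hp' _ _), IsWindow.boxNorm,
    kernelConv_congr_ae _ (MemLp.coeFn_toLp hF)]

theorem IsWindow.eLpNorm_boxKernel (hρ : IsWindow ρ) (k : Fin n → ℤ) (r : ℝ≥0∞) :
    eLpNorm (hρ.boxKernel k) r volume = eLpNorm (hρ.boxKernel 0) r volume :=
  eLpNorm_congr_norm_ae (.of_forall fun x => hρ.norm_boxKernel k x)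

theorem IsWindow.boxNorm_le (hρ : IsWindow ρ) (hp' : p ≠ ⊤) (k : Fin n → ℤ)
    {F : EuclideanSpace ℝ (Fin n) → ℂ} (hF : MemLp F p volume) :
    hρ.boxNorm p k F ≤ eLpNorm (hρ.boxKernel 0) 1 volume * eLpNorm F p volume := by
  rw [← hρ.eLpNorm_boxKernel k]
  exact eLpNorm_kernelConv_le hp.out hp' _ hF.1

theorem IsWindow.boxNorm_kernelConv_eq_zero (hρ : IsWindow ρ) (hp' : p ≠ ⊤) {k l : Fin n → ℤ}
    (hkl : k - l ∉ latticeCube n 2) {F : EuclideanSpace ℝ (Fin n) → ℂ} (hF : MemLp F p volume) :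
    hρ.boxNorm p k (kernelConv (hρ.boxKernel l) F) = 0 := by
  rw [← hρ.enorm_kernelConvCLM_toLp hp' k (memLp_kernelConv hp.out hp' _ hF), enorm_eq_zero]
  apply toTemperedDistribution_injective
  rw [hρ.toTemperedDistribution_kernelConvCLM, ← hρ.boxOp_toTemperedDistribution hp' l hF,
    hρ.boxOp_boxOp_eq_zero hkl]
  exact (map_zero (Lp.toTemperedDistributionCLM ℂ volume p)).symm

/-- A reproducing formula: a box is recovered from itself by the neighbouring kernels. It is what
yields Bernstein's inequality. -/
theorem IsWindow.kernelConv_eq_sum (hρ : IsWindow ρ) (hp' : p ≠ ⊤) (k : Fin n → ℤ)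
    {F : EuclideanSpace ℝ (Fin n) → ℂ} (hF : MemLp F p volume) :
    kernelConv (hρ.boxKernel k) F =ᵐ[volume] fun x => ∑ e ∈ latticeCube n 2,
      kernelConv (hρ.boxKernel (k + e)) (kernelConv (hρ.boxKernel k) F) x := by
  have hm := memLp_kernelConv hp.out hp' (hρ.boxKernel k) hF
  set G := kernelConv (hρ.boxKernel k) F
  have h : ∑ e ∈ latticeCube n 2, kernelConvCLM hp' (hρ.boxKernel (k + e)) (hm.toLp G) =
      hm.toLp G := by
    apply toTemperedDistribution_injective
    have h1 : ∀ g : Lp ℂ p (volume : Measure (EuclideanSpace ℝ (Fin n))),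
      Lp.toTemperedDistribution g = Lp.toTemperedDistributionCLM ℂ volume p g := fun _ => rfl
    rw [h1, map_sum]
    simp_rw [← h1, hρ.toTemperedDistribution_kernelConvCLM]
    rw [← hρ.boxOp_toTemperedDistribution hp' k hF, hρ.boxOp_sum_boxOp]
  have h2 : ∀ e ∈ latticeCube n 2, ∀ᵐ x,
      kernelConvCLM hp' (hρ.boxKernel (k + e)) (hm.toLp G) x =
        kernelConv (hρ.boxKernel (k + e)) G x := fun e _ => by
    have h3 := coeFn_kernelConvCLM hp' (hρ.boxKernel (k + e)) (hm.toLp G)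
    rwa [kernelConv_congr_ae _ (MemLp.coeFn_toLp hm)] at h3
  have h4 := (Filter.eventually_all_finset _).2 h2
  have h5 := Lp.coeFn_finsetSum (latticeCube n 2)
    fun e => kernelConvCLM hp' (hρ.boxKernel (k + e)) (hm.toLp G)
  rw [h] at h5
  filter_upwards [h4, h5, MemLp.coeFn_toLp hm] with x h6 h7 h8
  rw [← h8, h7, Finset.sum_apply]
  exact Finset.sum_congr rfl h6

/-- The Bernstein constant of a window. -/
noncomputable def IsWindow.bernsteinConst (hρ : IsWindow ρ) (p : ℝ≥0∞) : ℝ≥0∞ :=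
  (latticeCube n 2).card * eLpNorm (hρ.boxKernel 0) (1 - p⁻¹)⁻¹ volume

theorem IsWindow.bernsteinConst_ne_top (hρ : IsWindow ρ) (p : ℝ≥0∞) : hρ.bernsteinConst p ≠ ⊤ :=
  ENNReal.mul_ne_top (by simp) ((hρ.boxKernel 0).memLp (1 - p⁻¹)⁻¹ volume).2.ne

/-- **Bernstein's inequality** for the boxes. -/
theorem IsWindow.eLpNorm_top_kernelConv_le (hρ : IsWindow ρ) (hp' : p ≠ ⊤) (k : Fin n → ℤ)
    {F : EuclideanSpace ℝ (Fin n) → ℂ} (hF : MemLp F p volume) :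
    eLpNorm (kernelConv (hρ.boxKernel k) F) ⊤ volume ≤
      hρ.bernsteinConst p * hρ.boxNorm p k F := by
  rw [eLpNorm_exponent_top]
  refine eLpNormEssSup_le_of_ae_enorm_bound ?_
  -- Each term of the reproducing formula is bounded pointwise by Hölder, applied to a neighbouring
  -- kernel and the box itself.
  filter_upwards [hρ.kernelConv_eq_sum hp' k hF] with x hx
  rw [hx]
  refine (enorm_sum_le _ _).trans ?_
  rw [IsWindow.bernsteinConst, mul_assoc, ← nsmul_eq_mul]
  refine Finset.sum_le_card_nsmul _ _ _ fun e _ => ?_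
  rw [← hρ.eLpNorm_boxKernel (k + e)]
  exact enorm_kernelConv_le _ (memLp_kernelConv hp.out hp' _ hF) x

end boxCLM

/-! ### Series in L^p and reconstruction of a function from its boxes. -/

section reconstruction

open FourierTransform

variable {n : ℕ} {ρ : EuclideanSpace ℝ (Fin n) → ℝ} {p : ℝ≥0∞} [hp : Fact (1 ≤ p)]

theorem Lp.tsum_toLp_eq {ι X : Type*} [Countable ι] {mX : MeasurableSpace X} {μ : Measure X}
    {Fi : ι → X → ℂ} {F : X → ℂ}
    (hFi : ∀ i, MemLp (Fi i) p μ) (hs : ∑' i, eLpNorm (Fi i) p μ ≠ ⊤)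
    (hF : ∀ᵐ x ∂μ, HasSum (fun i => Fi i x) (F x)) :
    ∃ h : MemLp F p μ, ∑' i, (hFi i).toLp (Fi i) = h.toLp F := by
  have h1 : ∑' i, ‖(hFi i).toLp (Fi i)‖ₑ ≠ ⊤ := by simpa [Lp.enorm_toLp] using hs
  have h2 := Lp.hasSum_coeFn_tsum h1
  have h3 : ∀ᵐ x ∂μ, ∀ i, (hFi i).toLp (Fi i) x = Fi i x :=
    ae_all_iff.2 fun i => MemLp.coeFn_toLp (hFi i)
  have h4 : ⇑(∑' i, (hFi i).toLp (Fi i)) =ᵐ[μ] F := by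
    filter_upwards [h2, h3, hF] with x hx1 hx2 hx3
    simp_rw [hx2] at hx1
    exact hx1.unique hx3
  have h5 : MemLp F p μ := (memLp_congr_ae h4).1 (Lp.memLp _)
  refine ⟨h5, ?_⟩
  ext1
  exact h4.trans (MemLp.coeFn_toLp h5).symm

/-- The series converges absolutely in L^p to its pointwise sum, and box operators are continuous
there. This handles every infinite series below. -/
theorem IsWindow.boxNorm_tsum_le {ι : Type*} [Countable ι] (hρ : IsWindow ρ) (hp' : p ≠ ⊤)
    {Fi : ι → EuclideanSpace ℝ (Fin n) → ℂ} {F : EuclideanSpace ℝ (Fin n) → ℂ}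
    (hFi : ∀ i, MemLp (Fi i) p volume) (hs : ∑' i, eLpNorm (Fi i) p volume ≠ ⊤)
    (hF : ∀ᵐ x, HasSum (fun i => Fi i x) (F x)) :
    MemLp F p volume ∧ eLpNorm F p volume ≤ ∑' i, eLpNorm (Fi i) p volume ∧
      ∀ k, hρ.boxNorm p k F ≤ ∑' i, hρ.boxNorm p k (Fi i) := by
  obtain ⟨h, he⟩ := Lp.tsum_toLp_eq hFi hs hF
  have h1 : ∑' i, ‖(hFi i).toLp (Fi i)‖ₑ ≠ ⊤ := by simpa [Lp.enorm_toLp] using hs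
  have hsum : Summable fun i => (hFi i).toLp (Fi i) :=
    (tsum_enorm_ne_top_iff_summable_norm.1 h1).of_norm
  refine ⟨h, ?_, fun k => ?_⟩
  · rw [← Lp.enorm_toLp (hf := h), ← he]
    simpa [Lp.enorm_toLp] using enorm_tsum_le_tsum_enorm (f := fun i => (hFi i).toLp (Fi i))
  · rw [← hρ.enorm_kernelConvCLM_toLp hp' k h, ← he,
      ContinuousLinearMap.map_tsum _ hsum]
    simp_rw [← hρ.enorm_kernelConvCLM_toLp hp' k (hFi _)]
    exact enorm_tsum_le_tsum_enorm

/-- The Fourier transform of the difference vanishes on compactly supported test functions: only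
finitely many symbols meet the support, and they sum to 1 on it. By density it is zero. -/
theorem IsWindow.tsum_kernelConvCLM (hρ : IsWindow ρ) (hp' : p ≠ ⊤)
    (f : Lp ℂ p (volume : Measure (EuclideanSpace ℝ (Fin n))))
    (hs : ∑' k, ‖kernelConvCLM hp' (hρ.boxKernel k) f‖ₑ ≠ ⊤) :
    ∑' k, kernelConvCLM hp' (hρ.boxKernel k) f = f := by
  classical
  have hsum : Summable fun k => kernelConvCLM hp' (hρ.boxKernel k) f :=
    (tsum_enorm_ne_top_iff_summable_norm.1 hs).of_norm
  set S := ∑' k, kernelConvCLM hp' (hρ.boxKernel k) f with hS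
  apply toTemperedDistribution_injective
  rw [← sub_eq_zero]
  set T := Lp.toTemperedDistribution S - Lp.toTemperedDistribution f with hT
  have hFT : 𝓕 T = 0 := by
    refine temperedDistribution_eq_zero _ fun ψ hψ => ?_
    rw [TemperedDistribution.fourier_apply]
    obtain ⟨R, hR⟩ := hψ.isCompact.isBounded.subset_closedBall 0
    -- On the support of `ψ` one has |2π ξ_i| ≤ 2πR, and the symbols have half-width 1.
    set s := latticeCube n (2 * Real.pi * R + 1)
    have hs1 : ∀ ξ, ψ ξ ≠ 0 → latticeBox ((2 * Real.pi) • ξ) 1 ⊆ s := by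
      intro ξ hξ l hl
      rw [Finset.mem_coe, mem_latticeCube]
      intro i
      have h1 : ‖ξ‖ ≤ R := by simpa using hR (subset_tsupport ψ hξ)
      have h2 : |ξ i| ≤ R := (PiLp.norm_apply_le ξ i).trans h1
      have h3 : |(2 * Real.pi) * ξ i - l i| ≤ 1 := by simpa using hl i
      have h4 : |2 * Real.pi * ξ i| ≤ 2 * Real.pi * R := by
        rw [abs_mul, abs_of_pos (by positivity)]; gcongr
      have := abs_le.1 h3
      have := abs_le.1 h4
      rw [abs_le]; constructor <;> linarith
    have h0 : ∀ k ∉ s, smulLeftCLM ℂ (hρ.boxSymbol k) ψ = 0 := by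
      intro k hk
      ext ξ
      rw [smulLeftCLM_apply_apply (hρ.boxSymbol k).hasTemperateGrowth]
      by_contra h
      have h' : hρ.boxSymbol k ξ ≠ 0 ∧ ψ ξ ≠ 0 := by
        simpa [not_or] using h
      refine hk (hs1 ξ h'.2 fun i => ?_)
      simpa using hρ.abs_le_of_boxSymbol_ne_zero h'.1 i
    have h1 : ∑ k ∈ s, smulLeftCLM ℂ (hρ.boxSymbol k) ψ = ψ := by
      ext ξ
      rw [sum_apply]
      simp_rw [smulLeftCLM_apply_apply (hρ.boxSymbol _).hasTemperateGrowth]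
      by_cases hξ : ψ ξ = 0
      · simp [hξ]
      · rw [← Finset.sum_smul, hρ.sum_boxSymbol ξ (hs1 ξ hξ), one_smul]
    have h2 : HasSum (fun k => (boxOp ρ k (Lp.toTemperedDistribution f)) (𝓕 ψ))
        (Lp.toTemperedDistribution S (𝓕 ψ)) := by
      have h3 := hsum.hasSum.mapL (Lp.toTemperedDistributionCLM ℂ volume p)
      have h4 : Continuous fun T : 𝓢'(EuclideanSpace ℝ (Fin n), ℂ) => T (𝓕 ψ) := by
        fun_prop
      have h5 := h3.map ({ toFun := fun T : 𝓢'(EuclideanSpace ℝ (Fin n), ℂ) => T (𝓕 ψ)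
                           map_zero' := rfl
                           map_add' := fun _ _ => rfl } :
        𝓢'(EuclideanSpace ℝ (Fin n), ℂ) →+ ℂ) h4
      have h6 : ∀ k, boxOp ρ k (Lp.toTemperedDistribution f) =
        Lp.toTemperedDistributionCLM ℂ volume p (kernelConvCLM hp' (hρ.boxKernel k) f) :=
        fun k => (hρ.toTemperedDistribution_kernelConvCLM hp' k f).symm
      simp_rw [h6]
      exact h5
    have h7 : ∀ k, (boxOp ρ k (Lp.toTemperedDistribution f)) (𝓕 ψ) =
        Lp.toTemperedDistribution f (𝓕 (smulLeftCLM ℂ (hρ.boxSymbol k) ψ)) := fun k => by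
      rw [hρ.boxOp_eq, TemperedDistribution.fourierMultiplierCLM_apply_apply,
        fourierInv_fourier_eq]
    simp_rw [h7] at h2
    have h8 := h2.unique (hasSum_sum_of_ne_finset_zero (s := s) fun k hk => by
      rw [h0 k hk, FourierTransform.fourier_zero, map_zero])
    have h9 : (∑ k ∈ s, Lp.toTemperedDistribution f (𝓕 (smulLeftCLM ℂ (hρ.boxSymbol k) ψ))) =
        Lp.toTemperedDistribution f (𝓕 ψ) := by
      rw [← map_sum]
      congr 1
      have := map_sum (fourierCLM ℂ 𝓢(EuclideanSpace ℝ (Fin n), ℂ))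
        (fun k => smulLeftCLM ℂ (hρ.boxSymbol k) ψ) s
      rw [h1] at this
      exact this.symm
    change Lp.toTemperedDistribution S (𝓕 ψ) - Lp.toTemperedDistribution f (𝓕 ψ) = 0
    rw [h8, h9, sub_self]
  have hT0 : 𝓕⁻ (𝓕 T) = T := FourierPair.fourierInv_fourier_eq T
  rw [← hT0, hFT]
  exact map_zero (fourierInvCLM ℂ 𝓢'(EuclideanSpace ℝ (Fin n), ℂ))

theorem IsWindow.hasSum_kernelConv (hρ : IsWindow ρ) (hp' : p ≠ ⊤)
    {F : EuclideanSpace ℝ (Fin n) → ℂ} (hF : MemLp F p volume)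
    (hs : ∑' k, hρ.boxNorm p k F ≠ ⊤) :
    ∀ᵐ x, HasSum (fun k => kernelConv (hρ.boxKernel k) F x) (F x) := by
  simp_rw [← hρ.enorm_kernelConvCLM_toLp hp' _ hF] at hs
  have h1 := Lp.hasSum_coeFn_tsum hs
  rw [hρ.tsum_kernelConvCLM hp' _ hs] at h1
  have h2 : ∀ᵐ x, ∀ k, kernelConvCLM hp' (hρ.boxKernel k) (hF.toLp F) x =
      kernelConv (hρ.boxKernel k) F x := ae_all_iff.2 fun k => by
    have := coeFn_kernelConvCLM hp' (hρ.boxKernel k) (hF.toLp F)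
    rwa [kernelConv_congr_ae _ (MemLp.coeFn_toLp hF)] at this
  filter_upwards [h1, h2, MemLp.coeFn_toLp hF] with x hx1 hx2 hx3
  simp_rw [hx2, hx3] at hx1
  exact hx1

theorem IsWindow.eLpNorm_le_tsum_boxNorm (hρ : IsWindow ρ) (hp' : p ≠ ⊤)
    {F : EuclideanSpace ℝ (Fin n) → ℂ} (hF : MemLp F p volume)
    (hs : ∑' k, hρ.boxNorm p k F ≠ ⊤) :
    eLpNorm F p volume ≤ ∑' k, hρ.boxNorm p k F :=
  (hρ.boxNorm_tsum_le hp' (fun _ => memLp_kernelConv hp.out hp' _ hF) hs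
    (hρ.hasSum_kernelConv hp' hF hs)).2.1

/-- Bernstein's inequality, summed over the reconstruction. -/
theorem IsWindow.ae_enorm_le_tsum_boxNorm (hρ : IsWindow ρ) (hp' : p ≠ ⊤)
    {F : EuclideanSpace ℝ (Fin n) → ℂ} (hF : MemLp F p volume)
    (hs : ∑' k, hρ.boxNorm p k F ≠ ⊤) :
    ∀ᵐ x, ‖F x‖ₑ ≤ hρ.bernsteinConst p * ∑' k, hρ.boxNorm p k F := by
  have h1 : ∀ᵐ x, ∀ k, ‖kernelConv (hρ.boxKernel k) F x‖ₑ ≤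
      hρ.bernsteinConst p * hρ.boxNorm p k F := ae_all_iff.2 fun k => by
    have h2 : ∀ᵐ x, ‖kernelConv (hρ.boxKernel k) F x‖ₑ ≤ _ :=
      ae_le_eLpNormEssSup (μ := volume) (f := kernelConv (hρ.boxKernel k) F)
    have h3 := hρ.eLpNorm_top_kernelConv_le hp' k hF
    rw [eLpNorm_exponent_top] at h3
    filter_upwards [h2] with x hx using hx.trans h3
  filter_upwards [h1, hρ.hasSum_kernelConv hp' hF hs] with x hx1 hx2
  have h4 : ∑' k, ‖kernelConv (hρ.boxKernel k) F x‖ₑ ≤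
      hρ.bernsteinConst p * ∑' k, hρ.boxNorm p k F := by
    rw [← ENNReal.tsum_mul_left]
    exact ENNReal.tsum_le_tsum hx1
  rw [← hx2.tsum_eq]
  exact enorm_tsum_le_tsum_enorm.trans h4

end reconstruction

theorem hasSum_mul_of_hasSum {ι κ : Type*} {f : ι → ℂ} {g : κ → ℂ} {a b : ℂ}
    (hf : HasSum f a) (hg : HasSum g b) : HasSum (fun z : ι × κ => f z.1 * g z.2) (a * b) :=
  hf.mul hg (summable_mul_of_summable_norm hf.summable.norm hg.summable.norm)

theorem eLpNorm_mul_le_eLpNorm_mul_eLpNorm_top {p : ℝ≥0∞} {X : Type*} {mX : MeasurableSpace X}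
    {μ : Measure X} {F G : X → ℂ} (hF : AEStronglyMeasurable F μ) :
    eLpNorm (fun x => F x * G x) p μ ≤ eLpNorm F p μ * eLpNorm G ⊤ μ :=
  eLpNorm_le_eLpNorm_mul_eLpNorm_top p hF G (fun a b => a * b) 1
    (.of_forall fun x => by simp) |>.trans (by simp)

/-! ### Frequency localisation of products. -/

section product

open FourierTransform

variable {n : ℕ} {ρ : EuclideanSpace ℝ (Fin n) → ℝ} {p : ℝ≥0∞} [hp : Fact (1 ≤ p)]

theorem SchwartzMap.fourier_fourier_apply (f : 𝓢(EuclideanSpace ℝ (Fin n), ℂ))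
    (x : EuclideanSpace ℝ (Fin n)) : 𝓕 (𝓕 f) x = f (-x) := by
  have h := fourierInv_eq_fourier_neg (𝓕 f) (-x)
  rw [neg_neg] at h
  rw [← h, fourierInv_fourier_eq]

/-- By Parseval the integral is a double integral of the three transforms, the third one evaluated
at the sum of the other two frequencies. -/
theorem SchwartzMap.integral_mul_mul_eq_zero (A B C : 𝓢(EuclideanSpace ℝ (Fin n), ℂ))
    (h : ∀ t s, 𝓕 A t * 𝓕 B s * 𝓕⁻ C (t + s) = 0) : ∫ y, A y * B y * C y = 0 := by
  set a := 𝓕⁻ A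
  set b := 𝓕⁻ B
  set c := 𝓕⁻ C
  have h1 : ∀ y, A y * B y * C y = 𝓕 (convolution (.mul ℂ ℂ) a b) y * 𝓕 c y := fun y => by
    rw [fourier_convolution]
    simp [a, b, c]
  simp_rw [h1]
  rw [integral_fourier_mul_eq]
  refine integral_eq_zero_of_ae (.of_forall fun x => ?_)
  simp only [Pi.zero_apply]
  rw [fourier_fourier_apply, convolution_apply, MeasureTheory.convolution,
    ← integral_mul_const]
  refine integral_eq_zero_of_ae (.of_forall fun t => ?_)
  have h2 := h (-t) (-(x - t))
  rw [← fourierInv_eq_fourier_neg, ← fourierInv_eq_fourier_neg] at h2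
  have h3 : -t + -(x - t) = -x := by abel
  rw [h3] at h2
  simpa using h2

/-- Frequencies near j and l add up to one near j + l; three half-widths of 1 make the tolerance 3.
-/
theorem IsWindow.integral_boxKernel_eq_zero (hρ : IsWindow ρ) {m j l : Fin n → ℤ}
    (h : m - j - l ∉ latticeCube n 3) (x a z : EuclideanSpace ℝ (Fin n)) :
    ∫ y, hρ.boxKernel j (y - a) * (hρ.boxKernel l (y - z) * hρ.boxKernel m (x - y)) = 0 := by
  have hm : ∀ y, hρ.boxKernel m (x - y) = compSubConstCLM ℂ x (𝓕 (hρ.boxSymbol m)) y := fun y => by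
    rw [compSubConstCLM_apply, IsWindow.boxKernel, fourierInv_eq_fourier_neg, neg_sub]
  have h1 := SchwartzMap.integral_mul_mul_eq_zero (compSubConstCLM ℂ a (hρ.boxKernel j))
    (compSubConstCLM ℂ z (hρ.boxKernel l)) (compSubConstCLM ℂ x (𝓕 (hρ.boxSymbol m))) ?_
  · simpa [hm, mul_assoc] using h1
  · intro t s
    rw [fourierInv_eq_fourier_neg, fourier_compSubConstCLM, fourier_compSubConstCLM,
      fourier_compSubConstCLM, fourier_fourier_apply, hρ.fourier_boxKernel, hρ.fourier_boxKernel,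
      neg_neg]
    by_contra h0
    simp only [Circle.smul_def, smul_eq_mul, mul_eq_zero, not_or] at h0
    obtain ⟨⟨⟨-, hj⟩, ⟨-, hl⟩⟩, ⟨-, hm⟩⟩ := h0
    apply h
    rw [mem_latticeCube]
    intro i
    have h2 := abs_le.1 (hρ.abs_le_of_boxSymbol_ne_zero hj i)
    have h3 := abs_le.1 (hρ.abs_le_of_boxSymbol_ne_zero hl i)
    have h4 := abs_le.1 (hρ.abs_le_of_boxSymbol_ne_zero hm i)
    rw [PiLp.add_apply] at h4
    rw [abs_le]
    push_cast [Pi.sub_apply]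
    constructor <;> linarith

/-- Two applications of Fubini pull `F` and `G` out and leave the integral of three kernels, so no
regularity of `F` and `G` is needed. -/
theorem IsWindow.boxNorm_mul_eq_zero (hρ : IsWindow ρ) {m j l : Fin n → ℤ}
    (h : m - j - l ∉ latticeCube n 3) (hp' : p ≠ ⊤) {F G : EuclideanSpace ℝ (Fin n) → ℂ}
    (hF : MemLp F p volume) (hG : MemLp G p volume) :
    hρ.boxNorm p m (fun x => kernelConv (hρ.boxKernel j) F x * kernelConv (hρ.boxKernel l) G x)
      = 0 := by
  have h0 : kernelConv (hρ.boxKernel m)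
      (fun x => kernelConv (hρ.boxKernel j) F x * kernelConv (hρ.boxKernel l) G x) = 0 := by
    ext x
    have h1 := integral_mul_kernelConv (hρ.boxKernel l) hG
      (integrable_kernelConv_integrand (hρ.boxKernel m)
        (memLp_kernelConv hp.out hp' (hρ.boxKernel j) hF) x)
    have h2 : ∀ z, ∫ y, hρ.boxKernel l (y - z) *
        (hρ.boxKernel m (x - y) * kernelConv (hρ.boxKernel j) F y) = 0 := fun z => by
      have hi : Integrable (fun y => hρ.boxKernel l (y - z) * hρ.boxKernel m (x - y)) volume := by
        have h3 := ((compSubConstCLM ℂ z (hρ.boxKernel l)).memLp 2 volume).integrable_mul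
          ((hρ.boxKernel m).memLp_comp_sub_left 2 x)
        exact h3.congr (.of_forall fun y => by simp)
      have h4 := integral_mul_kernelConv (hρ.boxKernel j) hF hi
      simp_rw [hρ.integral_boxKernel_eq_zero h] at h4
      simpa [mul_assoc] using h4
    simp_rw [h2] at h1
    simpa [kernelConv, mul_assoc] using h1
  rw [IsWindow.boxNorm, h0, eLpNorm_zero]

/-- The constant of the product estimate for the boxes. -/
noncomputable def IsWindow.prodConst (hρ : IsWindow ρ) (p : ℝ≥0∞) : ℝ≥0∞ :=
  eLpNorm (hρ.boxKernel 0) 1 volume * hρ.bernsteinConst p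

theorem IsWindow.prodConst_ne_top (hρ : IsWindow ρ) (p : ℝ≥0∞) : hρ.prodConst p ≠ ⊤ :=
  ENNReal.mul_ne_top ((hρ.boxKernel 0).memLp 1 volume).2.ne (hρ.bernsteinConst_ne_top p)

/-- The boxes of a product. -/
theorem IsWindow.boxNorm_mul_le (hρ : IsWindow ρ) (hp' : p ≠ ⊤)
    {F G : EuclideanSpace ℝ (Fin n) → ℂ} (hF : MemLp F p volume) (hG : MemLp G p volume)
    (hsF : ∑' k, hρ.boxNorm p k F ≠ ⊤) (hsG : ∑' k, hρ.boxNorm p k G ≠ ⊤) :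
    MemLp (fun x => F x * G x) p volume ∧ ∀ m, hρ.boxNorm p m (fun x => F x * G x) ≤
      hρ.prodConst p * ∑ e ∈ latticeCube n 3, ∑' j, hρ.boxNorm p j F * hρ.boxNorm p (m - e - j) G := by
  classical
  set P : (Fin n → ℤ) × (Fin n → ℤ) → EuclideanSpace ℝ (Fin n) → ℂ := fun z x =>
    kernelConv (hρ.boxKernel z.1) F x * kernelConv (hρ.boxKernel z.2) G x
  -- The first box is measured in L^p, the second in L^∞ through Bernstein's inequality.
  have hPle : ∀ z, eLpNorm (P z) p volume ≤
      hρ.bernsteinConst p * (hρ.boxNorm p z.1 F * hρ.boxNorm p z.2 G) := fun z =>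
    calc eLpNorm (P z) p volume
        ≤ eLpNorm (kernelConv (hρ.boxKernel z.1) F) p volume *
            eLpNorm (kernelConv (hρ.boxKernel z.2) G) ⊤ volume :=
          eLpNorm_mul_le_eLpNorm_mul_eLpNorm_top (aestronglyMeasurable_kernelConv _ hF.1)
      _ ≤ hρ.boxNorm p z.1 F * (hρ.bernsteinConst p * hρ.boxNorm p z.2 G) := by
          gcongr
          · exact le_rfl
          · exact hρ.eLpNorm_top_kernelConv_le hp' _ hG
      _ = _ := by ring
  have hsum : ∑' z : (Fin n → ℤ) × (Fin n → ℤ), hρ.bernsteinConst p *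
      (hρ.boxNorm p z.1 F * hρ.boxNorm p z.2 G) ≠ ⊤ := by
    rw [ENNReal.tsum_mul_left, ENNReal.tsum_prod']
    simp_rw [ENNReal.tsum_mul_left, ENNReal.tsum_mul_right]
    exact ENNReal.mul_ne_top (hρ.bernsteinConst_ne_top p) (ENNReal.mul_ne_top hsF hsG)
  have hP : ∀ z, MemLp (P z) p volume := fun z =>
    ⟨(aestronglyMeasurable_kernelConv _ hF.1).mul (aestronglyMeasurable_kernelConv _ hG.1),
      (hPle z).trans_lt (lt_top_iff_ne_top.2 (ENNReal.ne_top_of_tsum_ne_top hsum z))⟩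
  have hs : ∑' z, eLpNorm (P z) p volume ≠ ⊤ :=
    ne_top_of_le_ne_top hsum (ENNReal.tsum_le_tsum hPle)
  have hFG : ∀ᵐ x, HasSum (fun z => P z x) (F x * G x) := by
    filter_upwards [hρ.hasSum_kernelConv hp' hF hsF, hρ.hasSum_kernelConv hp' hG hsG] with x h1 h2
    have h3 := hasSum_mul_of_hasSum h1 h2
    exact h3
  obtain ⟨h1, -, h3⟩ := hρ.boxNorm_tsum_le hp' hP hs hFG
  refine ⟨h1, fun m => (h3 m).trans ?_⟩
  -- The indicators encode the constraint that m - z₁ - z₂ lies in the cube, so the double sum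
  -- collapses to finitely many shifted convolutions.
  have h4 : ∀ z : (Fin n → ℤ) × (Fin n → ℤ), hρ.boxNorm p m (P z) ≤ hρ.prodConst p *
      ∑ e ∈ latticeCube n 3,
        if z.2 = m - e - z.1 then hρ.boxNorm p z.1 F * hρ.boxNorm p z.2 G else 0 := by
    intro z
    by_cases hz : m - z.1 - z.2 ∈ latticeCube n 3
    · calc hρ.boxNorm p m (P z) ≤ eLpNorm (hρ.boxKernel 0) 1 volume * eLpNorm (P z) p volume :=
            hρ.boxNorm_le hp' m (hP z)
        _ ≤ eLpNorm (hρ.boxKernel 0) 1 volume *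
            (hρ.bernsteinConst p * (hρ.boxNorm p z.1 F * hρ.boxNorm p z.2 G)) := by
            gcongr; exact hPle z
        _ = hρ.prodConst p * (hρ.boxNorm p z.1 F * hρ.boxNorm p z.2 G) := by
            rw [IsWindow.prodConst, mul_assoc]
        _ ≤ _ := by
            gcongr
            refine le_trans (le_of_eq ?_) (Finset.single_le_sum (fun _ _ => zero_le) hz)
            rw [if_pos (by abel)]
    · exact (hρ.boxNorm_mul_eq_zero hz hp' hF hG).trans_le zero_le
  refine (ENNReal.tsum_le_tsum h4).trans (le_of_eq ?_)
  rw [ENNReal.tsum_mul_left, Summable.tsum_finsetSum fun _ _ => ENNReal.summable]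
  congr 1
  refine Finset.sum_congr rfl fun e _ => ?_
  rw [ENNReal.tsum_prod']
  refine tsum_congr fun j => ?_
  rw [tsum_eq_single (m - e - j) fun l hl => if_neg hl, if_pos rfl]

end product

/-! ### The algebra estimates for the two norms. -/

section algebra

variable {n : ℕ} {ρ : EuclideanSpace ℝ (Fin n) → ℝ} {p q : ℝ≥0∞} [hp : Fact (1 ≤ p)] {θ : ℝ}

/-- The Gevrey-modulation norm of a function, with weight `e^(|k|^θ)`. -/
noncomputable def IsWindow.gevreyNorm (hρ : IsWindow ρ) (θ : ℝ) (p q : ℝ≥0∞)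
    (F : EuclideanSpace ℝ (Fin n) → ℂ) : ℝ≥0∞ :=
  lqNorm q fun k => subexpWeight θ 1 k * hρ.boxNorm p k F

/-- The `ℓ¹` modulation norm of a function, with weight `e^(θ |k|^θ)`. -/
noncomputable def IsWindow.wienerNorm (hρ : IsWindow ρ) (θ : ℝ) (p : ℝ≥0∞)
    (F : EuclideanSpace ℝ (Fin n) → ℂ) : ℝ≥0∞ :=
  ∑' k, subexpWeight θ θ k * hρ.boxNorm p k F

/-- The functions in `L^p` with finite `ℓ¹` modulation norm. -/
structure IsWindow.MemWiener (hρ : IsWindow ρ) (θ : ℝ) (p : ℝ≥0∞)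
    (F : EuclideanSpace ℝ (Fin n) → ℂ) : Prop where
  memLp : MemLp F p volume
  ne_top : hρ.wienerNorm θ p F ≠ ⊤

theorem IsWindow.tsum_boxNorm_le_wienerNorm (hρ : IsWindow ρ) (hθ : 0 < θ)
    (F : EuclideanSpace ℝ (Fin n) → ℂ) : ∑' k, hρ.boxNorm p k F ≤ hρ.wienerNorm θ p F :=
  ENNReal.tsum_le_tsum fun k => le_mul_of_one_le_left zero_le (one_le_subexpWeight hθ.le k)

theorem IsWindow.MemWiener.tsum_boxNorm_ne_top {hρ : IsWindow ρ} (hθ : 0 < θ)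
    {F : EuclideanSpace ℝ (Fin n) → ℂ} (h : hρ.MemWiener θ p F) :
    ∑' k, hρ.boxNorm p k F ≠ ⊤ :=
  ne_top_of_le_ne_top h.ne_top (hρ.tsum_boxNorm_le_wienerNorm hθ F)

theorem IsWindow.MemWiener.eLpNorm_le {hρ : IsWindow ρ} (hθ : 0 < θ) (hp' : p ≠ ⊤)
    {F : EuclideanSpace ℝ (Fin n) → ℂ} (h : hρ.MemWiener θ p F) :
    eLpNorm F p volume ≤ hρ.wienerNorm θ p F :=
  (hρ.eLpNorm_le_tsum_boxNorm hp' h.memLp (h.tsum_boxNorm_ne_top hθ)).trans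
    (hρ.tsum_boxNorm_le_wienerNorm hθ F)

theorem IsWindow.MemWiener.ae_enorm_le {hρ : IsWindow ρ} (hθ : 0 < θ) (hp' : p ≠ ⊤)
    {F : EuclideanSpace ℝ (Fin n) → ℂ} (h : hρ.MemWiener θ p F) :
    ∀ᵐ x, ‖F x‖ₑ ≤ hρ.bernsteinConst p * hρ.wienerNorm θ p F := by
  filter_upwards [hρ.ae_enorm_le_tsum_boxNorm hp' h.memLp (h.tsum_boxNorm_ne_top hθ)] with x hx
  refine hx.trans ?_
  gcongr
  exact hρ.tsum_boxNorm_le_wienerNorm hθ F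

theorem IsWindow.subexpWeight_mul_boxNorm_le (hρ : IsWindow ρ) (hq : 1 ≤ q)
    (F : EuclideanSpace ℝ (Fin n) → ℂ) (k : Fin n → ℤ) :
    subexpWeight θ θ k * hρ.boxNorm p k F ≤ subexpWeight θ (θ - 1) k * hρ.gevreyNorm θ p q F := by
  have h := le_lqNorm hq (fun k => subexpWeight θ 1 k * hρ.boxNorm p k F) k
  calc subexpWeight θ θ k * hρ.boxNorm p k F
      = subexpWeight θ (θ - 1) k * (subexpWeight θ 1 k * hρ.boxNorm p k F) := by
        rw [← mul_assoc, subexpWeight_mul, sub_add_cancel]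
    _ ≤ _ := by gcongr; exact h

/-- Lowering the exponent from 1 to θ leaves the weight e^{(θ-1)|k|^θ}, which is summable when 0 < θ
< 1; hence ℓ^q control passes to ℓ¹ for every q. -/
theorem IsWindow.wienerNorm_le_gevreyNorm (hρ : IsWindow ρ) (hq : 1 ≤ q)
    (F : EuclideanSpace ℝ (Fin n) → ℂ) :
    hρ.wienerNorm θ p F ≤ (∑' k : Fin n → ℤ, subexpWeight θ (θ - 1) k) * hρ.gevreyNorm θ p q F := by
  rw [← ENNReal.tsum_mul_right]
  exact ENNReal.tsum_le_tsum fun k => hρ.subexpWeight_mul_boxNorm_le hq F k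

/-- The constant in the algebra estimates. -/
noncomputable def IsWindow.algebraConst (hρ : IsWindow ρ) (θ : ℝ) (p : ℝ≥0∞) : ℝ≥0∞ :=
  hρ.prodConst p * ∑ e ∈ latticeCube n 3, subexpWeight θ 1 e

theorem IsWindow.algebraConst_ne_top (hρ : IsWindow ρ) (θ : ℝ) (p : ℝ≥0∞) :
    hρ.algebraConst θ p ≠ ⊤ :=
  ENNReal.mul_ne_top (hρ.prodConst_ne_top p)
    (ENNReal.sum_ne_top.2 fun e _ => subexpWeight_ne_top θ 1 e)

/-- The weight is submultiplicative and ℓ¹ is a convolution algebra. The shift by `e` is charged to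
the larger weight with exponent 1, so that both product estimates share one constant. -/
theorem IsWindow.wienerNorm_mul_le (hρ : IsWindow ρ) (hp' : p ≠ ⊤) (h0 : 0 < θ) (h1 : θ ≤ 1)
    {F G : EuclideanSpace ℝ (Fin n) → ℂ} (hF : hρ.MemWiener θ p F) (hG : hρ.MemWiener θ p G) :
    hρ.wienerNorm θ p (fun x => F x * G x) ≤
      hρ.algebraConst θ p * (hρ.wienerNorm θ p F * hρ.wienerNorm θ p G) := by
  have hb := (hρ.boxNorm_mul_le hp' hF.memLp hG.memLp (hF.tsum_boxNorm_ne_top h0)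
    (hG.tsum_boxNorm_ne_top h0)).2
  set a := fun k => subexpWeight θ θ k * hρ.boxNorm p k F
  set b := fun k => subexpWeight θ θ k * hρ.boxNorm p k G
  have h2 : ∀ m, subexpWeight θ θ m * hρ.boxNorm p m (fun x => F x * G x) ≤
      hρ.prodConst p * ∑ e ∈ latticeCube n 3, subexpWeight θ 1 e * ∑' j, a j * b (m - e - j) := by
    intro m
    calc _ ≤ subexpWeight θ θ m * (hρ.prodConst p * ∑ e ∈ latticeCube n 3,
          ∑' j, hρ.boxNorm p j F * hρ.boxNorm p (m - e - j) G) := by gcongr; exact hb m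
      _ = hρ.prodConst p * ∑ e ∈ latticeCube n 3,
          ∑' j, subexpWeight θ θ m * (hρ.boxNorm p j F * hρ.boxNorm p (m - e - j) G) := by
          simp_rw [ENNReal.tsum_mul_left, ← Finset.mul_sum]; ring
      _ ≤ _ := by
          gcongr with e
          rw [← ENNReal.tsum_mul_left]
          refine ENNReal.tsum_le_tsum fun j => ?_
          have h3 := subexpWeight_add_le h0 h1 h0.le e (m - e)
          have h4 := subexpWeight_add_le h0 h1 h0.le j (m - e - j)
          rw [add_sub_cancel] at h3 h4
          calc _ ≤ (subexpWeight θ 1 e * (subexpWeight θ θ j * subexpWeight θ θ (m - e - j))) *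
                (hρ.boxNorm p j F * hρ.boxNorm p (m - e - j) G) := by
                gcongr
                refine h3.trans ?_
                gcongr
                exact subexpWeight_mono h1 e
            _ = _ := by simp only [a, b]; ring
  refine (ENNReal.tsum_le_tsum h2).trans (le_of_eq ?_)
  rw [ENNReal.tsum_mul_left, Summable.tsum_finsetSum fun _ _ => ENNReal.summable,
    IsWindow.algebraConst, mul_assoc, Finset.sum_mul]
  congr 1
  refine Finset.sum_congr rfl fun e _ => ?_
  rw [ENNReal.tsum_mul_left, ENNReal.tsum_comm]
  congr 1
  simp_rw [ENNReal.tsum_mul_left]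
  have h5 : ∀ j, ∑' m, b (m - e - j) = ∑' m, b m := fun j => by
    rw [← (Equiv.subRight (e + j)).tsum_eq b]
    simp [sub_sub]
  simp_rw [h5, ENNReal.tsum_mul_right]
  rfl

/-- Young's inequality: Minkowski for a superposition of translates of `b`. -/
theorem lqNorm_conv_le {ι : Type*} [Countable ι] [AddCommGroup ι] (hq : 1 ≤ q) (a b : ι → ℝ≥0∞) :
    lqNorm q (fun m => ∑' j, a j * b (m - j)) ≤ (∑' j, a j) * lqNorm q b := by
  refine (lqNorm_tsum_le hq fun j m => a j * b (m - j)).trans (le_of_eq ?_)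
  rw [← ENNReal.tsum_mul_right]
  refine tsum_congr fun j => ?_
  rw [lqNorm_const_mul hq]
  exact congrArg _ (lqNorm_comp_equiv (Equiv.subRight j) b)

theorem lqNorm_sum_le {ι κ : Type*} [Countable ι] (hq : 1 ≤ q) (s : Finset κ)
    (f : κ → ι → ℝ≥0∞) : lqNorm q (fun k => ∑ i ∈ s, f i k) ≤ ∑ i ∈ s, lqNorm q (f i) := by
  have h := lqNorm_tsum_le hq fun (i : s) k => f i k
  simp_rw [tsum_fintype] at h
  rw [← Finset.sum_coe_sort s fun i => lqNorm q (f i)]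
  simp_rw [← fun k => Finset.sum_coe_sort s fun i => f i k]
  exact h

/-- The tame estimate. By `subexpWeight_one_add_le` the weighted convolution splits into two, each
with a factor in the weaker weight θ, to which ℓ¹ ∗ ℓ^q ⊆ ℓ^q applies. -/
theorem IsWindow.gevreyNorm_mul_le (hρ : IsWindow ρ) (hp' : p ≠ ⊤) (hq : 1 ≤ q) (h0 : 0 < θ)
    (h1 : θ ≤ 1) {F G : EuclideanSpace ℝ (Fin n) → ℂ} (hF : hρ.MemWiener θ p F)
    (hG : hρ.MemWiener θ p G) :
    hρ.gevreyNorm θ p q (fun x => F x * G x) ≤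
      hρ.algebraConst θ p * (hρ.gevreyNorm θ p q F * hρ.wienerNorm θ p G +
        hρ.wienerNorm θ p F * hρ.gevreyNorm θ p q G) := by
  have hb := (hρ.boxNorm_mul_le hp' hF.memLp hG.memLp (hF.tsum_boxNorm_ne_top h0)
    (hG.tsum_boxNorm_ne_top h0)).2
  set a := fun k => subexpWeight θ θ k * hρ.boxNorm p k F with ha
  set b := fun k => subexpWeight θ θ k * hρ.boxNorm p k G with hb'
  set a' := fun k => subexpWeight θ 1 k * hρ.boxNorm p k F with ha'
  set b' := fun k => subexpWeight θ 1 k * hρ.boxNorm p k G with hb''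
  set c := fun m => ∑' j, b j * a' (m - j) + ∑' j, a j * b' (m - j) with hc
  have hcN : lqNorm q c ≤ hρ.gevreyNorm θ p q F * hρ.wienerNorm θ p G +
      hρ.wienerNorm θ p F * hρ.gevreyNorm θ p q G := by
    refine (lqNorm_add_le hq _ _).trans ?_
    rw [mul_comm (hρ.gevreyNorm θ p q F)]
    exact add_le_add (lqNorm_conv_le hq b a') (lqNorm_conv_le hq a b')
  have h2 : ∀ m, subexpWeight θ 1 m * hρ.boxNorm p m (fun x => F x * G x) ≤
      hρ.prodConst p * ∑ e ∈ latticeCube n 3, subexpWeight θ 1 e * c (m - e) := by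
    intro m
    calc _ ≤ subexpWeight θ 1 m * (hρ.prodConst p * ∑ e ∈ latticeCube n 3,
          ∑' j, hρ.boxNorm p j F * hρ.boxNorm p (m - e - j) G) := by gcongr; exact hb m
      _ = hρ.prodConst p * ∑ e ∈ latticeCube n 3,
          ∑' j, subexpWeight θ 1 m * (hρ.boxNorm p j F * hρ.boxNorm p (m - e - j) G) := by
          simp_rw [ENNReal.tsum_mul_left, ← Finset.mul_sum]; ring
      _ ≤ _ := by
          gcongr with e
          have h5 : ∑' j, b j * a' (m - e - j) = ∑' j, a' j * b (m - e - j) := by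
            rw [← (Equiv.subLeft (m - e)).tsum_eq fun j => b j * a' (m - e - j)]
            simp [mul_comm]
          rw [hc]
          simp only
          rw [h5, ← ENNReal.tsum_add, ← ENNReal.tsum_mul_left]
          refine ENNReal.tsum_le_tsum fun j => ?_
          have h3 := subexpWeight_add_le h0 h1 zero_le_one e (m - e)
          have h4 := subexpWeight_one_add_le h0 h1 j (m - e - j)
          rw [add_sub_cancel] at h3 h4
          calc _ ≤ (subexpWeight θ 1 e * (subexpWeight θ 1 j * subexpWeight θ θ (m - e - j) +
                  subexpWeight θ θ j * subexpWeight θ 1 (m - e - j))) *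
                (hρ.boxNorm p j F * hρ.boxNorm p (m - e - j) G) := by
                gcongr
                refine h3.trans ?_
                gcongr
            _ = _ := by simp only [ha, hb', ha', hb'']; ring
  refine (lqNorm_mono h2).trans ?_
  rw [lqNorm_const_mul hq, IsWindow.algebraConst, mul_assoc]
  gcongr
  refine (lqNorm_sum_le hq _ _).trans ?_
  rw [Finset.sum_mul]
  gcongr with e
  rw [lqNorm_const_mul hq]
  gcongr
  exact (lqNorm_comp_equiv (Equiv.subRight e) c).trans_le hcN

theorem IsWindow.MemWiener.mul {hρ : IsWindow ρ} (hp' : p ≠ ⊤) (h0 : 0 < θ)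
    (h1 : θ ≤ 1) {F G : EuclideanSpace ℝ (Fin n) → ℂ} (hF : hρ.MemWiener θ p F)
    (hG : hρ.MemWiener θ p G) : hρ.MemWiener θ p (fun x => F x * G x) where
  memLp := (hρ.boxNorm_mul_le hp' hF.memLp hG.memLp (hF.tsum_boxNorm_ne_top h0)
    (hG.tsum_boxNorm_ne_top h0)).1
  ne_top := ne_top_of_le_ne_top (ENNReal.mul_ne_top (hρ.algebraConst_ne_top θ p)
    (ENNReal.mul_ne_top hF.ne_top hG.ne_top)) (hρ.wienerNorm_mul_le hp' h0 h1 hF hG)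

theorem IsWindow.memWiener_tsum {ι : Type*} [Countable ι] (hρ : IsWindow ρ) (hp' : p ≠ ⊤)
    (hq : 1 ≤ q) (h0 : 0 < θ)
    {Fi : ι → EuclideanSpace ℝ (Fin n) → ℂ} {F : EuclideanSpace ℝ (Fin n) → ℂ}
    (hFi : ∀ i, hρ.MemWiener θ p (Fi i)) (hs : ∑' i, hρ.wienerNorm θ p (Fi i) ≠ ⊤)
    (hF : ∀ᵐ x, HasSum (fun i => Fi i x) (F x)) :
    hρ.MemWiener θ p F ∧ hρ.wienerNorm θ p F ≤ ∑' i, hρ.wienerNorm θ p (Fi i) ∧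
      hρ.gevreyNorm θ p q F ≤ ∑' i, hρ.gevreyNorm θ p q (Fi i) := by
  obtain ⟨h2, -, h3⟩ := hρ.boxNorm_tsum_le hp' (fun i => (hFi i).memLp)
    (ne_top_of_le_ne_top hs (ENNReal.tsum_le_tsum fun i => (hFi i).eLpNorm_le h0 hp')) hF
  have h4 : hρ.wienerNorm θ p F ≤ ∑' i, hρ.wienerNorm θ p (Fi i) := by
    unfold IsWindow.wienerNorm
    rw [ENNReal.tsum_comm]
    refine ENNReal.tsum_le_tsum fun k => ?_
    rw [ENNReal.tsum_mul_left]
    gcongr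
    exact h3 k
  refine ⟨⟨h2, ne_top_of_le_ne_top hs h4⟩, h4, ?_⟩
  refine le_trans (lqNorm_mono fun k => ?_) (lqNorm_tsum_le hq _)
  rw [ENNReal.tsum_mul_left]
  gcongr
  exact h3 k

theorem IsWindow.MemWiener.add {hρ : IsWindow ρ} (hp' : p ≠ ⊤) (hq : 1 ≤ q) (h0 : 0 < θ)
    {F G : EuclideanSpace ℝ (Fin n) → ℂ} (hF : hρ.MemWiener θ p F) (hG : hρ.MemWiener θ p G) :
    hρ.MemWiener θ p (fun x => F x + G x) ∧
      hρ.gevreyNorm θ p q (fun x => F x + G x) ≤ hρ.gevreyNorm θ p q F + hρ.gevreyNorm θ p q G := by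
  have h := hρ.memWiener_tsum hp' hq h0 (Fi := fun i : Bool => bif i then F else G)
    (F := fun x => F x + G x) (by rintro (_ | _) <;> simpa) (by
      simpa [tsum_fintype] using ⟨hF.ne_top, hG.ne_top⟩)
    (.of_forall fun x => by simpa using hasSum_fintype fun i : Bool => (bif i then F else G) x)
  refine ⟨h.1, ?_⟩
  simpa [tsum_fintype] using h.2.2

theorem IsWindow.boxNorm_const_mul (hρ : IsWindow ρ) (c : ℂ) (k : Fin n → ℤ)
    (F : EuclideanSpace ℝ (Fin n) → ℂ) :
    hρ.boxNorm p k (fun x => c * F x) = ‖c‖ₑ * hρ.boxNorm p k F := by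
  have := kernelConv_const_smul (hρ.boxKernel k) c F
  unfold IsWindow.boxNorm
  rw [← eLpNorm_const_smul, ← this]
  rfl

theorem IsWindow.wienerNorm_const_mul (hρ : IsWindow ρ) (c : ℂ)
    (F : EuclideanSpace ℝ (Fin n) → ℂ) :
    hρ.wienerNorm θ p (fun x => c * F x) = ‖c‖ₑ * hρ.wienerNorm θ p F := by
  unfold IsWindow.wienerNorm
  rw [← ENNReal.tsum_mul_left]
  refine tsum_congr fun k => ?_
  rw [hρ.boxNorm_const_mul, mul_left_comm]

theorem IsWindow.gevreyNorm_const_mul (hρ : IsWindow ρ) (hq : 1 ≤ q) (c : ℂ)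
    (F : EuclideanSpace ℝ (Fin n) → ℂ) :
    hρ.gevreyNorm θ p q (fun x => c * F x) = ‖c‖ₑ * hρ.gevreyNorm θ p q F := by
  unfold IsWindow.gevreyNorm
  rw [← lqNorm_const_mul hq]
  congr 1
  ext k
  rw [hρ.boxNorm_const_mul, mul_left_comm]

theorem IsWindow.MemWiener.const_mul {hρ : IsWindow ρ} (c : ℂ)
    {F : EuclideanSpace ℝ (Fin n) → ℂ} (hF : hρ.MemWiener θ p F) :
    hρ.MemWiener θ p (fun x => c * F x) where
  memLp := hF.memLp.const_mul c
  ne_top := by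
    rw [hρ.wienerNorm_const_mul]
    exact ENNReal.mul_ne_top enorm_ne_top hF.ne_top

theorem IsWindow.boxNorm_congr_ae (hρ : IsWindow ρ) (k : Fin n → ℤ)
    {F G : EuclideanSpace ℝ (Fin n) → ℂ} (h : F =ᵐ[volume] G) :
    hρ.boxNorm p k F = hρ.boxNorm p k G := by
  rw [IsWindow.boxNorm, IsWindow.boxNorm, kernelConv_congr_ae _ h]

theorem IsWindow.gevreyNorm_congr_ae (hρ : IsWindow ρ)
    {F G : EuclideanSpace ℝ (Fin n) → ℂ} (h : F =ᵐ[volume] G) :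
    hρ.gevreyNorm θ p q F = hρ.gevreyNorm θ p q G := by
  simp only [IsWindow.gevreyNorm, hρ.boxNorm_congr_ae _ h]

/-- As in a Leibniz rule, the Gevrey norm falls on one of the m + 1 factors at a time; all others
are measured in the weaker norm. -/
theorem IsWindow.MemWiener.pow {hρ : IsWindow ρ} (hp' : p ≠ ⊤) (hq : 1 ≤ q) (h0 : 0 < θ)
    (h1 : θ ≤ 1) {F : EuclideanSpace ℝ (Fin n) → ℂ} (hF : hρ.MemWiener θ p F) (m : ℕ) :
    hρ.MemWiener θ p (fun x => F x ^ (m + 1)) ∧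
      hρ.wienerNorm θ p (fun x => F x ^ (m + 1)) ≤
        (hρ.algebraConst θ p * hρ.wienerNorm θ p F) ^ m * hρ.wienerNorm θ p F ∧
      hρ.gevreyNorm θ p q (fun x => F x ^ (m + 1)) ≤
        (m + 1) * ((hρ.algebraConst θ p * hρ.wienerNorm θ p F) ^ m * hρ.gevreyNorm θ p q F) := by
  induction m with
  | zero => simpa using hF
  | succ m ih =>
    obtain ⟨i1, i2, i3⟩ := ih
    have e : (fun x => F x ^ (m + 1 + 1)) = fun x => F x ^ (m + 1) * F x := by
      ext x; rw [pow_succ]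
    rw [e]
    refine ⟨i1.mul hp' h0 h1 hF, (hρ.wienerNorm_mul_le hp' h0 h1 i1 hF).trans ?_,
      (hρ.gevreyNorm_mul_le hp' hq h0 h1 i1 hF).trans ?_⟩
    · calc _ ≤ hρ.algebraConst θ p * ((hρ.algebraConst θ p * hρ.wienerNorm θ p F) ^ m *
            hρ.wienerNorm θ p F * hρ.wienerNorm θ p F) := by gcongr
        _ = _ := by ring
    · calc _ ≤ hρ.algebraConst θ p * ((m + 1) * ((hρ.algebraConst θ p * hρ.wienerNorm θ p F) ^ m *
            hρ.gevreyNorm θ p q F) * hρ.wienerNorm θ p F +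
            (hρ.algebraConst θ p * hρ.wienerNorm θ p F) ^ m * hρ.wienerNorm θ p F *
              hρ.gevreyNorm θ p q F) := by gcongr
        _ = _ := by push_cast; ring

end algebra

/-! ### Taylor remainders of the exponential. -/

/-- The remainder of the exponential series after the term of order `L`. -/
noncomputable def expRemainder (L : ℕ) (z : ℂ) : ℂ :=
  Complex.exp z - ∑ m ∈ Finset.range (L + 1), z ^ m / (m.factorial : ℂ)

theorem hasSum_expRemainder (L : ℕ) (z : ℂ) :
    HasSum (fun m : ℕ => z ^ (m + L + 1) / ((m + L + 1).factorial : ℂ)) (expRemainder L z) := by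
  have h := NormedSpace.expSeries_div_hasSum_exp z
  rw [← Complex.exp_eq_exp_ℂ] at h
  exact (hasSum_nat_add_iff' (L + 1)).2 h

/-- Multiplying the terms by e^{-L} e^{m+L} ≥ 1 turns the tail into part of e^{-L} exp(e x). The
tail is thus at most 1 as soon as L ≥ e x. -/
theorem tsum_pow_div_factorial_le (L : ℕ) {x : ℝ} (hx : 0 ≤ x) :
    ∑' m : ℕ, ENNReal.ofReal (x ^ (m + L) / (m + L).factorial) ≤
      ENNReal.ofReal (Real.exp (Real.exp 1 * x - L)) := by
  have h := NormedSpace.expSeries_div_hasSum_exp (Real.exp 1 * x)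
  rw [← Real.exp_eq_exp_ℝ] at h
  have h2 := h.mul_left (Real.exp (-L))
  have h3 : ∑' m : ℕ, ENNReal.ofReal (Real.exp (-L) * ((Real.exp 1 * x) ^ m / m.factorial)) =
      ENNReal.ofReal (Real.exp (-L) * Real.exp (Real.exp 1 * x)) := by
    rw [← h2.tsum_eq, ENNReal.ofReal_tsum_of_nonneg (fun m => by positivity) h2.summable]
  have e : Real.exp (Real.exp 1 * x - L) = Real.exp (-L) * Real.exp (Real.exp 1 * x) := by
    rw [← Real.exp_add]; ring_nf
  rw [e, ← h3]
  refine le_trans (ENNReal.tsum_le_tsum fun m => ?_)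
    (ENNReal.tsum_comp_le_tsum_of_injective (add_left_injective L) _)
  refine ENNReal.ofReal_le_ofReal ?_
  have h4 : (1 : ℝ) ≤ Real.exp (-L) * Real.exp 1 ^ (m + L) := by
    rw [← Real.exp_nat_mul, ← Real.exp_add]
    refine Real.one_le_exp ?_
    push_cast
    have : (0 : ℝ) ≤ m := m.cast_nonneg
    linarith
  calc x ^ (m + L) / ((m + L).factorial : ℝ) = 1 * (x ^ (m + L) / ((m + L).factorial : ℝ)) := by ring
    _ ≤ (Real.exp (-L) * Real.exp 1 ^ (m + L)) * (x ^ (m + L) / ((m + L).factorial : ℝ)) := by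
      gcongr
    _ = _ := by rw [mul_pow]; ring

section exponential

variable {n : ℕ} {ρ : EuclideanSpace ℝ (Fin n) → ℝ} {p q : ℝ≥0∞} [hp : Fact (1 ≤ p)] {θ : ℝ}

/-- The factor m + L + 1 from the Gevrey norm of a power is cancelled by (m + L + 1)!, so both norms
obey the same tail bound. The real number `x` only has to dominate |c| times the algebra constant
and the weak norm. -/
theorem IsWindow.MemWiener.expRemainder {hρ : IsWindow ρ} (hp' : p ≠ ⊤) (hq : 1 ≤ q) (h0 : 0 < θ)
    (h1 : θ ≤ 1) {F : EuclideanSpace ℝ (Fin n) → ℂ} (hF : hρ.MemWiener θ p F)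
    (c : ℂ) (L : ℕ) {x : ℝ} (hx : 0 ≤ x)
    (hFx : ‖c‖ₑ * (hρ.algebraConst θ p * hρ.wienerNorm θ p F) ≤ ENNReal.ofReal x) :
    hρ.MemWiener θ p (fun y => expRemainder L (c * F y)) ∧
      hρ.wienerNorm θ p (fun y => _root_.expRemainder L (c * F y)) ≤
        ENNReal.ofReal (Real.exp (Real.exp 1 * x - L)) * (‖c‖ₑ * hρ.wienerNorm θ p F) ∧
      hρ.gevreyNorm θ p q (fun y => _root_.expRemainder L (c * F y)) ≤
        ENNReal.ofReal (Real.exp (Real.exp 1 * x - L)) * (‖c‖ₑ * hρ.gevreyNorm θ p q F) := by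
  set T : ℕ → EuclideanSpace ℝ (Fin n) → ℂ := fun m y =>
    (c ^ (m + L + 1) / ((m + L + 1).factorial : ℂ)) * F y ^ (m + L + 1)
  have hT : ∀ m, hρ.MemWiener θ p (T m) := fun m =>
    (hF.pow hp' hq h0 h1 (m + L)).1.const_mul _
  set X := ‖c‖ₑ * (hρ.algebraConst θ p * hρ.wienerNorm θ p F)
  have hc : ∀ m, ‖c ^ (m + L + 1) / ((m + L + 1).factorial : ℂ)‖ₑ =
      ‖c‖ₑ ^ (m + L) * ‖c‖ₑ * ENNReal.ofReal (1 / ((m + L + 1).factorial : ℝ)) := fun m => by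
    rw [div_eq_mul_one_div, enorm_mul, enorm_pow, pow_succ]
    congr 1
    rw [← ofReal_norm]
    simp
  have hX : ∀ m, X ^ (m + L) * ENNReal.ofReal (1 / ((m + L).factorial : ℝ)) ≤
      ENNReal.ofReal (x ^ (m + L) / ((m + L).factorial : ℝ)) := fun m => by
    calc _ ≤ ENNReal.ofReal x ^ (m + L) * ENNReal.ofReal (1 / ((m + L).factorial : ℝ)) := by gcongr
      _ = _ := by
        rw [← ENNReal.ofReal_pow hx, ← ENNReal.ofReal_mul (by positivity), mul_one_div]
  have hV : ∀ m, hρ.wienerNorm θ p (T m) ≤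
      ENNReal.ofReal (x ^ (m + L) / ((m + L).factorial : ℝ)) * (‖c‖ₑ * hρ.wienerNorm θ p F) := by
    intro m
    have h2 := (hF.pow hp' hq h0 h1 (m + L)).2.1
    rw [hρ.wienerNorm_const_mul, hc]
    calc _ ≤ ‖c‖ₑ ^ (m + L) * ‖c‖ₑ * ENNReal.ofReal (1 / ((m + L).factorial : ℝ)) *
          ((hρ.algebraConst θ p * hρ.wienerNorm θ p F) ^ (m + L) * hρ.wienerNorm θ p F) := by
          refine mul_le_mul' (mul_le_mul' le_rfl (ENNReal.ofReal_le_ofReal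
            (one_div_le_one_div_of_le (by positivity) ?_))) h2
          exact_mod_cast Nat.factorial_le (Nat.le_succ _)
      _ = (X ^ (m + L) * ENNReal.ofReal (1 / ((m + L).factorial : ℝ))) *
          (‖c‖ₑ * hρ.wienerNorm θ p F) := by simp only [X]; ring
      _ ≤ _ := by gcongr; exact hX m
  have hN : ∀ m, hρ.gevreyNorm θ p q (T m) ≤
      ENNReal.ofReal (x ^ (m + L) / ((m + L).factorial : ℝ)) * (‖c‖ₑ * hρ.gevreyNorm θ p q F) := by
    intro m
    have h2 := (hF.pow hp' hq h0 h1 (m + L)).2.2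
    have h3 : ENNReal.ofReal (1 / ((m + L + 1).factorial : ℝ)) * (((m + L : ℕ) : ℝ≥0∞) + 1) =
        ENNReal.ofReal (1 / ((m + L).factorial : ℝ)) := by
      have h4 : (((m + L : ℕ) : ℝ≥0∞) + 1) = ENNReal.ofReal ((m + L : ℕ) + 1 : ℝ) := by
        rw [ENNReal.ofReal_add (by positivity) zero_le_one, ENNReal.ofReal_natCast,
          ENNReal.ofReal_one]
      rw [h4, ← ENNReal.ofReal_mul (by positivity), Nat.factorial_succ]
      congr 1
      push_cast
      field_simp
    rw [hρ.gevreyNorm_const_mul hq, hc]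
    calc _ ≤ ‖c‖ₑ ^ (m + L) * ‖c‖ₑ * ENNReal.ofReal (1 / ((m + L + 1).factorial : ℝ)) *
          ((((m + L : ℕ) : ℝ≥0∞) + 1) * ((hρ.algebraConst θ p * hρ.wienerNorm θ p F) ^ (m + L) *
            hρ.gevreyNorm θ p q F)) := by gcongr
      _ = (X ^ (m + L) * (ENNReal.ofReal (1 / ((m + L + 1).factorial : ℝ)) *
          (((m + L : ℕ) : ℝ≥0∞) + 1))) * (‖c‖ₑ * hρ.gevreyNorm θ p q F) := by simp only [X]; ring
      _ ≤ _ := by rw [h3]; gcongr; exact hX m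
  have hVs : ∑' m, hρ.wienerNorm θ p (T m) ≤
      ENNReal.ofReal (Real.exp (Real.exp 1 * x - L)) * (‖c‖ₑ * hρ.wienerNorm θ p F) := by
    refine (ENNReal.tsum_le_tsum hV).trans ?_
    rw [ENNReal.tsum_mul_right]
    gcongr
    exact tsum_pow_div_factorial_le L hx
  have hNs : ∑' m, hρ.gevreyNorm θ p q (T m) ≤
      ENNReal.ofReal (Real.exp (Real.exp 1 * x - L)) * (‖c‖ₑ * hρ.gevreyNorm θ p q F) := by
    refine (ENNReal.tsum_le_tsum hN).trans ?_
    rw [ENNReal.tsum_mul_right]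
    gcongr
    exact tsum_pow_div_factorial_le L hx
  obtain ⟨r1, r2, r3⟩ := hρ.memWiener_tsum hp' hq h0 hT
    (F := fun y => _root_.expRemainder L (c * F y))
    (ne_top_of_le_ne_top (ENNReal.mul_ne_top ENNReal.ofReal_ne_top
      (ENNReal.mul_ne_top enorm_ne_top hF.ne_top)) hVs)
    (.of_forall fun y => by
      have := hasSum_expRemainder L (c * F y)
      simp only [mul_pow] at this
      simpa only [T, div_mul_eq_mul_div] using this)
  exact ⟨r1, r2.trans hVs, r3.trans hNs⟩

end exponential

/-! ### Splitting a function by frequency. -/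

section split

variable {n : ℕ} {ρ : EuclideanSpace ℝ (Fin n) → ℝ} {p q : ℝ≥0∞} [hp : Fact (1 ≤ p)] {θ : ℝ}

open Classical in
/-- The part of a function with the boxes in `S`. -/
noncomputable def IsWindow.boxPart (hρ : IsWindow ρ) (S : Set (Fin n → ℤ))
    (F : EuclideanSpace ℝ (Fin n) → ℂ) (x : EuclideanSpace ℝ (Fin n)) : ℂ :=
  ∑' k, if k ∈ S then kernelConv (hρ.boxKernel k) F x else 0

/-- The constant in the estimates for the parts of a function. -/
noncomputable def IsWindow.partConst (hρ : IsWindow ρ) (θ : ℝ) : ℝ≥0∞ :=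
  eLpNorm (hρ.boxKernel 0) 1 volume * ∑ e ∈ latticeCube n 2, subexpWeight θ 1 e

theorem IsWindow.partConst_ne_top (hρ : IsWindow ρ) (θ : ℝ) : hρ.partConst θ ≠ ⊤ :=
  ENNReal.mul_ne_top ((hρ.boxKernel 0).memLp 1 volume).2.ne
    (ENNReal.sum_ne_top.2 fun e _ => subexpWeight_ne_top θ 1 e)

open Classical in
-- Part of a box series need not consist of exact boxes, because neighbouring symbols overlap; a box
-- of the part sees the neighbours within 2.
theorem IsWindow.boxPart_spec (hρ : IsWindow ρ) (hp' : p ≠ ⊤) (S : Set (Fin n → ℤ))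
    {F : EuclideanSpace ℝ (Fin n) → ℂ} (hF : MemLp F p volume)
    (hs : ∑' k, hρ.boxNorm p k F ≠ ⊤) :
    MemLp (hρ.boxPart S F) p volume ∧ ∀ k, hρ.boxNorm p k (hρ.boxPart S F) ≤
      eLpNorm (hρ.boxKernel 0) 1 volume * ∑ e ∈ latticeCube n 2,
        if k - e ∈ S then hρ.boxNorm p (k - e) F else 0 := by
  set P : (Fin n → ℤ) → EuclideanSpace ℝ (Fin n) → ℂ := fun k x =>
    if k ∈ S then kernelConv (hρ.boxKernel k) F x else 0 with hPdef
  have hP1 : ∀ k, P k = if k ∈ S then kernelConv (hρ.boxKernel k) F else 0 := fun k => by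
    ext x; simp only [hPdef]; split_ifs <;> rfl
  have hP : ∀ k, MemLp (P k) p volume := fun k => by
    rw [hP1]
    split_ifs
    · exact memLp_kernelConv hp.out hp' _ hF
    · exact MemLp.zero
  have hPn : ∀ k, eLpNorm (P k) p volume ≤ if k ∈ S then hρ.boxNorm p k F else 0 := fun k => by
    rw [hP1]
    split_ifs
    · exact le_rfl
    · simp
  have hsP : ∑' k, eLpNorm (P k) p volume ≠ ⊤ :=
    ne_top_of_le_ne_top hs (ENNReal.tsum_le_tsum fun k => (hPn k).trans (by split_ifs <;> simp))
  have hPs : ∀ᵐ x, HasSum (fun k => P k x) (hρ.boxPart S F x) := by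
    filter_upwards [hρ.hasSum_kernelConv hp' hF hs] with x hx
    have h1 : Summable fun k => P k x := by
      refine (hx.summable.indicator S).congr fun k => ?_
      simp [hPdef, Set.indicator_apply]
    exact h1.hasSum
  obtain ⟨h1, -, h3⟩ := hρ.boxNorm_tsum_le hp' hP hsP hPs
  refine ⟨h1, fun k => (h3 k).trans ?_⟩
  rw [Finset.mul_sum]
  have h4 : ∀ j, hρ.boxNorm p k (P j) ≤ ∑ e ∈ latticeCube n 2, if j = k - e then
      eLpNorm (hρ.boxKernel 0) 1 volume * (if j ∈ S then hρ.boxNorm p j F else 0) else 0 := by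
    intro j
    by_cases hj : k - j ∈ latticeCube n 2
    · refine le_trans ?_ (Finset.single_le_sum (fun _ _ => zero_le) hj)
      rw [if_pos (by abel)]
      refine (hρ.boxNorm_le hp' k (hP j)).trans ?_
      gcongr
      exact hPn j
    · refine le_trans (le_of_eq ?_) zero_le
      rw [hP1]
      split_ifs
      · exact hρ.boxNorm_kernelConv_eq_zero hp' hj hF
      · have := hρ.boxNorm_const_mul (p := p) 0 k 0
        simp only [zero_mul, enorm_zero] at this
        exact this
  refine (ENNReal.tsum_le_tsum h4).trans (le_of_eq ?_)
  rw [Summable.tsum_finsetSum fun _ _ => ENNReal.summable]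
  refine Finset.sum_congr rfl fun e _ => ?_
  rw [tsum_eq_single (k - e) fun l hl => if_neg hl, if_pos rfl]

theorem IsWindow.boxPart_add_boxPart_compl (hρ : IsWindow ρ) (hp' : p ≠ ⊤) (S : Set (Fin n → ℤ))
    {F : EuclideanSpace ℝ (Fin n) → ℂ} (hF : MemLp F p volume)
    (hs : ∑' k, hρ.boxNorm p k F ≠ ⊤) :
    ∀ᵐ x, hρ.boxPart S F x + hρ.boxPart Sᶜ F x = F x := by
  filter_upwards [hρ.hasSum_kernelConv hp' hF hs] with x hx
  have h1 : ∀ S : Set (Fin n → ℤ), hρ.boxPart S F x =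
      ∑' k, S.indicator (fun k => kernelConv (hρ.boxKernel k) F x) k := fun S => by
    simp only [IsWindow.boxPart, Set.indicator]
  rw [h1, h1, ← (hx.summable.indicator S).tsum_add (hx.summable.indicator Sᶜ), ← hx.tsum_eq]
  refine tsum_congr fun k => ?_
  exact congrFun (Set.indicator_self_add_compl S _) k

open Classical in
theorem IsWindow.wienerNorm_boxPart_le (hρ : IsWindow ρ) (hp' : p ≠ ⊤) (h0 : 0 < θ) (h1 : θ ≤ 1)
    (S : Set (Fin n → ℤ)) {F : EuclideanSpace ℝ (Fin n) → ℂ} (hF : MemLp F p volume)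
    (hs : ∑' k, hρ.boxNorm p k F ≠ ⊤) :
    hρ.wienerNorm θ p (hρ.boxPart S F) ≤ hρ.partConst θ *
      ∑' k, if k ∈ S then subexpWeight θ θ k * hρ.boxNorm p k F else 0 := by
  have hb := (hρ.boxPart_spec hp' S hF hs).2
  set c : (Fin n → ℤ) → ℝ≥0∞ := fun k => if k ∈ S then subexpWeight θ θ k * hρ.boxNorm p k F else 0
    with hc
  have h2 : ∀ k, subexpWeight θ θ k * hρ.boxNorm p k (hρ.boxPart S F) ≤
      eLpNorm (hρ.boxKernel 0) 1 volume * ∑ e ∈ latticeCube n 2, subexpWeight θ 1 e * c (k - e) := by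
    intro k
    calc _ ≤ subexpWeight θ θ k * (eLpNorm (hρ.boxKernel 0) 1 volume * ∑ e ∈ latticeCube n 2,
          if k - e ∈ S then hρ.boxNorm p (k - e) F else 0) := by gcongr; exact hb k
      _ = eLpNorm (hρ.boxKernel 0) 1 volume * ∑ e ∈ latticeCube n 2, subexpWeight θ θ k *
          if k - e ∈ S then hρ.boxNorm p (k - e) F else 0 := by
          rw [← Finset.mul_sum]; ring
      _ ≤ _ := by
          refine mul_le_mul' le_rfl (Finset.sum_le_sum fun e _ => ?_)
          simp only [hc]
          split_ifs
          · have h3 := subexpWeight_add_le h0 h1 h0.le e (k - e)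
            rw [add_sub_cancel] at h3
            rw [← mul_assoc]
            gcongr
            refine h3.trans ?_
            gcongr
            exact subexpWeight_mono h1 e
          · simp
  refine (ENNReal.tsum_le_tsum h2).trans (le_of_eq ?_)
  rw [ENNReal.tsum_mul_left, Summable.tsum_finsetSum fun _ _ => ENNReal.summable,
    IsWindow.partConst, mul_assoc, Finset.sum_mul]
  congr 1
  refine Finset.sum_congr rfl fun e _ => ?_
  rw [ENNReal.tsum_mul_left]
  congr 1
  exact (Equiv.subRight e).tsum_eq c

theorem IsWindow.gevreyNorm_boxPart_le (hρ : IsWindow ρ) (hp' : p ≠ ⊤) (hq : 1 ≤ q) (h0 : 0 < θ)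
    (h1 : θ ≤ 1) (S : Set (Fin n → ℤ)) {F : EuclideanSpace ℝ (Fin n) → ℂ} (hF : MemLp F p volume)
    (hs : ∑' k, hρ.boxNorm p k F ≠ ⊤) :
    hρ.gevreyNorm θ p q (hρ.boxPart S F) ≤ hρ.partConst θ * hρ.gevreyNorm θ p q F := by
  classical
  have hb := (hρ.boxPart_spec hp' S hF hs).2
  set c : (Fin n → ℤ) → ℝ≥0∞ := fun k => subexpWeight θ 1 k * hρ.boxNorm p k F with hc
  have h2 : ∀ k, subexpWeight θ 1 k * hρ.boxNorm p k (hρ.boxPart S F) ≤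
      eLpNorm (hρ.boxKernel 0) 1 volume * ∑ e ∈ latticeCube n 2, subexpWeight θ 1 e * c (k - e) := by
    intro k
    calc _ ≤ subexpWeight θ 1 k * (eLpNorm (hρ.boxKernel 0) 1 volume * ∑ e ∈ latticeCube n 2,
          hρ.boxNorm p (k - e) F) := by
          gcongr
          refine (hb k).trans ?_
          gcongr with e
          split_ifs <;> simp
      _ = eLpNorm (hρ.boxKernel 0) 1 volume * ∑ e ∈ latticeCube n 2, subexpWeight θ 1 k *
          hρ.boxNorm p (k - e) F := by
          rw [← Finset.mul_sum]; ring
      _ ≤ _ := by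
          refine mul_le_mul' le_rfl (Finset.sum_le_sum fun e _ => ?_)
          have h3 := subexpWeight_add_le h0 h1 zero_le_one e (k - e)
          rw [add_sub_cancel] at h3
          rw [← mul_assoc]
          gcongr
  refine (lqNorm_mono h2).trans ?_
  rw [lqNorm_const_mul hq, IsWindow.partConst, mul_assoc]
  gcongr
  refine (lqNorm_sum_le hq _ _).trans ?_
  rw [Finset.sum_mul]
  gcongr with e
  rw [lqNorm_const_mul hq]
  gcongr
  exact (lqNorm_comp_equiv (Equiv.subRight e) c).le

end split

/-! ### Functions of admissible growth. -/

section growth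

/-- The growth scale `(1 + t)^θ (1 + log (1 + t))`. -/
noncomputable def growthScale (θ t : ℝ) : ℝ := (1 + t) ^ θ * (1 + Real.log (1 + t))

theorem one_add_log_le_growthScale {θ t : ℝ} (hθ : 0 ≤ θ) (ht : 0 ≤ t) :
    1 + Real.log (1 + t) ≤ growthScale θ t := by
  have h1 : 0 ≤ Real.log (1 + t) := Real.log_nonneg (by linarith)
  exact le_mul_of_one_le_left (by linarith) (Real.one_le_rpow (by linarith) hθ)

theorem growthScale_nonneg {θ t : ℝ} (hθ : 0 ≤ θ) (ht : 0 ≤ t) : 0 ≤ growthScale θ t := by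
  have h1 : 0 ≤ Real.log (1 + t) := Real.log_nonneg (by linarith)
  linarith [one_add_log_le_growthScale hθ ht]

/-- Growth at most `C e^(a (1 + t)^θ (1 + log (1 + t)))`. -/
def IsSubexp (θ : ℝ) (f : ℝ → ℝ≥0∞) : Prop :=
  ∃ C a : ℝ, 0 ≤ C ∧ 0 ≤ a ∧ ∀ t, 0 ≤ t → f t ≤ ENNReal.ofReal (C * Real.exp (a * growthScale θ t))

theorem IsSubexp.mono {θ : ℝ} {f g : ℝ → ℝ≥0∞} (hg : IsSubexp θ g) (h : ∀ t, 0 ≤ t → f t ≤ g t) :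
    IsSubexp θ f := by
  obtain ⟨C, a, hC, ha, hb⟩ := hg
  exact ⟨C, a, hC, ha, fun t ht => (h t ht).trans (hb t ht)⟩

theorem isSubexp_const {θ : ℝ} {c : ℝ≥0∞} (hc : c ≠ ⊤) : IsSubexp θ fun _ => c :=
  ⟨c.toReal, 0, ENNReal.toReal_nonneg, le_rfl, fun t _ => by simp [hc]⟩

theorem isSubexp_exp {θ a : ℝ} (ha : 0 ≤ a) :
    IsSubexp θ fun t => ENNReal.ofReal (Real.exp (a * growthScale θ t)) :=
  ⟨1, a, zero_le_one, ha, fun t _ => by simp⟩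

theorem isSubexp_ofReal {θ : ℝ} (hθ : 0 ≤ θ) : IsSubexp θ fun t => ENNReal.ofReal t := by
  refine (isSubexp_exp zero_le_one).mono fun t ht => ENNReal.ofReal_le_ofReal ?_
  have h := one_add_log_le_growthScale hθ ht
  calc t ≤ 1 + t := by linarith
    _ = Real.exp (Real.log (1 + t)) := (Real.exp_log (by linarith)).symm
    _ ≤ _ := by gcongr; linarith

theorem IsSubexp.add {θ : ℝ} (hθ : 0 ≤ θ) {f g : ℝ → ℝ≥0∞} (hf : IsSubexp θ f)
    (hg : IsSubexp θ g) : IsSubexp θ fun t => f t + g t := by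
  obtain ⟨C, a, hC, ha, hb⟩ := hf
  obtain ⟨C', a', hC', ha', hb'⟩ := hg
  refine ⟨C + C', a + a', by positivity, by positivity, fun t ht => ?_⟩
  have h := growthScale_nonneg hθ ht
  rw [add_mul, ENNReal.ofReal_add (by positivity) (by positivity)]
  refine add_le_add ((hb t ht).trans (ENNReal.ofReal_le_ofReal ?_))
    ((hb' t ht).trans (ENNReal.ofReal_le_ofReal ?_))
  · gcongr; linarith
  · gcongr; linarith

theorem IsSubexp.mul {θ : ℝ} {f g : ℝ → ℝ≥0∞} (hf : IsSubexp θ f)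
    (hg : IsSubexp θ g) : IsSubexp θ fun t => f t * g t := by
  obtain ⟨C, a, hC, ha, hb⟩ := hf
  obtain ⟨C', a', hC', ha', hb'⟩ := hg
  refine ⟨C * C', a + a', by positivity, by positivity, fun t ht => ?_⟩
  refine (mul_le_mul' (hb t ht) (hb' t ht)).trans (le_of_eq ?_)
  rw [← ENNReal.ofReal_mul (by positivity), add_mul, Real.exp_add]
  ring_nf

end growth

/-! ### Band-limited functions and their exponentials. -/

section low

variable {n : ℕ} {ρ : EuclideanSpace ℝ (Fin n) → ℝ} {p q : ℝ≥0∞} [hp : Fact (1 ≤ p)] {θ : ℝ}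

/-- A bound for the norms of the lattice points in the cube of half-width `3`. -/
noncomputable def cubeRadius (n : ℕ) : ℝ := ∑ e ∈ latticeCube n 3, ‖latticePoint e‖

theorem cubeRadius_nonneg (n : ℕ) : 0 ≤ cubeRadius n :=
  Finset.sum_nonneg fun _ _ => norm_nonneg _

theorem norm_latticePoint_le_cubeRadius {e : Fin n → ℤ} (he : e ∈ latticeCube n 3) :
    ‖latticePoint e‖ ≤ cubeRadius n :=
  Finset.single_le_sum (f := fun e => ‖latticePoint e‖) (fun _ _ => norm_nonneg _) he

theorem norm_latticePoint_le_add {a : ℝ} {k j : Fin n → ℤ} (hj : ‖latticePoint j‖ ≤ a) :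
    ‖latticePoint k‖ ≤ a + ‖latticePoint (k - j)‖ := by
  have h := norm_add_le (latticePoint j) (latticePoint (k - j))
  rw [← latticePoint_add, add_sub_cancel] at h
  linarith

theorem IsWindow.boxNorm_boxPart_eq_zero (hρ : IsWindow ρ) (hp' : p ≠ ⊤) (R : ℝ)
    {F : EuclideanSpace ℝ (Fin n) → ℂ} (hF : MemLp F p volume)
    (hs : ∑' k, hρ.boxNorm p k F ≠ ⊤) {k : Fin n → ℤ} (hk : R + cubeRadius n < ‖latticePoint k‖) :
    hρ.boxNorm p k (hρ.boxPart {k | ‖latticePoint k‖ ≤ R} F) = 0 := by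
  classical
  refine le_antisymm (((hρ.boxPart_spec hp' _ hF hs).2 k).trans (le_of_eq ?_)) zero_le
  rw [Finset.sum_eq_zero, mul_zero]
  intro e he
  refine if_neg fun h => ?_
  have h3 : e ∈ latticeCube n 3 := mem_latticeCube.2 fun i =>
    (mem_latticeCube.1 he i).trans (by norm_num)
  have h1 := norm_latticePoint_le_add (k := k) (show ‖latticePoint (k - e)‖ ≤ R from h)
  have h2 := norm_latticePoint_le_cubeRadius h3
  rw [sub_sub_cancel] at h1
  linarith

theorem IsWindow.boxNorm_mul_eq_zero_of_lt (hρ : IsWindow ρ) (hp' : p ≠ ⊤) (h0 : 0 < θ) {a b : ℝ}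
    {F G : EuclideanSpace ℝ (Fin n) → ℂ} (hF : hρ.MemWiener θ p F) (hG : hρ.MemWiener θ p G)
    (ha : ∀ k, a < ‖latticePoint k‖ → hρ.boxNorm p k F = 0)
    (hb : ∀ k, b < ‖latticePoint k‖ → hρ.boxNorm p k G = 0) {k : Fin n → ℤ}
    (hk : a + b + cubeRadius n < ‖latticePoint k‖) :
    hρ.boxNorm p k (fun x => F x * G x) = 0 := by
  refine le_antisymm (((hρ.boxNorm_mul_le hp' hF.memLp hG.memLp (hF.tsum_boxNorm_ne_top h0)
    (hG.tsum_boxNorm_ne_top h0)).2 k).trans (le_of_eq ?_)) zero_le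
  rw [Finset.sum_eq_zero, mul_zero]
  intro e he
  rw [ENNReal.tsum_eq_zero]
  intro j
  by_cases hj : a < ‖latticePoint j‖
  · rw [ha j hj, zero_mul]
  · rw [hb (k - e - j), mul_zero]
    have h1 := norm_latticePoint_le_add (k := k) (norm_latticePoint_le_cubeRadius he)
    have h2 := norm_latticePoint_le_add (k := k - e) (not_lt.1 hj)
    linarith

/-- The m + 1 factors contribute (m + 1)a and the m products each enlarge the band by `cubeRadius
n`, whence the subtracted term. -/
theorem IsWindow.boxNorm_pow_eq_zero (hρ : IsWindow ρ) (hp' : p ≠ ⊤) (hq : 1 ≤ q) (h0 : 0 < θ)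
    (h1 : θ ≤ 1) {a : ℝ} {F : EuclideanSpace ℝ (Fin n) → ℂ} (hF : hρ.MemWiener θ p F)
    (ha : ∀ k, a < ‖latticePoint k‖ → hρ.boxNorm p k F = 0) (m : ℕ) (k : Fin n → ℤ)
    (hk : (m + 1) * (a + cubeRadius n) - cubeRadius n < ‖latticePoint k‖) :
    hρ.boxNorm p k (fun x => F x ^ (m + 1)) = 0 := by
  induction m generalizing k with
  | zero => simpa using ha k (by simpa using hk)
  | succ m ih =>
    have e : (fun x => F x ^ (m + 1 + 1)) = fun x => F x ^ (m + 1) * F x := by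
      ext x; rw [pow_succ]
    rw [e]
    refine hρ.boxNorm_mul_eq_zero_of_lt hp' h0 (hF.pow hp' hq h0 h1 m).1 hF ih ha ?_
    push_cast at hk
    linarith

theorem IsWindow.boxNorm_add_le (hρ : IsWindow ρ) (hp' : p ≠ ⊤) {F G : EuclideanSpace ℝ (Fin n) → ℂ}
    (hF : MemLp F p volume) (hG : MemLp G p volume) (k : Fin n → ℤ) :
    hρ.boxNorm p k (fun x => F x + G x) ≤ hρ.boxNorm p k F + hρ.boxNorm p k G := by
  have h := kernelConv_add (hρ.boxKernel k) hF hG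
  unfold IsWindow.boxNorm
  refine le_trans (le_of_eq ?_) (eLpNorm_add_le (memLp_kernelConv hp.out hp' _ hF).1
    (memLp_kernelConv hp.out hp' _ hG).1 hp.out)
  rw [← h]
  rfl

theorem expRemainder_zero (z : ℂ) : expRemainder 0 z = Complex.exp z - 1 := by
  simp [expRemainder]

theorem expRemainder_eq_succ (L : ℕ) (z : ℂ) :
    expRemainder L z = expRemainder (L + 1) z + z ^ (L + 1) / ((L + 1).factorial : ℂ) := by
  rw [expRemainder, expRemainder, Finset.sum_range_succ _ (L + 1)]
  ring

theorem IsWindow.MemWiener.memWiener_expRemainder {hρ : IsWindow ρ} (hp' : p ≠ ⊤) (h0 : 0 < θ)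
    (h1 : θ ≤ 1) {F : EuclideanSpace ℝ (Fin n) → ℂ} (hF : hρ.MemWiener θ p F) (c : ℂ) (L : ℕ) :
    hρ.MemWiener θ p (fun y => _root_.expRemainder L (c * F y)) :=
  (hF.expRemainder (q := 1) hp' le_rfl h0 h1 c L ENNReal.toReal_nonneg
    (ENNReal.ofReal_toReal (ENNReal.mul_ne_top enorm_ne_top (ENNReal.mul_ne_top
      (hρ.algebraConst_ne_top θ p) hF.ne_top))).ge).1

/-- Beyond this radius the powers of degrees 1 to L have vanishing boxes, so the Taylor terms can be
removed one by one. -/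
theorem IsWindow.boxNorm_exp_sub_one_le (hρ : IsWindow ρ) (hp' : p ≠ ⊤) (h0 : 0 < θ)
    (h1 : θ ≤ 1) {a : ℝ} (ha0 : 0 ≤ a) {F : EuclideanSpace ℝ (Fin n) → ℂ}
    (hF : hρ.MemWiener θ p F)
    (ha : ∀ k, a < ‖latticePoint k‖ → hρ.boxNorm p k F = 0) (c : ℂ) (L : ℕ) (k : Fin n → ℤ)
    (hk : L * (a + cubeRadius n) < ‖latticePoint k‖) :
    hρ.boxNorm p k (fun x => expRemainder 0 (c * F x)) ≤
      hρ.boxNorm p k (fun x => expRemainder L (c * F x)) := by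
  have hd := cubeRadius_nonneg n
  induction L with
  | zero => exact le_rfl
  | succ L ih =>
    push_cast at hk
    refine (ih (by linarith)).trans ?_
    have e : (fun x => expRemainder L (c * F x)) = fun x => expRemainder (L + 1) (c * F x) +
        (c ^ (L + 1) / ((L + 1).factorial : ℂ)) * F x ^ (L + 1) := by
      ext x
      rw [expRemainder_eq_succ, mul_pow]
      ring
    rw [e]
    have hpow := (hF.pow (q := 1) hp' le_rfl h0 h1 L).1
    refine (hρ.boxNorm_add_le hp' (hF.memWiener_expRemainder hp' h0 h1 c (L + 1)).memLp
      (hpow.const_mul _).memLp k).trans ?_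
    rw [hρ.boxNorm_const_mul, hρ.boxNorm_pow_eq_zero (q := 1) hp' le_rfl h0 h1 hF ha L k (by linarith),
      mul_zero, add_zero]

/-- On the ball e^{r} ≤ e^{2K^θ} e^{-r} with r = |k|^θ; the second factor is summable. -/
theorem tsum_subexpWeight_ball_le (hθ : 0 < θ) (K : ℝ) :
    (∑' k : Fin n → ℤ, if ‖latticePoint k‖ ≤ K then subexpWeight θ 1 k else 0) ≤
      ENNReal.ofReal (Real.exp (2 * K ^ θ)) * ∑' k : Fin n → ℤ, subexpWeight θ (-1) k := by
  rw [← ENNReal.tsum_mul_left]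
  refine ENNReal.tsum_le_tsum fun k => ?_
  split_ifs with h
  · unfold subexpWeight
    rw [← ENNReal.ofReal_mul (Real.exp_pos _).le, ← Real.exp_add]
    have := Real.rpow_le_rpow (norm_nonneg _) h hθ.le
    refine ENNReal.ofReal_le_ofReal (Real.exp_le_exp.2 ?_)
    linarith
  · exact zero_le

/-- Inside the ball the boxes are controlled by the unweighted L^p norm and the weights are paid for
by the radius; outside it only the Taylor remainder survives. The free degree `L` balances the two.
-/
theorem IsWindow.gevreyNorm_exp_sub_one_le (hρ : IsWindow ρ) (hp' : p ≠ ⊤) (hq : 1 ≤ q) (h0 : 0 < θ)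
    (h1 : θ ≤ 1) {a : ℝ} (ha0 : 0 ≤ a) {F : EuclideanSpace ℝ (Fin n) → ℂ}
    (hF : hρ.MemWiener θ p F)
    (ha : ∀ k, a < ‖latticePoint k‖ → hρ.boxNorm p k F = 0) (c : ℂ) (L : ℕ) :
    hρ.gevreyNorm θ p q (fun x => expRemainder 0 (c * F x)) ≤
      eLpNorm (hρ.boxKernel 0) 1 volume * eLpNorm (fun x => expRemainder 0 (c * F x)) p volume *
        (ENNReal.ofReal (Real.exp (2 * (L * (a + cubeRadius n)) ^ θ)) *
          ∑' k : Fin n → ℤ, subexpWeight θ (-1) k) +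
      hρ.gevreyNorm θ p q (fun x => expRemainder L (c * F x)) := by
  set B := eLpNorm (hρ.boxKernel 0) 1 volume * eLpNorm (fun x => expRemainder 0 (c * F x)) p volume
  have hd := cubeRadius_nonneg n
  have h2 : ∀ k, subexpWeight θ 1 k * hρ.boxNorm p k (fun x => expRemainder 0 (c * F x)) ≤
      B * (if ‖latticePoint k‖ ≤ L * (a + cubeRadius n) then subexpWeight θ 1 k else 0) +
      subexpWeight θ 1 k * hρ.boxNorm p k (fun x => expRemainder L (c * F x)) := by
    intro k
    split_ifs with hk
    · refine le_add_right ?_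
      rw [mul_comm]
      gcongr
      exact hρ.boxNorm_le hp' k (hF.memWiener_expRemainder hp' h0 h1 c 0).memLp
    · rw [mul_zero, zero_add]
      gcongr
      exact hρ.boxNorm_exp_sub_one_le hp' h0 h1 ha0 hF ha c L k (not_le.1 hk)
  refine (lqNorm_mono h2).trans ((lqNorm_add_le hq _ _).trans ?_)
  rw [lqNorm_const_mul hq]
  refine add_le_add (mul_le_mul' le_rfl ?_) le_rfl
  exact (lqNorm_le_tsum hq _).trans (tsum_subexpWeight_ball_le h0 _)

/-- Mean value inequality on the half-plane Re w ≤ b, which is convex and contains 0. -/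
theorem Complex.norm_exp_sub_one_le_of_re_le {z : ℂ} {b : ℝ} (hb : 0 ≤ b) (hz : z.re ≤ b) :
    ‖Complex.exp z - 1‖ ≤ Real.exp b * ‖z‖ := by
  have hconv : Convex ℝ {w : ℂ | w.re ≤ b} := convex_halfSpace_re_le b
  have h := hconv.norm_image_sub_le_of_norm_deriv_le (f := Complex.exp) (C := Real.exp b)
    (x := 0) (y := z) (fun w _ => Complex.differentiableAt_exp) (fun w hw => by
      rw [Complex.deriv_exp, Complex.norm_exp]
      exact Real.exp_le_exp.2 hw) (by simpa using hb) hz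
  simpa using h

end low

/-! ### The choice of the frequency cutoff. -/

section main

variable {n : ℕ} {ρ : EuclideanSpace ℝ (Fin n) → ℝ} {p q : ℝ≥0∞} [hp : Fact (1 ≤ p)] {θ : ℝ}

theorem tsum_subexpWeight_sub_one_ne_top (h0 : 0 < θ) (h1 : θ < 1) :
    ∑' k : Fin n → ℤ, subexpWeight θ (θ - 1) k ≠ ⊤ :=
  tsum_subexpWeight_neg_ne_top h0 (by linarith)

theorem IsWindow.memWiener_of_gevreyNorm_ne_top (hρ : IsWindow ρ) (hq : 1 ≤ q) (h0 : 0 < θ)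
    (h1 : θ < 1) {F : EuclideanSpace ℝ (Fin n) → ℂ} (hF : MemLp F p volume)
    (hN : hρ.gevreyNorm θ p q F ≠ ⊤) : hρ.MemWiener θ p F :=
  ⟨hF, ne_top_of_le_ne_top (ENNReal.mul_ne_top (tsum_subexpWeight_sub_one_ne_top h0 h1) hN)
    (hρ.wienerNorm_le_gevreyNorm hq F)⟩

/-- The frequency cutoff at the parameter `t`. -/
noncomputable def freqCutoff (θ A t : ℝ) : ℝ := (A * (1 + Real.log (1 + t))) ^ (1 / θ)

theorem freqCutoff_rpow {A t : ℝ} (h0 : 0 < θ) (hA : 0 ≤ A) (ht : 0 ≤ t) :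
    freqCutoff θ A t ^ θ = A * (1 + Real.log (1 + t)) := by
  have h : 0 ≤ Real.log (1 + t) := Real.log_nonneg (by linarith)
  rw [freqCutoff, ← Real.rpow_mul (by positivity), one_div, inv_mul_cancel₀ h0.ne', Real.rpow_one]

theorem freqCutoff_nonneg {A t : ℝ} (hA : 0 ≤ A) (ht : 0 ≤ t) :
    0 ≤ freqCutoff θ A t := by
  have h : 0 ≤ Real.log (1 + t) := Real.log_nonneg (by linarith)
  unfold freqCutoff
  positivity

/-- Half of the gap 1 - θ between the two weights pays for summability, the other half gives the
decay in R. -/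
theorem IsWindow.wienerNorm_high_le (hρ : IsWindow ρ) (hp' : p ≠ ⊤) (hq : 1 ≤ q) (h0 : 0 < θ)
    (h1 : θ < 1) {F : EuclideanSpace ℝ (Fin n) → ℂ} (hF : MemLp F p volume)
    (hN : hρ.gevreyNorm θ p q F ≠ ⊤) {R : ℝ} (hR : 0 ≤ R) :
    hρ.wienerNorm θ p (hρ.boxPart {k | ‖latticePoint k‖ ≤ R}ᶜ F) ≤
      ENNReal.ofReal (Real.exp ((θ - 1) / 2 * R ^ θ)) *
        (hρ.partConst θ * ((∑' k : Fin n → ℤ, subexpWeight θ ((θ - 1) / 2) k) *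
          hρ.gevreyNorm θ p q F)) := by
  classical
  have hW := hρ.memWiener_of_gevreyNorm_ne_top hq h0 h1 hF hN
  refine (hρ.wienerNorm_boxPart_le hp' h0 h1.le _ hF (hW.tsum_boxNorm_ne_top h0)).trans ?_
  rw [mul_left_comm]
  gcongr
  rw [← ENNReal.tsum_mul_right, ← ENNReal.tsum_mul_left]
  refine ENNReal.tsum_le_tsum fun k => ?_
  split_ifs with hk
  · have h2 : R ≤ ‖latticePoint k‖ := (not_le.1 (show ¬ ‖latticePoint k‖ ≤ R from hk)).le
    have h3 : subexpWeight θ ((θ - 1) / 2) k ≤ ENNReal.ofReal (Real.exp ((θ - 1) / 2 * R ^ θ)) := by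
      unfold subexpWeight
      refine ENNReal.ofReal_le_ofReal (Real.exp_le_exp.2 ?_)
      exact mul_le_mul_of_nonpos_left (Real.rpow_le_rpow hR h2 h0.le) (by linarith)
    refine (hρ.subexpWeight_mul_boxNorm_le hq F k).trans ?_
    rw [← add_halves (θ - 1), ← subexpWeight_mul, mul_assoc, add_halves]
    gcongr
  · exact zero_le

/-- At the cutoff the decay is a power of 1 + t, which beats t for large A. The algebra constant is
included for the exponential series of the high part, the Bernstein constant for its sup norm. -/
theorem IsWindow.exists_freqCutoff (hρ : IsWindow ρ) (hp' : p ≠ ⊤) (hq : 1 ≤ q) (h0 : 0 < θ)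
    (h1 : θ < 1) {F : EuclideanSpace ℝ (Fin n) → ℂ} (hF : MemLp F p volume)
    (hN : hρ.gevreyNorm θ p q F ≠ ⊤) : ∃ A : ℝ, 0 ≤ A ∧ ∀ t, 0 ≤ t → ENNReal.ofReal t *
      ((hρ.algebraConst θ p + hρ.bernsteinConst p) *
        hρ.wienerNorm θ p (hρ.boxPart {k | ‖latticePoint k‖ ≤ freqCutoff θ A t}ᶜ F)) ≤ 1 := by
  set Q := (hρ.algebraConst θ p + hρ.bernsteinConst p) *
    (hρ.partConst θ * ((∑' k : Fin n → ℤ, subexpWeight θ ((θ - 1) / 2) k) *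
          hρ.gevreyNorm θ p q F)) with hQ
  have hQt : Q ≠ ⊤ := by
    refine ENNReal.mul_ne_top (ENNReal.add_ne_top.2
      ⟨hρ.algebraConst_ne_top θ p, hρ.bernsteinConst_ne_top p⟩)
      (ENNReal.mul_ne_top (hρ.partConst_ne_top θ)
        (ENNReal.mul_ne_top (tsum_subexpWeight_neg_ne_top h0 (by linarith)) hN))
  have hQ0 : 0 ≤ Q.toReal := ENNReal.toReal_nonneg
  have h1' : 0 < 1 - θ := by linarith
  -- The factor 2/(1 - θ) normalises the decay to exp(-(1 + Q)(1 + log(1 + t))), and Q t ≤ e^Q (1 +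
  -- t) is below its inverse.
  refine ⟨2 / (1 - θ) * (1 + Q.toReal), by positivity, fun t ht => ?_⟩
  have hA : 0 ≤ 2 / (1 - θ) * (1 + Q.toReal) := by positivity
  have hlog : 0 ≤ Real.log (1 + t) := Real.log_nonneg (by linarith)
  have h2 := hρ.wienerNorm_high_le hp' hq h0 h1 hF hN (freqCutoff_nonneg (θ := θ) hA ht)
  rw [freqCutoff_rpow h0 hA ht] at h2
  have e : (θ - 1) / 2 * (2 / (1 - θ) * (1 + Q.toReal) * (1 + Real.log (1 + t))) =
      -((1 + Q.toReal) * (1 + Real.log (1 + t))) := by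
    field_simp
    ring
  rw [e] at h2
  have h3 : Real.exp (-((1 + Q.toReal) * (1 + Real.log (1 + t)))) * Q.toReal * t ≤ 1 := by
    rw [Real.exp_neg]
    have h4 : Q.toReal * t ≤ Real.exp ((1 + Q.toReal) * (1 + Real.log (1 + t))) := by
      calc Q.toReal * t ≤ Real.exp Q.toReal * (1 + t) := by
            gcongr
            · linarith [Real.add_one_le_exp Q.toReal]
            · linarith
        _ = Real.exp (Q.toReal + Real.log (1 + t)) := by
            rw [Real.exp_add, Real.exp_log (by linarith)]
        _ ≤ _ := by
            gcongr
            nlinarith [mul_nonneg hQ0 hlog]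
    rw [mul_assoc, inv_mul_le_iff₀ (Real.exp_pos _), mul_one]
    exact h4
  calc _ ≤ ENNReal.ofReal t * ((hρ.algebraConst θ p + hρ.bernsteinConst p) *
        (ENNReal.ofReal (Real.exp (-((1 + Q.toReal) * (1 + Real.log (1 + t))))) *
        (hρ.partConst θ * ((∑' k : Fin n → ℤ, subexpWeight θ ((θ - 1) / 2) k) *
          hρ.gevreyNorm θ p q F)))) := by gcongr
    _ = ENNReal.ofReal (Real.exp (-((1 + Q.toReal) * (1 + Real.log (1 + t))))) * Q *
          ENNReal.ofReal t := by rw [hQ]; ring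
    _ = ENNReal.ofReal (Real.exp (-((1 + Q.toReal) * (1 + Real.log (1 + t)))) * Q.toReal * t) := by
        rw [ENNReal.ofReal_mul (by positivity), ENNReal.ofReal_mul (by positivity),
          ENNReal.ofReal_toReal hQt]
    _ ≤ 1 := by rwa [ENNReal.ofReal_le_one]

/-- The cutoff is of order (log t)^{1/θ}, so the θ-th power of t times the cutoff is of order t^θ
log t: this is where the logarithm in the hypothesis on μ comes from. -/
theorem exists_cutoff_rpow_le {A Y d : ℝ} (h0 : 0 < θ) (hA : 0 ≤ A) (hY : 0 ≤ Y) (hd : 0 ≤ d) :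
    ∃ a : ℝ, 0 ≤ a ∧ ∀ t, 0 ≤ t →
      ((⌈Y * t⌉₊ : ℝ) * (freqCutoff θ A t + d)) ^ θ ≤ a * growthScale θ t := by
  refine ⟨((Y + 1) * (A ^ (1 / θ) + d)) ^ θ, by positivity, fun t ht => ?_⟩
  have hlog : 0 ≤ Real.log (1 + t) := Real.log_nonneg (by linarith)
  set ℓ := 1 + Real.log (1 + t) with hℓ
  have hℓ1 : 1 ≤ ℓ := by linarith
  have hR := freqCutoff_nonneg (θ := θ) hA ht
  have h1 : (⌈Y * t⌉₊ : ℝ) ≤ (Y + 1) * (1 + t) := by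
    have := (Nat.ceil_lt_add_one (mul_nonneg hY ht)).le
    nlinarith
  have h2 : freqCutoff θ A t + d ≤ (A ^ (1 / θ) + d) * ℓ ^ (1 / θ) := by
    rw [freqCutoff, Real.mul_rpow hA (by linarith), add_mul]
    gcongr
    exact le_mul_of_one_le_right hd (Real.one_le_rpow hℓ1 (by positivity))
  calc _ ≤ ((Y + 1) * (1 + t) * ((A ^ (1 / θ) + d) * ℓ ^ (1 / θ))) ^ θ := by gcongr
    _ = ((Y + 1) * (A ^ (1 / θ) + d) * ((1 + t) * ℓ ^ (1 / θ))) ^ θ := by ring_nf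
    _ = ((Y + 1) * (A ^ (1 / θ) + d)) ^ θ * ((1 + t) ^ θ * (ℓ ^ (1 / θ)) ^ θ) := by
        rw [Real.mul_rpow (x := (Y + 1) * (A ^ (1 / θ) + d)) (by positivity) (by positivity),
          Real.mul_rpow (x := 1 + t) (by positivity) (by positivity)]
    _ = _ := by
        rw [← Real.rpow_mul (by positivity), one_div, inv_mul_cancel₀ h0.ne', Real.rpow_one]
        rfl

end main

/-! ### The norm of e^{iξu} - 1 for real u. -/

section main

variable {n : ℕ} {ρ : EuclideanSpace ℝ (Fin n) → ℝ} {p q : ℝ≥0∞} [hp : Fact (1 ≤ p)] {θ : ℝ}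

theorem enorm_I_mul_ofReal (ξ : ℝ) : ‖Complex.I * ξ‖ₑ = ENNReal.ofReal |ξ| := by
  rw [← ofReal_norm]
  simp

/-- Here the reality of `u` enters: Im l = -Im h, so Re(iξ l) = ξ Im h is at most 1 and |e^{iξl} -
1| ≤ e |ξ l|. -/
theorem eLpNorm_expRemainder_zero_le {u : EuclideanSpace ℝ (Fin n) → ℝ}
    {l h : EuclideanSpace ℝ (Fin n) → ℂ} (hlh : ∀ᵐ x, l x + h x = u x) {ξ : ℝ} {B : ℝ≥0∞}
    (hh : ∀ᵐ x, ‖h x‖ₑ ≤ B) (hB : ENNReal.ofReal |ξ| * B ≤ 1) :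
    eLpNorm (fun x => expRemainder 0 (Complex.I * ξ * l x)) p volume ≤
      ENNReal.ofReal (Real.exp 1 * |ξ|) * eLpNorm l p volume := by
  refine eLpNorm_le_mul_eLpNorm_of_ae_le_mul ?_ p
  filter_upwards [hlh, hh] with x h1 h2
  have him : (l x).im = -(h x).im := by
    have := congrArg Complex.im h1
    simp at this
    linarith
  have h3 : |ξ| * ‖h x‖ ≤ 1 := by
    have h4 : ENNReal.ofReal (|ξ| * ‖h x‖) ≤ 1 := by
      rw [ENNReal.ofReal_mul (abs_nonneg _), ofReal_norm]
      exact le_trans (by gcongr) hB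
    rwa [ENNReal.ofReal_le_one] at h4
  have hre : (Complex.I * ξ * l x).re ≤ 1 := by
    have h5 : (Complex.I * ξ * l x).re = ξ * (h x).im := by
      simp [him]
    rw [h5]
    refine (le_abs_self _).trans ?_
    rw [abs_mul]
    refine le_trans ?_ h3
    gcongr
    exact Complex.abs_im_le_norm _
  rw [expRemainder_zero]
  refine (Complex.norm_exp_sub_one_le_of_re_le zero_le_one hre).trans (le_of_eq ?_)
  simp [mul_assoc]

/-- The composition of `e^(i ξ ·) - 1` with a real function has a norm of subexponential growth. -/
theorem IsWindow.exists_gevreyNorm_exp_le (hρ : IsWindow ρ) (hp' : p ≠ ⊤) (hq : 1 ≤ q) (h0 : 0 < θ)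
    (h1 : θ < 1) {u : EuclideanSpace ℝ (Fin n) → ℝ}
    (hF : MemLp (fun x => (u x : ℂ)) p volume)
    (hN : hρ.gevreyNorm θ p q (fun x => (u x : ℂ)) ≠ ⊤) :
    ∃ g : ℝ → ℝ≥0∞, IsSubexp θ g ∧ ∀ ξ : ℝ,
      hρ.gevreyNorm θ p q (fun x => Complex.exp (Complex.I * ξ * u x) - 1) ≤ g |ξ| := by
  classical
  set F : EuclideanSpace ℝ (Fin n) → ℂ := fun x => (u x : ℂ) with hFdef
  have hW := hρ.memWiener_of_gevreyNorm_ne_top hq h0 h1 hF hN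
  have hs := hW.tsum_boxNorm_ne_top h0
  obtain ⟨A, hA, hcut⟩ := hρ.exists_freqCutoff hp' hq h0 h1 hF hN
  set N := hρ.gevreyNorm θ p q F
  set Cv := ∑' k : Fin n → ℤ, subexpWeight θ (θ - 1) k
  have hCv : Cv ≠ ⊤ := tsum_subexpWeight_sub_one_ne_top h0 h1
  set S1 := ∑' k : Fin n → ℤ, subexpWeight θ (-1) k
  have hS1 : S1 ≠ ⊤ := tsum_subexpWeight_neg_ne_top h0 (by norm_num)
  set D := hρ.algebraConst θ p
  have hD : D ≠ ⊤ := hρ.algebraConst_ne_top θ p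
  set C5 := hρ.partConst θ
  have hC5 : C5 ≠ ⊤ := hρ.partConst_ne_top θ
  set V0 := C5 * (Cv * N)
  have hV0 : V0 ≠ ⊤ := ENNReal.mul_ne_top hC5 (ENNReal.mul_ne_top hCv hN)
  set C1 := eLpNorm (hρ.boxKernel 0) 1 volume
  have hC1 : C1 ≠ ⊤ := ((hρ.boxKernel 0).memLp 1 volume).2.ne
  set Y := (D * V0).toReal with hYdef
  have hY : 0 ≤ Y := ENNReal.toReal_nonneg
  have hd := cubeRadius_nonneg n
  -- One `cubeRadius n` for the overlap at the edge of the low part, one for each multiplication.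
  obtain ⟨a, ha, hgrow⟩ := exists_cutoff_rpow_le (θ := θ) (A := A) (Y := Real.exp 1 * Y)
    (d := cubeRadius n + cubeRadius n) h0 hA (by positivity) (by positivity)
  -- The constant exp(e) is the bound for the exponential series with L = 0 and x = 1.
  set gH : ℝ → ℝ≥0∞ := fun t => ENNReal.ofReal (Real.exp (Real.exp 1)) *
    (ENNReal.ofReal t * (C5 * N))
  set gG : ℝ → ℝ≥0∞ := fun t => C1 * (ENNReal.ofReal (Real.exp 1) * ENNReal.ofReal t * V0) *
    (ENNReal.ofReal (Real.exp (2 * a * growthScale θ t)) * S1) + ENNReal.ofReal t * (C5 * N)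
  have hgH : IsSubexp θ gH := (isSubexp_const ENNReal.ofReal_ne_top).mul
    ((isSubexp_ofReal h0.le).mul (isSubexp_const (ENNReal.mul_ne_top hC5 hN)))
  have hgG : IsSubexp θ gG := (((isSubexp_const hC1).mul (((isSubexp_const
    ENNReal.ofReal_ne_top).mul (isSubexp_ofReal h0.le)).mul (isSubexp_const hV0))).mul
    ((isSubexp_exp (by positivity)).mul (isSubexp_const hS1))).add h0.le
    ((isSubexp_ofReal h0.le).mul (isSubexp_const (ENNReal.mul_ne_top hC5 hN)))
  refine ⟨fun t => D * (gG t * (Cv * gH t) + Cv * gG t * gH t) + gG t + gH t,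
    (((isSubexp_const hD).mul ((hgG.mul ((isSubexp_const hCv).mul hgH)).add h0.le
      (((isSubexp_const hCv).mul hgG).mul hgH))).add h0.le hgG).add h0.le hgH, fun ξ => ?_⟩
  set t := |ξ|
  have ht : 0 ≤ t := abs_nonneg ξ
  set S : Set (Fin n → ℤ) := {k | ‖latticePoint k‖ ≤ freqCutoff θ A t}
  set l := hρ.boxPart S F
  set h := hρ.boxPart Sᶜ F
  have hlh : ∀ᵐ x, l x + h x = u x := hρ.boxPart_add_boxPart_compl hp' S hF hs
  have hVle : ∀ T : Set (Fin n → ℤ), hρ.wienerNorm θ p (hρ.boxPart T F) ≤ V0 := fun T => by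
    refine (hρ.wienerNorm_boxPart_le hp' h0 h1.le T hF hs).trans ?_
    refine mul_le_mul' le_rfl (le_trans ?_ (hρ.wienerNorm_le_gevreyNorm hq F))
    refine ENNReal.tsum_le_tsum fun k => ?_
    split_ifs <;> simp
  have hWl : ∀ T, hρ.MemWiener θ p (hρ.boxPart T F) := fun T =>
    ⟨(hρ.boxPart_spec hp' T hF hs).1, ne_top_of_le_ne_top hV0 (hVle T)⟩
  have hNle : ∀ T, hρ.gevreyNorm θ p q (hρ.boxPart T F) ≤ C5 * N := fun T =>
    hρ.gevreyNorm_boxPart_le hp' hq h0 h1.le T hF hs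
  have hcutt := hcut t ht
  have hc := enorm_I_mul_ofReal ξ
  -- the high frequencies
  have hH := (hWl Sᶜ).expRemainder hp' hq h0 h1.le (Complex.I * ξ) 0 zero_le_one (by
    rw [hc, ENNReal.ofReal_one]
    refine le_trans ?_ hcutt
    gcongr
    exact le_self_add)
  set H : EuclideanSpace ℝ (Fin n) → ℂ := fun x => expRemainder 0 (Complex.I * ξ * h x)
  have hHN : hρ.gevreyNorm θ p q H ≤ gH t := by
    refine hH.2.2.trans ?_
    rw [hc]
    simp only [gH]
    gcongr
    · simp
    · exact hNle _
  -- the low frequencies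
  set G : EuclideanSpace ℝ (Fin n) → ℂ := fun x => expRemainder 0 (Complex.I * ξ * l x)
  have hGW : hρ.MemWiener θ p G := (hWl S).memWiener_expRemainder hp' h0 h1.le _ 0
  have hGN : hρ.gevreyNorm θ p q G ≤ gG t := by
    -- The degree L = ⌈e Y t⌉ makes the remainder factor exp(e Y t - L) at most 1.
    refine (hρ.gevreyNorm_exp_sub_one_le hp' hq h0 h1.le
      (a := freqCutoff θ A t + cubeRadius n)
      (add_nonneg (freqCutoff_nonneg hA ht) hd) (hWl S)
      (fun k hk => hρ.boxNorm_boxPart_eq_zero hp' _ hF hs hk) (Complex.I * ξ)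
      ⌈Real.exp 1 * Y * t⌉₊).trans ?_
    refine add_le_add (mul_le_mul' (mul_le_mul' le_rfl ?_) (mul_le_mul' ?_ le_rfl)) ?_
    · refine (eLpNorm_expRemainder_zero_le hlh ((hWl Sᶜ).ae_enorm_le h0 hp') ?_).trans ?_
      · refine le_trans ?_ hcutt
        gcongr
        exact le_add_self
      · rw [ENNReal.ofReal_mul (Real.exp_pos _).le]
        gcongr
        exact ((hWl S).eLpNorm_le h0 hp').trans (hVle S)
    · refine ENNReal.ofReal_le_ofReal (Real.exp_le_exp.2 ?_)
      have := hgrow t ht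
      rw [← add_assoc] at this
      linarith
    · refine ((hWl S).expRemainder hp' hq h0 h1.le (Complex.I * ξ) ⌈Real.exp 1 * Y * t⌉₊
        (x := Y * t) (by positivity) ?_).2.2.trans ?_
      · rw [hc, mul_comm Y, ENNReal.ofReal_mul ht, hYdef,
          ENNReal.ofReal_toReal (ENNReal.mul_ne_top hD hV0)]
        gcongr
        exact hVle S
      · rw [hc]
        refine (mul_le_mul' (ENNReal.ofReal_le_one.2 (Real.exp_le_one_iff.2 ?_))
          (mul_le_mul' le_rfl (hNle S))).trans (one_mul _).le
        have := Nat.le_ceil (Real.exp 1 * Y * t)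
        rw [← mul_assoc]
        linarith
  have hV : ∀ K : EuclideanSpace ℝ (Fin n) → ℂ,
      hρ.wienerNorm θ p K ≤ Cv * hρ.gevreyNorm θ p q K := hρ.wienerNorm_le_gevreyNorm hq
  have hGH := hGW.mul hp' h0 h1.le hH.1
  have hGHG := hGH.add hp' hq h0 hGW
  have hsum := hGHG.1.add hp' hq h0 hH.1
  -- With u = l + h, e^{iξu} - 1 = (1 + G)(1 + H) - 1.
  have hae : (fun x => Complex.exp (Complex.I * ξ * u x) - 1) =ᵐ[volume]
      fun x => (G x * H x + G x) + H x := by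
    filter_upwards [hlh] with x hx
    simp only [G, H, expRemainder_zero]
    rw [← hx, mul_add, Complex.exp_add]
    ring
  rw [hρ.gevreyNorm_congr_ae hae]
  refine hsum.2.trans (add_le_add (hGHG.2.trans (add_le_add ?_ hGN)) hHN)
  refine (hρ.gevreyNorm_mul_le hp' hq h0 h1.le hGW hH.1).trans ?_
  refine mul_le_mul' le_rfl (add_le_add (mul_le_mul' hGN ((hV H).trans ?_))
    (mul_le_mul' ((hV G).trans ?_) hHN))
  · gcongr
  · gcongr

end main

/-! ### Polar decomposition of a complex measure. -/

section complexMeasure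

variable {X : Type*} {mX : MeasurableSpace X}

theorem MeasureTheory.ComplexMeasure.absolutelyContinuous_variation (μ : ComplexMeasure X) :
    μ ≪ᵥ μ.variation.toENNRealVectorMeasure := by
  intro s hs
  by_cases hm : MeasurableSet s
  · rw [Measure.toENNRealVectorMeasure_apply_measurable hm] at hs
    exact (VectorMeasure.variation_apply_eq_zero hm).1 hs s le_rfl hm
  · exact μ.not_measurable hm

/-- The polar decomposition of a complex measure of finite variation. -/
theorem MeasureTheory.ComplexMeasure.exists_polarDecomposition (μ : ComplexMeasure X)
    [IsFiniteMeasure μ.variation] :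
    ∃ h : X → ℂ, Measurable h ∧ (∀ᵐ x ∂μ.variation, ‖h x‖ₑ = 1) ∧ Integrable h μ.variation ∧
      μ.variation.withDensityᵥ h = μ := by
  set ν := μ.variation
  have hac := (ComplexMeasure.absolutelyContinuous_ennreal_iff μ _).1
    μ.absolutelyContinuous_variation
  have hi : Integrable (μ.rnDeriv ν) ν := ComplexMeasure.integrable_rnDeriv μ ν
  -- Radon–Nikodym for the real and the imaginary part.
  have hd : ν.withDensityᵥ (μ.rnDeriv ν) = μ := by
    ext s hs : 1
    have h1 := SignedMeasure.withDensityᵥ_rnDeriv_eq _ ν hac.1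
    have h2 := SignedMeasure.withDensityᵥ_rnDeriv_eq _ ν hac.2
    rw [withDensityᵥ_apply hi hs]
    apply Complex.ext
    · have h3 := integral_re (hi.integrableOn (s := s))
      have h4 := congrArg (fun m : SignedMeasure X => m s) h1
      simp only [withDensityᵥ_apply (SignedMeasure.integrable_rnDeriv _ _) hs] at h4
      exact h3.symm.trans h4
    · have h3 := integral_im (hi.integrableOn (s := s))
      have h4 := congrArg (fun m : SignedMeasure X => m s) h2
      simp only [withDensityᵥ_apply (SignedMeasure.integrable_rnDeriv _ _) hs] at h4
      exact h3.symm.trans h4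
  have hm : Measurable (μ.rnDeriv ν) := measurable_of_re_im (𝕜 := ℂ)
    (SignedMeasure.measurable_rnDeriv _ _) (SignedMeasure.measurable_rnDeriv _ _)
  refine ⟨μ.rnDeriv ν, hm, ?_, hi, hd⟩
  -- The variation of h dν is |h| dν; here it is ν itself, which forces |h| = 1.
  have hv := Measure.variation_withDensityᵥ hi
  rw [hd] at hv
  have h5 : ν.withDensity (fun x => ‖μ.rnDeriv ν x‖ₑ) = ν.withDensity 1 := by
    rw [withDensity_one]; exact hv.symm
  exact (withDensity_eq_iff_of_sigmaFinite hm.enorm.aemeasurable aemeasurable_const).1 h5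

/-- Both sides are linear and L¹-continuous in `f`, the right one because |h| = 1, and they agree on
indicators. -/
theorem MeasureTheory.ComplexMeasure.integral_eq_of_withDensity (μ : ComplexMeasure X)
    [IsFiniteMeasure μ.variation] {h : X → ℂ} (hm : Measurable h)
    (h1 : ∀ᵐ x ∂μ.variation, ‖h x‖ₑ = 1) (hi : Integrable h μ.variation)
    (hd : μ.variation.withDensityᵥ h = μ) {f : X → ℂ} (hf : Integrable f μ.variation) :
    μ.integral f (ContinuousLinearMap.mul ℝ ℂ) = ∫ x, f x * h x ∂μ.variation := by
  set ν := μ.variation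
  have hn : ∀ᵐ x ∂ν, ‖h x‖ = 1 := by
    filter_upwards [h1] with x hx
    rw [← toReal_enorm, hx, ENNReal.toReal_one]
  have hmul : ∀ {g : X → ℂ}, Integrable g ν → Integrable (fun x => g x * h x) ν := fun hg =>
    hg.mul_bdd (c := 1) hm.aestronglyMeasurable (hn.mono fun x hx => hx.le)
  refine Integrable.induction (fun f => μ.integral f (ContinuousLinearMap.mul ℝ ℂ) =
    ∫ x, f x * h x ∂ν) ?_ ?_ ?_ ?_ hf
  · intro c s hs hsν
    rw [VectorMeasure.integral_eq_setToFun, setToFun_indicator_const _ hs hsν.ne]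
    have e : ∀ x, s.indicator (fun _ => c) x * h x = s.indicator (fun x => c * h x) x := fun x => by
      by_cases hx : x ∈ s <;> simp [hx]
    simp_rw [e]
    rw [integral_indicator hs, integral_const_mul]
    have h2 : μ s = ∫ x in s, h x ∂ν := by
      conv_lhs => rw [← hd]
      exact withDensityᵥ_apply hi hs
    rw [← h2]
    rfl
  · intro f g _ hf hg h2 h3
    rw [VectorMeasure.integral_add hf hg, h2, h3, ← integral_add (hmul hf) (hmul hg)]
    simp [add_mul]
  · refine isClosed_eq VectorMeasure.continuous_integral ?_
    refine (LipschitzWith.of_dist_le_mul (K := 1) fun f g => ?_).continuous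
    rw [NNReal.coe_one, one_mul, dist_eq_norm, dist_eq_norm, L1.norm_eq_integral_norm,
      ← integral_sub (hmul (L1.integrable_coeFn f)) (hmul (L1.integrable_coeFn g))]
    refine (norm_integral_le_integral_norm _).trans (le_of_eq (integral_congr_ae ?_))
    filter_upwards [hn, Lp.coeFn_sub f g] with x hx hx2
    rw [hx2, Pi.sub_apply, ← sub_mul, norm_mul, hx, mul_one]
  · intro f g hfg _ h2
    rw [← VectorMeasure.integral_congr_ae hfg, h2]
    refine integral_congr_ae ?_
    filter_upwards [hfg] with x hx
    rw [hx]

end complexMeasure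

/-! ### Moments of μ and smoothness of f. -/

section moments

variable {θ : ℝ} {ν : Measure ℝ}

theorem exists_growthScale_le (hθ : 0 < θ) (hθ1 : θ ≤ 1) :
    ∃ c : ℝ, ∀ t, 0 ≤ t → growthScale θ t ≤ c + 6 * (t ^ θ * Real.log t) := by
  have he : 1 ≤ Real.exp 1 := Real.one_le_exp zero_le_one
  -- The first term bounds the scale for t ≤ e, and 6/θ compensates for t^θ log t ≥ -1/θ being
  -- negative near 0. For t ≥ e the factor 6 is 2 from (1 + t)^θ ≤ 2t^θ times 3 from 1 + log(1 + t)
  -- ≤ 3 log t.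
  refine ⟨(1 + Real.exp 1) ^ θ * (1 + Real.log (1 + Real.exp 1)) + 6 * (1 / θ), fun t ht => ?_⟩
  have hpos : 0 ≤ (1 + Real.exp 1) ^ θ * (1 + Real.log (1 + Real.exp 1)) := by
    have := Real.log_nonneg (show (1 : ℝ) ≤ 1 + Real.exp 1 by linarith)
    positivity
  rcases le_total (Real.exp 1) t with h | h
  · have ht1 : 1 ≤ t := he.trans h
    have ht0 : 0 < t := by linarith
    have hl : 1 ≤ Real.log t := (Real.le_log_iff_exp_le ht0).2 h
    have h1 : Real.log (1 + t) ≤ 1 + Real.log t := by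
      have h2 : Real.log (1 + t) ≤ Real.log (Real.exp 1 * t) := by
        refine Real.log_le_log (by linarith) ?_
        nlinarith [Real.add_one_le_exp 1]
      rwa [Real.log_mul (Real.exp_pos 1).ne' ht0.ne', Real.log_exp] at h2
    have h3 : (1 + t) ^ θ ≤ 2 * t ^ θ := by
      calc (1 + t) ^ θ ≤ (2 * t) ^ θ := by gcongr; linarith
        _ = 2 ^ θ * t ^ θ := Real.mul_rpow (by norm_num) ht
        _ ≤ 2 ^ (1 : ℝ) * t ^ θ := by gcongr; norm_num
        _ = _ := by rw [Real.rpow_one]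
    have h4 : growthScale θ t ≤ 6 * (t ^ θ * Real.log t) := by
      calc growthScale θ t ≤ (2 * t ^ θ) * (3 * Real.log t) := by
            unfold growthScale
            gcongr
            · have := Real.log_nonneg (show 1 ≤ 1 + t by linarith)
              linarith
            · linarith
        _ = _ := by ring
    have : 0 ≤ 1 / θ := by positivity
    linarith
  · have h1 : growthScale θ t ≤ (1 + Real.exp 1) ^ θ * (1 + Real.log (1 + Real.exp 1)) := by
      unfold growthScale
      have := Real.log_nonneg (show 1 ≤ 1 + t by linarith)
      gcongr
    have h2 : -(1 / θ) ≤ t ^ θ * Real.log t := by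
      rcases ht.eq_or_lt with rfl | ht0
      · simp [hθ.le]
      rcases le_total t 1 with ht1 | ht1
      · have := (abs_lt.1 (Real.abs_log_mul_self_rpow_lt t θ ht0 ht1 hθ)).1
        linarith
      · have h3 : 0 ≤ t ^ θ * Real.log t := mul_nonneg (by positivity) (Real.log_nonneg ht1)
        have : 0 ≤ 1 / θ := by positivity
        linarith
    linarith

theorem lintegral_isSubexp_lt_top (hθ : 0 < θ) (hθ1 : θ ≤ 1)
    (hexp : ∀ l : ℝ, 0 < l →
      ∫⁻ ξ, ENNReal.ofReal (Real.exp (l * (|ξ| ^ θ * Real.log |ξ|))) ∂ν < ⊤)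
    {g : ℝ → ℝ≥0∞} (hg : IsSubexp θ g) : ∫⁻ ξ, g |ξ| ∂ν < ⊤ := by
  obtain ⟨C, a, hC, ha, hb⟩ := hg
  obtain ⟨c, hc⟩ := exists_growthScale_le hθ hθ1
  -- Using a + 1 in place of a keeps the exponent parameter positive when a = 0.
  have h1 : ∀ ξ : ℝ, g |ξ| ≤ ENNReal.ofReal (C * Real.exp ((a + 1) * c)) *
      ENNReal.ofReal (Real.exp ((a + 1) * 6 * (|ξ| ^ θ * Real.log |ξ|))) := fun ξ => by
    refine (hb _ (abs_nonneg ξ)).trans ?_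
    rw [← ENNReal.ofReal_mul (by positivity), mul_assoc, ← Real.exp_add]
    have h2 := growthScale_nonneg hθ.le (abs_nonneg ξ)
    have h3 := mul_le_mul_of_nonneg_left (hc _ (abs_nonneg ξ)) (show 0 ≤ a + 1 by linarith)
    refine ENNReal.ofReal_le_ofReal (mul_le_mul_of_nonneg_left (Real.exp_le_exp.2 ?_) hC)
    linarith
  refine (lintegral_mono h1).trans_lt ?_
  rw [lintegral_const_mul' _ _ ENNReal.ofReal_ne_top]
  exact ENNReal.mul_lt_top ENNReal.ofReal_lt_top (hexp _ (by positivity))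

theorem IsSubexp.pow {g : ℝ → ℝ≥0∞} (hg : IsSubexp θ g) (m : ℕ) :
    IsSubexp θ fun t => g t ^ m := by
  induction m with
  | zero => simpa using isSubexp_const (θ := θ) ENNReal.one_ne_top
  | succ m ih => simpa only [pow_succ] using ih.mul hg

theorem integrable_abs_pow (hθ : 0 < θ) (hθ1 : θ ≤ 1)
    (hexp : ∀ l : ℝ, 0 < l →
      ∫⁻ ξ, ENNReal.ofReal (Real.exp (l * (|ξ| ^ θ * Real.log |ξ|))) ∂ν < ⊤) (m : ℕ) :
    Integrable (fun ξ : ℝ => |ξ| ^ m) ν := by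
  refine ⟨by fun_prop, ?_⟩
  have h := lintegral_isSubexp_lt_top hθ hθ1 hexp ((isSubexp_ofReal hθ.le).pow m)
  refine lt_of_le_of_lt (lintegral_mono fun ξ => ?_) h
  rw [enorm_pow, ← ofReal_norm, norm_abs_eq_norm, Real.norm_eq_abs]

/-- All moments are finite, so one may differentiate under the integral. The form -(2π)⁻¹ ξt
converts the kernel e^{-2πi·} into e^{iξt}. -/
theorem contDiff_integral_exp_mul {h : ℝ → ℂ} (h1 : ∀ᵐ ξ ∂ν, ‖h ξ‖ = 1)
    (hint : ∀ m : ℕ, Integrable (fun ξ : ℝ => |ξ| ^ m) ν) :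
    ContDiff ℝ ∞ fun t : ℝ => ∫ ξ, Complex.exp (Complex.I * ξ * t) * h ξ ∂ν := by
  set L : ℝ →L[ℝ] ℝ →L[ℝ] ℝ := (-(2 * Real.pi)⁻¹) • ContinuousLinearMap.mul ℝ ℝ
  have h2 := VectorFourier.contDiff_fourierIntegral (μ := ν) (f := h) L (N := ⊤) fun m _ =>
    (hint m).congr (by
      filter_upwards [h1] with ξ hξ
      rw [hξ, mul_one, Real.norm_eq_abs])
  suffices e : (fun t : ℝ => ∫ ξ, Complex.exp (Complex.I * ξ * t) * h ξ ∂ν) =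
      VectorFourier.fourierIntegral Real.fourierChar ν L.toLinearMap₁₂ h by
    rw [e]; exact h2
  ext t
  unfold VectorFourier.fourierIntegral
  refine integral_congr_ae (.of_forall fun ξ => ?_)
  simp only [Circle.smul_def, smul_eq_mul, Real.fourierChar_apply]
  congr 2
  have hpi : (Real.pi : ℂ) ≠ 0 := by exact_mod_cast Real.pi_ne_zero
  simp [L]
  field_simp

end moments

/-! ### Superposition of exponentials. -/

section superposition

variable {n : ℕ} {ρ : EuclideanSpace ℝ (Fin n) → ℝ} {p q : ℝ≥0∞} [hp : Fact (1 ≤ p)] {θ : ℝ}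
  {ν : Measure ℝ} [IsFiniteMeasure ν] {h : ℝ → ℂ} {v : EuclideanSpace ℝ (Fin n) → ℝ}

theorem norm_exp_I_mul_mul_sub_one_le (ξ x : ℝ) :
    ‖Complex.exp (Complex.I * ξ * x) - 1‖ ≤ |ξ| * |x| := by
  have := Real.norm_exp_I_mul_ofReal_sub_one_le (x := ξ * x)
  rw [Complex.ofReal_mul, ← mul_assoc] at this
  simpa [abs_mul] using this

theorem norm_exp_I_mul_mul_sub_one_le_two (ξ x : ℝ) :
    ‖Complex.exp (Complex.I * ξ * x) - 1‖ ≤ 2 := by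
  refine (norm_sub_le _ _).trans ?_
  have : Complex.I * ξ * x = ((ξ * x : ℝ) : ℂ) * Complex.I := by push_cast; ring
  rw [this, Complex.norm_exp_ofReal_mul_I]
  norm_num

/-- Fubini, with the bound 2 |K| |h| on the integrand. -/
theorem kernelConv_integral_exp (K : 𝓢(EuclideanSpace ℝ (Fin n), ℂ)) (hv : Measurable v)
    (hm : Measurable h) (h1 : ∀ᵐ ξ ∂ν, ‖h ξ‖ = 1) (x : EuclideanSpace ℝ (Fin n)) :
    kernelConv K (fun y => ∫ ξ, (Complex.exp (Complex.I * ξ * v y) - 1) * h ξ ∂ν) x =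
      ∫ ξ, kernelConv K (fun y => Complex.exp (Complex.I * ξ * v y) - 1) x * h ξ ∂ν := by
  unfold kernelConv
  simp_rw [← integral_const_mul, ← integral_mul_const, ← mul_assoc]
  refine integral_integral_swap ?_
  have hK : Integrable (fun y => K (x - y)) volume :=
    memLp_one_iff_integrable.1 (K.memLp_comp_sub_left 1 x)
  have hh : Integrable h ν := ⟨hm.aestronglyMeasurable,
    (hasFiniteIntegral_const (1 : ℝ)).mono (h1.mono fun ξ hξ => by simp [hξ])⟩
  have hmeas : Measurable fun z : EuclideanSpace ℝ (Fin n) × ℝ =>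
      Complex.exp (Complex.I * z.2 * v z.1) - 1 := by fun_prop
  have h2 := (hK.mul_prod hh).bdd_mul (c := 2) hmeas.aestronglyMeasurable
    (.of_forall fun z => norm_exp_I_mul_mul_sub_one_le_two z.2 (v z.1))
  refine h2.congr (.of_forall fun z => ?_)
  simp only [Function.uncurry]
  ring

theorem measurable_kernelConv_exp (K : 𝓢(EuclideanSpace ℝ (Fin n), ℂ)) (hv : Measurable v) :
    Measurable fun z : EuclideanSpace ℝ (Fin n) × ℝ =>
      kernelConv K (fun y => Complex.exp (Complex.I * z.2 * v y) - 1) z.1 := by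
  have hK := K.continuous.measurable
  have h2 : Measurable fun z : (EuclideanSpace ℝ (Fin n) × ℝ) × EuclideanSpace ℝ (Fin n) =>
      K (z.1.1 - z.2) * (Complex.exp (Complex.I * z.1.2 * v z.2) - 1) := by
    fun_prop
  exact h2.stronglyMeasurable.integral_prod_right.measurable

theorem IsWindow.boxNorm_integral_exp_le (hρ : IsWindow ρ) (hp' : p ≠ ⊤) (hv : Measurable v)
    (hm : Measurable h) (h1 : ∀ᵐ ξ ∂ν, ‖h ξ‖ = 1) (k : Fin n → ℤ) :
    (Measurable fun ξ : ℝ =>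
        hρ.boxNorm p k (fun y => Complex.exp (Complex.I * ξ * v y) - 1)) ∧
    hρ.boxNorm p k (fun y => ∫ ξ, (Complex.exp (Complex.I * ξ * v y) - 1) * h ξ ∂ν) ≤
      ∫⁻ ξ : ℝ, hρ.boxNorm p k (fun y => Complex.exp (Complex.I * ξ * v y) - 1) ∂ν := by
  have hp0 : p ≠ 0 := (zero_lt_one.trans_le hp.out).ne'
  set f : EuclideanSpace ℝ (Fin n) → ℝ → ℂ := fun x ξ =>
    kernelConv (hρ.boxKernel k) (fun y => Complex.exp (Complex.I * ξ * v y) - 1) x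
  have hf : Measurable (Function.uncurry fun x ξ => ‖f x ξ‖ₑ) :=
    (measurable_kernelConv_exp (hρ.boxKernel k) hv).enorm
  have hb : ∀ ξ : ℝ, hρ.boxNorm p k (fun y => Complex.exp (Complex.I * ξ * v y) - 1) =
      (∫⁻ x, ‖f x ξ‖ₑ ^ p.toReal) ^ (1 / p.toReal) := fun ξ =>
    eLpNorm_eq_lintegral_rpow_enorm_toReal hp0 hp'
  simp_rw [hb]
  constructor
  · exact (Measurable.lintegral_prod_left (hf.pow_const p.toReal)).pow_const _
  · refine le_trans ?_ (lintegral_rpow_lintegral_le (toReal_pos_of_one_le hp.out hp') hf)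
    rw [IsWindow.boxNorm, eLpNorm_eq_lintegral_rpow_enorm_toReal hp0 hp']
    gcongr with x
    rw [kernelConv_integral_exp _ hv hm h1]
    refine (enorm_integral_le_lintegral_enorm _).trans (lintegral_mono_ae ?_)
    filter_upwards [h1] with ξ hξ
    rw [enorm_mul, ← ofReal_norm (h ξ), hξ, ENNReal.ofReal_one, mul_one]

theorem IsWindow.gevreyNorm_integral_exp_le (hρ : IsWindow ρ) (hp' : p ≠ ⊤) (hq : 1 ≤ q)
    (hv : Measurable v) (hm : Measurable h) (h1 : ∀ᵐ ξ ∂ν, ‖h ξ‖ = 1) :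
    hρ.gevreyNorm θ p q (fun y => ∫ ξ, (Complex.exp (Complex.I * ξ * v y) - 1) * h ξ ∂ν) ≤
      ∫⁻ ξ : ℝ, hρ.gevreyNorm θ p q (fun y => Complex.exp (Complex.I * ξ * v y) - 1) ∂ν := by
  have hb := hρ.boxNorm_integral_exp_le hp' hv hm h1
  refine le_trans (lqNorm_mono fun k => ?_) (lqNorm_lintegral_le hq fun k =>
    (hb k).1.const_mul (subexpWeight θ 1 k))
  rw [lintegral_const_mul _ (hb k).1]
  gcongr
  exact (hb k).2

/-- From |e^{iξv} - 1| ≤ |ξ| |v| and the finite first moment; subtracting 1 is essential here. -/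
theorem memLp_integral_exp (hv : Measurable v) (hvp : MemLp v p volume)
    (hm : Measurable h) (h1 : ∀ᵐ ξ ∂ν, ‖h ξ‖ = 1) (hint : Integrable (fun ξ : ℝ => |ξ|) ν) :
    MemLp (fun y => ∫ ξ, (Complex.exp (Complex.I * ξ * v y) - 1) * h ξ ∂ν) p volume := by
  have hmeas : Measurable fun z : EuclideanSpace ℝ (Fin n) × ℝ =>
      (Complex.exp (Complex.I * z.2 * v z.1) - 1) * h z.2 := by fun_prop
  refine hvp.of_le_mul (c := ∫ ξ, |ξ| ∂ν)
    hmeas.stronglyMeasurable.integral_prod_right.aestronglyMeasurable (.of_forall fun y => ?_)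
  rw [← integral_mul_const]
  refine norm_integral_le_of_norm_le (hint.mul_const _) ?_
  filter_upwards [h1] with ξ hξ
  rw [norm_mul, hξ, mul_one]
  exact norm_exp_I_mul_mul_sub_one_le ξ (v y)

theorem IsWindow.gevreyModulationNorm_toLp (hρ : IsWindow ρ) (hp' : p ≠ ⊤) (s : ℝ)
    {F : EuclideanSpace ℝ (Fin n) → ℂ} (hF : MemLp F p volume) :
    gevreyModulationNorm ρ s p q (hF.toLp F) = hρ.gevreyNorm (1 / s) p q F := by
  simp only [gevreyModulationNorm, IsWindow.gevreyNorm, lqNorm, hρ.distLpNorm_boxOp hp',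
    hρ.enorm_kernelConvCLM_toLp hp', subexpWeight, one_mul]
  split_ifs with h
  · rfl
  · have h0 : 0 ≤ q.toReal := ENNReal.toReal_nonneg
    congr 2
    ext k
    rw [ENNReal.mul_rpow_of_nonneg _ _ h0, ENNReal.ofReal_rpow_of_nonneg (Real.exp_pos _).le h0,
      ← Real.exp_mul, mul_comm q.toReal]

theorem IsWindow.memGevreyModulation_iff (hρ : IsWindow ρ) (hp' : p ≠ ⊤) (s : ℝ)
    {F : EuclideanSpace ℝ (Fin n) → ℂ} :
    MemGevreyModulation ρ s p q F ↔ MemLp F p volume ∧ hρ.gevreyNorm (1 / s) p q F ≠ ⊤ := by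
  constructor
  · rintro ⟨hF, h⟩
    rw [hρ.gevreyModulationNorm_toLp hp'] at h
    exact ⟨hF, h.ne⟩
  · rintro ⟨hF, h⟩
    refine ⟨hF, ?_⟩
    rw [hρ.gevreyModulationNorm_toLp hp']
    exact lt_top_iff_ne_top.2 h

end superposition

/-! ### Assembly of the theorem. -/

theorem mainTheorem3 {n : ℕ} (hn : 1 ≤ n) (ρ : EuclideanSpace ℝ (Fin n) → ℝ) (hρ : IsWindow ρ)
    (s : ℝ) (hs : 1 < s) (p q : ℝ≥0∞) [Fact (1 ≤ p)] (hp : 1 < p) (hp' : p < ⊤) (hq : 1 ≤ q)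
    (μ : ComplexMeasure ℝ) (hμ : μ Set.univ = 0)
    (hexp : ∀ l : ℝ, 0 < l →
      ∫⁻ ξ, ENNReal.ofReal (Real.exp (l * (|ξ| ^ (1 / s) * Real.log |ξ|))) ∂μ.variation < ⊤) :
    ContDiff ℝ ∞ (measureFourierInv μ) ∧
      ∀ u : EuclideanSpace ℝ (Fin n) → ℝ,
        MemGevreyModulation ρ s p q (fun x => (u x : ℂ)) →
          MemGevreyModulation ρ s p q (fun x => measureFourierInv μ (u x)) := by
  have h0 : 0 < 1 / s := by positivity
  have h1 : 1 / s < 1 := (div_lt_one (by linarith)).2 hs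
  have hint := integrable_abs_pow h0 h1.le hexp
  -- Finiteness of the variation is the moment of order zero.
  have hfin : IsFiniteMeasure μ.variation := by
    have := hint 0
    simp only [pow_zero] at this
    exact (integrable_const_iff_isFiniteMeasure one_ne_zero).1 this
  obtain ⟨h, hm, hh1, hhi, hd⟩ := μ.exists_polarDecomposition
  have hn1 : ∀ᵐ ξ ∂μ.variation, ‖h ξ‖ = 1 := by
    filter_upwards [hh1] with ξ hξ
    rw [← toReal_enorm, hξ, ENNReal.toReal_one]
  set c : ℂ := ((1 / Real.sqrt (2 * Real.pi) : ℝ) : ℂ)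
  have hbdd : ∀ t : ℝ, Integrable (fun ξ : ℝ => Complex.exp (Complex.I * ξ * t)) μ.variation :=
    fun t => by
      refine Integrable.of_bound (by fun_prop) 1 (.of_forall fun ξ => ?_)
      have : Complex.I * ξ * t = ((ξ * t : ℝ) : ℂ) * Complex.I := by push_cast; ring
      rw [this, Complex.norm_exp_ofReal_mul_I]
  have hrep : ∀ t, measureFourierInv μ t =
      c * ∫ ξ, Complex.exp (Complex.I * ξ * t) * h ξ ∂μ.variation := fun t => by
    rw [measureFourierInv, μ.integral_eq_of_withDensity hm hh1 hhi hd (hbdd t)]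
  have hzero : ∫ ξ, h ξ ∂μ.variation = 0 := by
    have h2 := withDensityᵥ_apply hhi MeasurableSet.univ
    rw [hd, hμ, setIntegral_univ] at h2
    exact h2.symm
  -- Because μ(ℝ) = 0, the constant 1 may be subtracted for free.
  have hrep' : ∀ t : ℝ, measureFourierInv μ t =
      c * ∫ ξ, (Complex.exp (Complex.I * ξ * t) - 1) * h ξ ∂μ.variation := fun t => by
    have h2 : Integrable (fun ξ : ℝ => Complex.exp (Complex.I * ξ * t) * h ξ) μ.variation :=
      (hbdd t).mul_bdd (c := 1) hm.aestronglyMeasurable (hn1.mono fun ξ hξ => hξ.le)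
    simp_rw [sub_mul, one_mul]
    rw [integral_sub h2 hhi, hzero, sub_zero, hrep]
  refine ⟨?_, fun u hu => ?_⟩
  · rw [show measureFourierInv μ = fun t : ℝ => c * _ from funext hrep]
    exact contDiff_const.mul (contDiff_integral_exp_mul hn1 hint)
  · rw [hρ.memGevreyModulation_iff hp'.ne] at hu ⊢
    obtain ⟨huL, huN⟩ := hu
    have huL' : MemLp u p volume := by simpa using huL.re
    -- A Borel representative of u provides the joint measurability in (ξ, x) needed for Fubini and
    -- Minkowski.
    set v := huL'.1.mk u
    have hv : Measurable v := huL'.1.stronglyMeasurable_mk.measurable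
    have huv : u =ᵐ[volume] v := huL'.1.ae_eq_mk
    obtain ⟨g, hg, hb⟩ := hρ.exists_gevreyNorm_exp_le hp'.ne hq h0 h1 huL huN
    have hae : (fun x => measureFourierInv μ (u x)) =ᵐ[volume] fun x =>
        c * ∫ ξ, (Complex.exp (Complex.I * ξ * v x) - 1) * h ξ ∂μ.variation := by
      filter_upwards [huv] with x hx
      rw [hrep', hx]
    have hint1 : Integrable (fun ξ : ℝ => |ξ|) μ.variation := by simpa using hint 1
    have hL := memLp_integral_exp hv (huL'.ae_eq huv) hm hn1 hint1
    refine ⟨(hL.const_mul c).ae_eq hae.symm, ?_⟩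
    rw [hρ.gevreyNorm_congr_ae hae, hρ.gevreyNorm_const_mul hq]
    refine ENNReal.mul_ne_top enorm_ne_top (ne_top_of_le_ne_top
      (lintegral_isSubexp_lt_top h0 h1.le hexp hg).ne
      ((hρ.gevreyNorm_integral_exp_le hp'.ne hq hv hm hn1).trans (lintegral_mono fun ξ => ?_)))
    refine le_trans (le_of_eq ?_) (hb ξ)
    refine hρ.gevreyNorm_congr_ae ?_
    filter_upwards [huv] with x hx
    rw [hx]
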